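/- **Setting.** Let $\mathcal X$ be a finite set and, for $\varepsilon>0$, let $L=L(\varepsilon)$ be the generator of a jump process on $\mathcal X$ with rates $L_{ij}=\frac{c_{ij}}{m_i}e^{-h_{ij}/\varepsilon}$ for $i\ne j$ (and zero row sums), where $m_i>0$, $c_{ij}=c_{ji}>0$, $0<h_{ij}\le+\infty$. Assume that $L$ is irreducible (any two points are joined by a chain of transitions with $h<\infty$) and reversible: there is $V:\mathcal X\to[0,\infty)$ with $V_i+h_{ij}=V_j+h_{ji}$ for all $i\neq j$. Let a finite group $G$ act on $\mathcal X$, let $\pi(g)_{ab}=1$ if $g(a)=b$ and $0$ otherwise, and assume $\pi(g)L=L\pi(g)$ for all $g\in G$ and $\varepsilon>0$. Assume absence of accidental degeneracy: if $h_{a_1b_1}=h_{a_2b_2}<\infty$ with $a_1\ne b_1$, $a_2\neq b_2$, then $g(\{a_1,b_1\})=\{a_2,b_2\}$ for some $g\in G$. **The restricted generator.** Let $\chi:G\to\mathbb C^*$ be a nontrivial one-dimensional representation of $G$, $P=\frac1{|G|}\sum_{g\in G}\overline{\chi(g)}\,\pi(g)$, and let $L^{(\chi)}$ be the restriction of $L$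 to the invariant subspace $P\,\mathbb C^{\mathcal X}$. An orbit of $G$ is *active* if the projector defined in the same way for the action of $G$ on this orbit has trace $1$ (equivalently, $\chi=1$ on the stabilisers of its points). Let $n_\chi$ be the number of active orbits. Fix a point $a_A$ in every orbit $A$, write $G_a$ for the stabiliser of $a$, and put $\varphi(b)=\chi(g)$ if $b=g(a_A)$ with $A$ active, and $\varphi(b)=0$ if the orbit of $b$ is inactive. For active $A$ let $u_A=\varphi\,\mathbf 1_A$, and $L^{(\chi)}_{AB}=\langle u_A,Lu_B\rangle/\langle u_A,u_A\rangle$. Adding an absorbing cemetery state $\dagger$, with a zero row and with a column that makes all row sums zero, gives a matrix $\widehat L$ indexed by the active orbits and $\dagger$. **The augmented process.** Let $\hat m_A=m_{a_A}/|G_{a_A}|$ and $\widehat V_A=V_{a_A}$. For active $A\ne B$ let $$\hat h_{AB}=\min_{a\in A,\,b\in B}h_{ab},\qquad \hat c_{AB}=\frac1{|G_{a_A}|}\sum_{b\in B:\ h_{a_Ab}=\hat h_{AB}}c_{a_Ab},$$ and let $$\hat h_{A\dagger}=\min\{h_{a_Ab}: b\ne a_A,\ \varphi(b)\neq1\},\qquad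 \hat c_{A\dagger}=\frac1{|G_{a_A}|}\Bigl|\sum_{b\neq a_A:\ \varphi(b)\ne1,\ h_{a_Ab}=\hat h_{A\dagger}}(1-\varphi(b))\,c_{a_Ab}\Bigr|$$ (a minimum over the empty set is $+\infty$). The augmented process has the rates $\frac{\hat c_{xy}}{\hat m_x}e^{-\hat h_{xy}/\varepsilon}$ out of active orbits $x$, and rate $0$ out of $\dagger$ ($\hat h_{\dagger y}=\infty$). Its saddle heights are $\widehat V_x+\hat h_{xy}$; the height of a path is the largest saddle height along it, and $\widehat H(x,M)$, for $x\notin M$, is the minimum, over all paths from $x$ to $M$, of the height of the path minus $\widehat V_x$. (A path from $x$ to $M$ has no repeated vertices and meets $M$ only at its end.) Let $\theta>0$ be such that 1. $h_{ab}>\hat h_{AB}$ with $a\in A$, $b\in B$, $A\ne B$ active, implies $h_{ab}\geq\hat h_{AB}+\theta$; and $h_{a_Ab}>\hat h_{A\dagger}$ with $A$ active, $b\ne a_A$, $\varphi(b)\ne1$ implies $h_{a_Ab}\ge\hat h_{A\dagger}+\theta$; 2. the augmented process satisfies the hypothesis of the asymmetric Eyring–Kramers theorem with this $\theta$: its $n_\chi+1$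 states can be ordered as $x_0\prec x_1\prec\dots\prec x_{n_\chi}$ so that, with $M_k=\{x_0,\dots,x_{k-1}\}$, for all $k=1,\dots,n_\chi$, $$\widehat H(x_k,M_k)\le\min_{i<k}\widehat H(x_i,M_{k+1}\setminus\{x_i\})-\theta ,$$ and there is an (unoriented) edge $e^*(k)$, of finite height $\widehat H(x_k,M_k)+\widehat V_{x_k}$, such that every minimal path from $x_k$ to $M_k$ reaches this height only on $e^*(k)$, while every non-minimal path from $x_k$ to $M_k$ reaches at least this height plus $\theta$. **Theorem.** Under these assumptions $x_0=\dagger$, and there are constants $C,\varepsilon_0>0$ such that for all $0<\varepsilon<\varepsilon_0$: * for all $x\ne y$, $|\widehat L_{xy}|=\frac{\hat c_{xy}}{\hat m_x}e^{-\hat h_{xy}/\varepsilon}[1+r_{xy}]$ with $|r_{xy}|\le Ce^{-\theta/\varepsilon}$ (that is, the augmented process is the leading-order part of $\widehat L$); * the spectrum of $L^{(\chi)}$ consists of exactly $n_\chi$ distinct eigenvalues $\lambda_1,\dots,\lambda_{n_\chi}$, which are real and of geometric multiplicity $1$; * these are the eigenvalues that the asymmetric Eyring–Kramers theorem gives for the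 augmented process, without the eigenvalue $0$ of the cemetery state: $$\lambda_k=-\frac{\hat c_{e^*(k)}}{\hat m_{x_k}}\,e^{-\widehat H(x_k,M_k)/\varepsilon}\,[1+r_k],\qquad |r_k|\leq Ce^{-\theta/\varepsilon},\qquad k=1,\dots,n_\chi .$$ -/

import Mathlib

open scoped ENNReal NNReal

noncomputable section

open scoped Classical in
/-- The factor `exp (-h / ε)`, equal to `0` when `h = ∞`. -/
def arrhenius (h : ℝ≥0∞) (ε : ℝ) : ℝ :=
  if h = ⊤ then 0 else Real.exp (-h.toReal / ε)

/-- The data of a family (indexed by the noise intensity `ε > 0`) of jump processes on `S`: the rate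
from `i` to `j ≠ i` is `(c i j / m i) * exp (-h i j / ε)`, where `h i j = ∞` means that there is no
transition from `i` to `j`; `V i` is the height of the potential at `i`. Diagonal values of `c` and
`h` are never used. -/
structure JumpData (S : Type*) where
  m : S → ℝ
  c : S → S → ℝ
  h : S → S → ℝ≥0∞
  V : S → ℝ≥0

namespace JumpData

section General

variable {S : Type*} (D : JumpData S)

/-- The transition rate from `i` to `j ≠ i`. -/
def rate (ε : ℝ) (i j : S) : ℝ := D.c i j / D.m i * arrhenius (D.h i j) ε

open scoped Classical in
/-- The generator: off-diagonal elements are the rates, and row sums vanish. -/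
def gen [Fintype S] (ε : ℝ) : Matrix S S ℝ :=
  fun i j => if i = j then -∑ k ∈ Finset.univ.erase i, D.rate ε i k else D.rate ε i j

/-- The generator as a complex matrix. -/
def genC [Fintype S] (ε : ℝ) : Matrix S S ℂ := (D.gen ε).map (fun x : ℝ => (x : ℂ))

/-- Positivity and symmetry of the data, reversibility with respect to `m * exp (-V / ε)`, and
irreducibility. -/
structure IsReversible : Prop where
  m_pos : ∀ i, 0 < D.m i
  c_pos : ∀ i j, i ≠ j → 0 < D.c i j
  c_symm : ∀ i j, D.c i j = D.c j i
  h_pos : ∀ i j, i ≠ j → 0 < D.h i j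
  reversible : ∀ i j, i ≠ j → (D.V i : ℝ≥0∞) + D.h i j = (D.V j : ℝ≥0∞) + D.h j i
  irreducible : ∀ i j, Relation.ReflTransGen (fun x y => x ≠ y ∧ D.h x y ≠ ⊤) i j

/-- The height of the saddle crossed by a step from `i` to `j`. -/
def saddle (i j : S) : ℝ≥0∞ := D.V i + D.h i j

/-- The steps of a path. -/
def steps (γ : List S) : List (S × S) := γ.zip γ.tail

/-- The height of a path: the maximal saddle height met along it. -/
def pathHeight (γ : List S) : ℝ≥0∞ := ⨆ p ∈ steps γ, D.saddle p.1 p.2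

/-- `γ` is a path from `x` to the set `A`: it has no repeated vertices, starts at `x`, ends in `A`,
and does not meet `A` before its last vertex. -/
structure IsPathTo (A : Set S) (x : S) (γ : List S) : Prop where
  start : γ.head? = some x
  nodup : γ.Nodup
  finish : ∃ y ∈ A, γ.getLast? = some y
  avoids : ∀ z ∈ γ.dropLast, z ∉ A

/-- The lowest height of a path from `x` to `A`. -/
def passHeight (x : S) (A : Set S) : ℝ≥0∞ := ⨅ (γ : List S) (_ : IsPathTo A x γ), D.pathHeight γ

/-- The communication height `H(x, A)`, for `x ∉ A`: the minimum, over all paths `γ` from `x` to `A`,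
of the height of `γ` measured from `V x`. -/
def commHeight (x : S) (A : Set S) : ℝ≥0∞ := D.passHeight x A - D.V x

/-- The set `{σ 0, …, σ (k - 1)}` of the first `k` states for the order `σ`. -/
def firstStates {n : ℕ} (σ : Fin (n + 1) ≃ S) (k : ℕ) : Set S := {x | (σ.symm x : ℕ) < k}

/-- Metastable hierarchy with parameter `θ`. The states are ordered as `σ 0 ≺ σ 1 ≺ … ≺ σ n`, and
`e k` is the highest edge `e*` on the way from the state `σ (k + 1)` to the set
`{σ 0, …, σ k}` of its predecessors. Edges are unoriented. -/
structure IsMetastableHierarchy (θ : ℝ≥0) {n : ℕ} (σ : Fin (n + 1) ≃ S) (e : Fin n → S × S) :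
    Prop where
  order : ∀ (k : Fin n) (i : Fin (n + 1)), i < k.succ →
    D.commHeight (σ k.succ) (firstStates σ (k + 1)) + θ ≤
      D.commHeight (σ i) (firstStates σ (k + 2) \ {σ i})
  edge : ∀ k, (e k).1 ≠ (e k).2 ∧ D.h (e k).1 (e k).2 ≠ ⊤
  edge_height : ∀ k, D.saddle (e k).1 (e k).2 = D.passHeight (σ k.succ) (firstStates σ (k + 1))
  unique : ∀ (k : Fin n) (γ : List S), IsPathTo (firstStates σ (k + 1)) (σ k.succ) γ →
    D.pathHeight γ = D.passHeight (σ k.succ) (firstStates σ (k + 1)) →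
    ∀ p ∈ steps γ, D.saddle p.1 p.2 = D.passHeight (σ k.succ) (firstStates σ (k + 1)) →
      s(p.1, p.2) = s((e k).1, (e k).2)
  gap : ∀ (k : Fin n) (γ : List S), IsPathTo (firstStates σ (k + 1)) (σ k.succ) γ →
    D.pathHeight γ ≠ D.passHeight (σ k.succ) (firstStates σ (k + 1)) →
    D.saddle (e k).1 (e k).2 + θ ≤ D.pathHeight γ

/-- The value `- (c_{e*} / m_x) exp (-H(x, M) / ε)`, with `x = σ (k + 1)`, `M = {σ 0, …, σ k}` and
`e* = e k`, which the asymmetric Eyring-Kramers theorem gives for the eigenvalue attached to `x`. -/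
def kramersValue {n : ℕ} (σ : Fin (n + 1) ≃ S) (e : Fin n → S × S) (ε : ℝ) (k : Fin n) : ℝ :=
  -(D.c (e k).1 (e k).2 / D.m (σ k.succ) *
    arrhenius (D.commHeight (σ k.succ) (firstStates σ (k + 1))) ε)

end General

end JumpData

section Symmetry

variable {G : Type*} [Group G]

open scoped Classical in
/-- The permutation matrix of `g`. -/
def permMat (X : Type*) [MulAction G X] (g : G) : Matrix X X ℂ :=
  fun a b => if g • a = b then 1 else 0

/-- The projector associated with a one-dimensional representation `χ`. -/
def projMat (X : Type*) [MulAction G X] [Fintype G] (χ : G →* ℂˣ) : Matrix X X ℂ :=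
  (Fintype.card G : ℂ)⁻¹ • ∑ g : G, (starRingEnd ℂ (χ g : ℂ)) • permMat X g

/-- The invariant subspace of `ℂ^X` associated with `χ`. -/
def isotypic (X : Type*) [Fintype X] [MulAction G X] [Fintype G] (χ : G →* ℂˣ) :
    Submodule ℂ (X → ℂ) :=
  LinearMap.range (projMat X χ).mulVecLin

open scoped Classical in
/-- An orbit is active if the projector for the permutation action on this orbit has trace `1`. -/
def IsActive {X : Type*} [Fintype X] [MulAction G X] [Fintype G] (χ : G →* ℂˣ)
    (A : MulAction.orbitRel.Quotient G X) : Prop :=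
  (projMat A.orbit χ).trace = 1

/-- The set of active orbits. -/
abbrev ActiveOrbit (X : Type*) [Fintype X] [MulAction G X] [Fintype G] (χ : G →* ℂˣ) : Type _ :=
  {A : MulAction.orbitRel.Quotient G X // IsActive χ A}

/-- The number of active orbits. -/
def numActive (X : Type*) [Fintype X] [MulAction G X] [Fintype G] (χ : G →* ℂˣ) : ℕ :=
  Nat.card (ActiveOrbit X χ)

/-- The orbit of a point. -/
abbrev orbitOf (G : Type*) [Group G] {X : Type*} [MulAction G X] (a : X) :
    MulAction.orbitRel.Quotient G X :=
  Quotient.mk _ a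

open scoped Classical in
/-- The average of `χ g` over all `g` that map the chosen representative of the orbit of `b` to `b`.
On an active orbit it is the common value of these `χ g`; on an inactive orbit it vanishes. -/
def phase {X : Type*} [MulAction G X] [Fintype G] (χ : G →* ℂˣ)
    (rep : MulAction.orbitRel.Quotient G X → X) (b : X) : ℂ :=
  (Nat.card (MulAction.stabilizer G b) : ℂ)⁻¹ *
    ∑ g ∈ Finset.univ.filter (fun g : G => g • rep (orbitOf G b) = b), (χ g : ℂ)

open scoped Classical in
/-- The basis vector of the invariant subspace supported on the orbit `A`. -/
def basisVec {X : Type*} [MulAction G X] [Fintype G] (χ : G →* ℂˣ)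
    (rep : MulAction.orbitRel.Quotient G X → X) (A : MulAction.orbitRel.Quotient G X) : X → ℂ :=
  fun b => if orbitOf G b = A then phase χ rep b else 0

namespace JumpData

variable {X : Type*} (D : JumpData X)

/-- The generator is invariant under `G`: it commutes with all permutation matrices. -/
def IsInvariant (G : Type*) [Group G] [MulAction G X] [Fintype X] : Prop :=
  ∀ ε : ℝ, 0 < ε → ∀ g : G, permMat X g * D.genC ε = D.genC ε * permMat X g

/-- Absence of accidental degeneracy: transitions with equal finite exponents are related by the
symmetry group, as unordered pairs. -/
def IsNondegenerate (G : Type*) [Group G] [MulAction G X] : Prop :=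
  ∀ a₁ b₁ a₂ b₂ : X, a₁ ≠ b₁ → a₂ ≠ b₂ → D.h a₁ b₁ ≠ ⊤ → D.h a₁ b₁ = D.h a₂ b₂ →
    ∃ g : G, s(g • a₁, g • b₁) = s(a₂, b₂)

variable [Fintype X] [MulAction G X] [Fintype G]

variable {D} in
theorem genC_mapsTo (hinv : D.IsInvariant G) (χ : G →* ℂˣ) {ε : ℝ} (hε : 0 < ε) :
    ∀ u ∈ isotypic X χ, (D.genC ε).mulVecLin u ∈ isotypic X χ := by
  have key : projMat X χ * D.genC ε = D.genC ε * projMat X χ := by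
    simp only [projMat, Matrix.smul_mul, Matrix.mul_smul, Finset.sum_mul, Finset.mul_sum]
    congr 1
    refine Finset.sum_congr rfl fun g _ => ?_
    rw [hinv ε hε g]
  rintro u ⟨v, rfl⟩
  refine ⟨(D.genC ε).mulVecLin v, ?_⟩
  simp only [Matrix.mulVecLin_apply, Matrix.mulVec_mulVec, key]

variable {D} in
/-- The restriction of the generator to the invariant subspace associated with `χ`. -/
def restriction (hinv : D.IsInvariant G) (χ : G →* ℂˣ) {ε : ℝ} (hε : 0 < ε) :
    Module.End ℂ (isotypic X χ) :=
  (D.genC ε).mulVecLin.restrict (genC_mapsTo hinv χ hε)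

variable (χ : G →* ℂˣ) (rep : MulAction.orbitRel.Quotient G X → X)

/-- The matrix element `⟨u_A, L u_B⟩ / ⟨u_A, u_A⟩` of the restricted generator. -/
def restrictedEntry (ε : ℝ) (A B : MulAction.orbitRel.Quotient G X) : ℂ :=
  (star (basisVec χ rep A) ⬝ᵥ (D.genC ε).mulVec (basisVec χ rep B)) /
    (star (basisVec χ rep A) ⬝ᵥ basisVec χ rep A)

/-- The restricted generator, in the basis of the vectors `u_A` with `A` active, augmented by an
absorbing cemetery state `none`: the row of the cemetery is zero, and its column is such that all
row sums vanish. -/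
def augmentedMatrix (ε : ℝ) : Matrix (Option (ActiveOrbit X χ)) (Option (ActiveOrbit X χ)) ℂ
  | none, _ => 0
  | some A, some B => D.restrictedEntry χ rep ε A B
  | some A, none => -∑ᶠ B : ActiveOrbit X χ, D.restrictedEntry χ rep ε A B

/-- The minimal exponent `h*(A, B)` of a transition from the orbit `A` to the orbit `B`. -/
def orbitExponent (A B : MulAction.orbitRel.Quotient G X) : ℝ≥0∞ :=
  ⨅ (a : X) (b : X) (_ : orbitOf G a = A) (_ : orbitOf G b = B), D.h a b

/-- The exponent of the killing rate of the orbit `A`: the minimal exponent of a transition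
from its representative to a point `b` with phase different from `1`. This includes all `b` in
inactive orbits. -/
def killExponent (A : MulAction.orbitRel.Quotient G X) : ℝ≥0∞ :=
  ⨅ (b : X) (_ : b ≠ rep A) (_ : phase χ rep b ≠ 1), D.h (rep A) b

open scoped Classical in
/-- The coefficient `c*` for transitions between two orbits. -/
def orbitCoeff (A B : MulAction.orbitRel.Quotient G X) : ℝ :=
  (Nat.card (MulAction.stabilizer G (rep A)) : ℝ)⁻¹ *
    ∑ b ∈ Finset.univ.filter
      (fun b : X => orbitOf G b = B ∧ D.h (rep A) b = D.orbitExponent A B), D.c (rep A) b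

open scoped Classical in
/-- The coefficient for transitions from the orbit `A` to the cemetery. -/
def killCoeff (A : MulAction.orbitRel.Quotient G X) : ℝ :=
  (Nat.card (MulAction.stabilizer G (rep A)) : ℝ)⁻¹ *
    ‖∑ b ∈ Finset.univ.filter
      (fun b : X => b ≠ rep A ∧ phase χ rep b ≠ 1 ∧ D.h (rep A) b = D.killExponent χ rep A),
      (1 - phase χ rep b) * (D.c (rep A) b : ℂ)‖

/-- The augmented process: the jump process on the active orbits and the absorbing cemetery state
`none` whose rates are the leading-order parts of the (moduli of the) off-diagonal elements of the
augmented matrix. -/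
def augmented : JumpData (Option (ActiveOrbit X χ)) where
  m
    | none => 1
    | some A => D.m (rep A) / Nat.card (MulAction.stabilizer G (rep A.1))
  c
    | none, none => 0
    | some A, none => D.killCoeff χ rep A
    | none, some A => D.killCoeff χ rep A
    | some A, some B => D.orbitCoeff rep A B
  h
    | none, _ => ⊤
    | some A, none => D.killExponent χ rep A
    | some A, some B => D.orbitExponent A.1 B.1
  V
    | none => 0
    | some A => D.V (rep A)

/-- `θ` is a lower bound for the gap between the leading exponent and the other exponents
contributing to the same rate of the augmented process. -/
structure IsGap (θ : ℝ≥0) : Prop where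
  orbit : ∀ A B : ActiveOrbit X χ, A ≠ B → ∀ a b : X, orbitOf G a = A.1 → orbitOf G b = B.1 →
    D.orbitExponent A.1 B.1 < D.h a b → D.orbitExponent A.1 B.1 + θ ≤ D.h a b
  kill : ∀ (A : ActiveOrbit X χ) (b : X), b ≠ rep A → phase χ rep b ≠ 1 →
    D.killExponent χ rep A < D.h (rep A) b → D.killExponent χ rep A + θ ≤ D.h (rep A) b

end JumpData

end Symmetry

end

/-! In the basis $u_A$ the restricted generator is self-adjoint for the weights $\hat m_A
e^{-\widehat V_A/\varepsilon}$ (`restrictedMatrix_symm`), so its eigenvalues are real and can be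
read off from its Dirichlet form by min-max. That form is a sum over transitions out of the
representatives (`dirichlet_form_eq`): a transition to a point $b$ of another active orbit $B$
carries $|F_A-\varphi(b)F_B|^2/2$, and any other transition carries the killing energy
$\mathrm{Re}(1-\varphi(b))|F_A|^2$.

The edges $e^*(k)$ form a spanning tree of the augmented state space: contracting them in decreasing
order of $k$ merges the states one by one (`exists_clustering`). The ends of any other edge are
joined by tree edges lower by at least $\theta$ (`tree_or_lowConn`), so this edge carries only a
fraction $O(e^{-\theta/\varepsilon})$ of the tree energy.

Phases could spoil the comparison with the tree, and the triangle lemmas exclude this. If a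
transition between orbits $A$ and $B$ has phase different from $1$, then its reversal also has phase
different from $1$, so both orbits can be killed at the height of that transition. The triangle
$A,B,\dagger$ is then open at this height. It follows that leading transitions along a tree edge
between two orbits have phase $1$, and that no transition to another active orbit contributes to the
leading part of a tree edge to $\dagger$. What remains in this last part is a real sum, by
reversibility inside the orbit, so that its modulus is the sum of the killing energies. Altogether
the Dirichlet form is the tree energy up to a factor $1+O(e^{-\theta/\varepsilon})$
(`dirichlet_form_bounds`).

For the tree energy, functions vanishing on the predecessors of a state give the lower bound for its
eigenvalue (`lower_bound`), and functions constant on clusters give the upper one (`upper_bound`).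
The two agree with the Eyring–Kramers rate to relative order $e^{-\theta/\varepsilon}$. Rates of
different states differ by factors of order $e^{\theta/\varepsilon}$ at least, so the $n_\chi$
eigenvalues are distinct for small $\varepsilon$ and exhaust the spectrum. The asymptotics of
$\widehat L$ are a separate statement about leading exponents; there nondegeneracy makes all leading
phases between two orbits equal, so that the modulus of the sum is the sum of the coefficients. -/

noncomputable section

/-! ### Combinatorics of the hierarchy: clusters and the spanning tree of highest edges. -/

section Hierarchy

open Relation

theorem reflTransGen_mono {α : Type*} {r s : α → α → Prop} (hrs : ∀ a b, r a b → s a b) {a b : α}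
    (h : ReflTransGen r a b) : ReflTransGen s a b :=
  ReflTransGen.lift id hrs _ _ h

theorem reflTransGen_symm {α : Type*} {r : α → α → Prop} (hr : ∀ a b, r a b → r b a) {a b : α}
    (h : ReflTransGen r a b) : ReflTransGen r b a :=
  reflTransGen_mono (fun _ _ => hr _ _) h.swap

theorem exists_exit_of_reflTransGen {α : Type*} {R : α → α → Prop} {C : α → Prop} {a b : α}
    (hR : ReflTransGen R a b) (ha : C a) (hb : ¬ C b) : ∃ x y, C x ∧ ¬ C y ∧ R x y := by
  induction hR with
  | refl => exact absurd ha hb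
  | @tail y z _ hyz ih =>
    by_cases hy : C y
    · exact ⟨y, z, hy, hb, hyz⟩
    · exact ih hy

variable {n : ℕ}

/-- A metastable hierarchy on `{0, …, n}`, in terms of the relation `Q h a b`: the states `a` and
`b` are joined by a saddle of height at most `h`. The highest edge on the way from `k + 1` to
`{0, …, k}` joins `u k` to `v k` and has height `S k`. -/
structure GapHierarchy (Q : ℝ → Fin (n + 1) → Fin (n + 1) → Prop) (S : Fin n → ℝ)
    (u v : Fin n → Fin (n + 1)) (V : Fin (n + 1) → ℝ) (θ : ℝ) : Prop where
  pos : 0 < θ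
  symm : ∀ h a b, Q h a b → Q h b a
  mono : ∀ h h' a b, h ≤ h' → Q h a b → Q h' a b
  edge : ∀ k, Q (S k) (u k) (v k)
  edge_min : ∀ k h, Q h (u k) (v k) → S k ≤ h
  path : ∀ k, ∃ y, y ≤ k.castSucc ∧ ReflTransGen (Q (S k)) k.succ y
  gap : ∀ k h y, y ≤ k.castSucc →
    ReflTransGen (fun a b => Q h a b ∧ s(a, b) ≠ s(u k, v k)) k.succ y → S k + θ ≤ h
  order : ∀ (k : Fin n) (i y : Fin (n + 1)) (h : ℝ), 0 < i → i ≤ k.castSucc → y ≤ k.succ → y ≠ i →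
    ReflTransGen (Q h) i y → S k - V k.succ + θ ≤ h - V i

/-- A step along one of the edges `{u j, v j}` with `k ≤ j` whose height is at most `h - θ`. -/
def LowStep (S : Fin n → ℝ) (u v : Fin n → Fin (n + 1)) (θ : ℝ) (k : ℕ) (h : ℝ)
    (a b : Fin (n + 1)) : Prop :=
  ∃ j : Fin n, k ≤ j ∧ S j + θ ≤ h ∧ s(a, b) = s(u j, v j)

/-- Connection along the edges `{u j, v j}` with `k ≤ j` whose height is at most `h - θ`. -/
def LowConn (S : Fin n → ℝ) (u v : Fin n → Fin (n + 1)) (θ : ℝ) (k : ℕ) (h : ℝ) :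
    Fin (n + 1) → Fin (n + 1) → Prop :=
  ReflTransGen (LowStep S u v θ k h)

/-- A partition of the states into `k + 1` clusters, obtained by contraction of the edges
`{u j, v j}` with `k ≤ j`. -/
structure IsClustering (Q : ℝ → Fin (n + 1) → Fin (n + 1) → Prop) (S : Fin n → ℝ)
    (u v : Fin n → Fin (n + 1)) (θ : ℝ) (k : ℕ) (cl : Fin (n + 1) → Fin (n + 1)) : Prop where
  le : ∀ a, (cl a : ℕ) ≤ k
  fix : ∀ i : Fin (n + 1), (i : ℕ) ≤ k → cl i = i
  edge : ∀ j : Fin n, k ≤ j → cl (u j) = cl (v j)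
  out : ∀ a b h, cl a ≠ cl b → Q h a b → LowConn S u v θ k h (cl a) a
  inner : ∀ a b h, cl a = cl b → a ≠ b → Q h a b →
    (∃ j, s(a, b) = s(u j, v j)) ∨ LowConn S u v θ k h a b

variable {Q : ℝ → Fin (n + 1) → Fin (n + 1) → Prop} {S : Fin n → ℝ}
  {u v : Fin n → Fin (n + 1)} {V : Fin (n + 1) → ℝ} {θ : ℝ} {k : ℕ} {h h' : ℝ}
  {a b : Fin (n + 1)}

theorem LowStep.symm (H : LowStep S u v θ k h a b) : LowStep S u v θ k h b a := by
  obtain ⟨j, h1, h2, h3⟩ := H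
  exact ⟨j, h1, h2, by rw [Sym2.eq_swap, h3]⟩

theorem LowConn.symm (H : LowConn S u v θ k h a b) : LowConn S u v θ k h b a :=
  reflTransGen_symm (fun _ _ h => LowStep.symm h) H

theorem LowConn.mono {k' : ℕ} (hk : k' ≤ k) (hh : h ≤ h') (H : LowConn S u v θ k h a b) :
    LowConn S u v θ k' h' a b :=
  reflTransGen_mono (fun _ _ ⟨j, h1, h2, h3⟩ => ⟨j, hk.trans h1, h2.trans hh, h3⟩) H

theorem LowConn.trans {c : Fin (n + 1)} (H : LowConn S u v θ k h a b)
    (H' : LowConn S u v θ k h b c) : LowConn S u v θ k h a c :=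
  ReflTransGen.trans H H'

namespace GapHierarchy

variable (H : GapHierarchy Q S u v V θ)
include H

theorem of_sym2 {j : Fin n} (hab : s(a, b) = s(u j, v j)) : Q (S j) a b := by
  rcases Sym2.eq_iff.1 hab with ⟨rfl, rfl⟩ | ⟨rfl, rfl⟩
  · exact H.edge j
  · exact H.symm _ _ _ (H.edge j)

theorem le_of_sym2 {j : Fin n} (hab : s(a, b) = s(u j, v j)) (hQ : Q h a b) : S j ≤ h := by
  rcases Sym2.eq_iff.1 hab with ⟨rfl, rfl⟩ | ⟨rfl, rfl⟩
  · exact H.edge_min j _ hQ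
  · exact H.edge_min j _ (H.symm _ _ _ hQ)

theorem lowConn_reach (hc : LowConn S u v θ k h a b) : ReflTransGen (Q h) a b :=
  reflTransGen_mono (fun _ _ ⟨_, _, h2, h3⟩ =>
    H.mono _ _ _ _ (by linarith [H.pos]) (H.of_sym2 h3)) hc

/-- The edges used have height at most `h - θ < S j`, while `{u j, v j}` is not open below `S j`. -/
theorem lowConn_reach_ne {j : Fin n} (hlt : h < S j + θ) (hc : LowConn S u v θ k h a b) :
    ReflTransGen (fun a b => Q h a b ∧ s(a, b) ≠ s(u j, v j)) a b := by
  refine reflTransGen_mono (fun x y ⟨i, _, h2, h3⟩ => ⟨H.mono _ _ _ _ (by linarith [H.pos])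
    (H.of_sym2 h3), fun h4 => ?_⟩) hc
  have := H.le_of_sym2 h4 (H.of_sym2 h3)
  linarith

/-- By `out`, the ends `a` and `b` are joined to the representatives of their clusters by lower
edges. If `h < S j + θ`, these connections and the step from `a` to `b` would form a walk from `j +
1` to a smaller state that avoids `{u j, v j}`, against `gap`. -/
theorem exit_gap (j : Fin n) {cl : Fin (n + 1) → Fin (n + 1)}
    (hcl : IsClustering Q S u v θ (j + 1) cl) (ha : cl a = j.succ) (hb : cl b ≠ j.succ)
    (hQ : Q h a b) (hne : s(a, b) ≠ s(u j, v j)) : S j + θ ≤ h := by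
  by_contra! hlt
  have hab : cl a ≠ cl b := by rw [ha]; exact hb.symm
  have h1 := H.lowConn_reach_ne hlt (hcl.out a b h hab hQ)
  have h2 := H.lowConn_reach_ne hlt (hcl.out b a h hab.symm (H.symm _ _ _ hQ)).symm
  rw [ha] at h1
  have hle : cl b ≤ j.castSucc := by
    have h3 := hcl.le b
    have h4 : (cl b : ℕ) ≠ j + 1 := fun h => hb (Fin.ext (by simpa using h))
    rw [Fin.le_def, Fin.val_castSucc]
    omega
  exact absurd (H.gap j h (cl b) hle ((h1.tail ⟨hQ, hne⟩).trans h2)) (not_le.2 hlt)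

/-- A minimal path from `j + 1` has to leave its cluster at height at most `S j`, and `exit_gap`
leaves only one edge for this. -/
theorem edge_exits (j : Fin n) {cl : Fin (n + 1) → Fin (n + 1)}
    (hcl : IsClustering Q S u v θ (j + 1) cl) :
    ∃ x y, cl x = j.succ ∧ cl y ≠ j.succ ∧ s(x, y) = s(u j, v j) := by
  obtain ⟨y, hy, hpath⟩ := H.path j
  have hy' : (y : ℕ) ≤ j := by simpa [Fin.le_def] using hy
  obtain ⟨x, z, hx, hz, hQ⟩ := exists_exit_of_reflTransGen (C := fun a => cl a = j.succ) hpath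
    (hcl.fix _ (by simp)) (by
      rw [hcl.fix _ (by omega)]
      rintro rfl
      simp at hy')
  refine ⟨x, z, hx, hz, ?_⟩
  by_contra hne
  linarith [H.exit_gap j hcl hx hz hQ hne, H.pos]

/-- The merging of the cluster of `j + 1` into the one on the other side of its edge. -/
theorem clustering_step (j : Fin n) {cl : Fin (n + 1) → Fin (n + 1)}
    (hcl : IsClustering Q S u v θ (j + 1) cl) : ∃ cl', IsClustering Q S u v θ j cl' := by
  obtain ⟨x, y, hx, hy, hxy⟩ := H.edge_exits j hcl
  have hQ := H.of_sym2 hxy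
  have hne : cl x ≠ cl y := by rw [hx]; exact hy.symm
  have hyle : (cl y : ℕ) ≤ j := by
    have h3 := hcl.le y
    have h4 : (cl y : ℕ) ≠ j + 1 := fun h => hy (Fin.ext (by simpa using h))
    omega
  -- The edge `{u j, v j}` joins the cluster of `j + 1` to that of `y`, so a step into a third
  -- cluster is a different edge and `exit_gap` applies to it.
  have hmem : ∀ a b, cl a = j.succ → cl b ≠ j.succ → cl b ≠ cl y → s(a, b) ≠ s(u j, v j) := by
    intro a b _ hb hb' he
    rw [← hxy] at he
    rcases Sym2.eq_iff.1 he with ⟨rfl, rfl⟩ | ⟨rfl, rfl⟩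
    · exact hb' rfl
    · exact hb hx
  -- At heights from `S j + θ` on, `{u j, v j}` itself counts as a low edge and connects the two old
  -- representatives.
  have hxc : ∀ h, S j + θ ≤ h → LowConn S u v θ j h (j.succ) (cl y) := by
    intro h hh
    have hS : S j ≤ h := by linarith [H.pos]
    have h1 := (hcl.out x y _ hne hQ).mono (Nat.le_succ _) hS
    have h2 := (hcl.out y x _ hne.symm (H.symm _ _ _ hQ)).symm.mono (Nat.le_succ _) hS
    rw [hx] at h1
    exact (ReflTransGen.tail h1 ⟨j, le_rfl, hh, hxy⟩).trans h2
  refine ⟨fun a => if cl a = j.succ then cl y else cl a, ⟨?_, ?_, ?_, ?_, ?_⟩⟩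
  · intro a
    split_ifs with h
    · exact hyle
    · have h3 := hcl.le a
      have h4 : (cl a : ℕ) ≠ j + 1 := fun h' => h (Fin.ext (by simpa using h'))
      omega
  · intro i hi
    have : cl i = i := hcl.fix i (by omega)
    have hij : i ≠ j.succ := by rintro rfl; simp at hi
    simp [this, hij]
  · intro i hi
    rcases hi.eq_or_lt with h | h
    · obtain rfl : j = i := Fin.ext h
      rcases Sym2.eq_iff.1 hxy with ⟨h1, h2⟩ | ⟨h1, h2⟩ <;> simp [← h1, ← h2, hx, hy]
    · simp [hcl.edge i h]
  -- The cluster of `j + 1` has changed its representative to `cl y`. A step out of the merged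
  -- cluster from this part lies above `S j + θ`, so the new representative reaches `a` through
  -- `hxc`.
  · intro a b h hab hQab
    by_cases ha : cl a = j.succ
    · simp only [ha, if_true] at hab ⊢
      have hb : cl b ≠ j.succ := fun hb => by simp [hb] at hab
      simp only [hb, if_false] at hab
      have hgap := H.exit_gap j hcl ha hb hQab (hmem a b ha hb hab.symm)
      have h1 := hcl.out a b h (by rw [ha]; exact hb.symm) hQab
      rw [ha] at h1
      exact (hxc h hgap).symm.trans (h1.mono (Nat.le_succ _) le_rfl)
    · simp only [ha, if_false] at hab ⊢
      refine (hcl.out a b h ?_ hQab).mono (Nat.le_succ _) le_rfl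
      intro hab'
      rw [← hab'] at hab
      simp [ha] at hab
  -- Edges that become internal by the merging are `{u j, v j}` itself, or lie above `S j + θ` and
  -- are bypassed through `hxc`.
  · have key : ∀ a b h, cl a = j.succ → cl b = cl y → Q h a b →
        (∃ j, s(a, b) = s(u j, v j)) ∨ LowConn S u v θ j h a b := by
      intro a b h ha hb hQab
      by_cases he : s(a, b) = s(u j, v j)
      · exact Or.inl ⟨j, he⟩
      · right
        have hb' : cl b ≠ j.succ := by rw [hb]; exact hy
        have hab : cl a ≠ cl b := by rw [ha]; exact hb'.symm
        have hgap := H.exit_gap j hcl ha hb' hQab he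
        have h1 := (hcl.out a b h hab hQab).mono (Nat.le_succ _) le_rfl
        have h2 := (hcl.out b a h hab.symm (H.symm _ _ _ hQab)).mono (Nat.le_succ _) le_rfl
        rw [ha] at h1
        rw [hb] at h2
        exact (h1.symm.trans (hxc h hgap)).trans h2
    intro a b h hab hab' hQab
    by_cases heq : cl a = cl b
    · exact (hcl.inner a b h heq hab' hQab).imp id (fun h => h.mono (Nat.le_succ _) le_rfl)
    by_cases ha : cl a = j.succ
    · have hb : cl b ≠ j.succ := by rw [← ha]; exact fun h => heq h.symm
      simp only [ha, hb, if_true, if_false] at hab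
      exact key a b h ha hab.symm hQab
    · by_cases hb : cl b = j.succ
      · simp only [ha, hb, if_true, if_false] at hab
        refine (key b a h hb hab (H.symm _ _ _ hQab)).imp ?_ LowConn.symm
        rintro ⟨i, hi⟩
        exact ⟨i, by rw [Sym2.eq_swap, hi]⟩
      · simp only [ha, hb, if_false] at hab
        exact absurd hab heq

/-- Downward induction from the partition into singletons at level `n`. At level `0` a single
cluster is left, which is why the edges `{u j, v j}` connect all states. -/
theorem exists_clustering (hk : k ≤ n) : ∃ cl, IsClustering Q S u v θ k cl := by
  induction hk using Nat.decreasingInduction with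
  | self =>
    refine ⟨id, ⟨fun a => by simpa using Nat.lt_succ_iff.1 a.2, fun _ _ => rfl, fun j hj => ?_,
      fun _ _ _ _ _ => ReflTransGen.refl, fun a b h hab hne => absurd hab hne⟩⟩
    exact absurd j.2 (not_lt.2 hj)
  | of_succ k hk ih =>
    obtain ⟨cl, hcl⟩ := ih
    exact H.clustering_step ⟨k, hk⟩ hcl

/-- At level `i + 1` the edge of `i` joins two clusters, whereas the edges of all `j > i` have
already been contracted. -/
theorem edge_injective : Function.Injective (fun j => s(u j, v j)) := by
  have key : ∀ i j : Fin n, i < j → s(u i, v i) ≠ s(u j, v j) := by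
    intro i j hij he
    obtain ⟨cl, hcl⟩ := H.exists_clustering (k := i + 1) (by omega)
    obtain ⟨x, y, hx, hy, hxy⟩ := H.edge_exits i hcl
    have h1 := hcl.edge j hij
    rw [he] at hxy
    rcases Sym2.eq_iff.1 hxy with ⟨rfl, rfl⟩ | ⟨rfl, rfl⟩
    · exact hy (by rw [← h1, hx])
    · exact hy (by rw [h1, hx])
  intro i j hij
  rcases lt_trichotomy i j with h | h | h
  · exact absurd hij (key i j h)
  · exact h
  · exact absurd hij.symm (key j i h)

/-- An edge which is not one of the highest edges is high compared with the connection of its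
endpoints along the highest edges. -/
theorem tree_or_lowConn (hab : a ≠ b) (hQ : Q h a b) :
    (∃ j, s(a, b) = s(u j, v j)) ∨ LowConn S u v θ 0 h a b := by
  obtain ⟨cl, hcl⟩ := H.exists_clustering (k := 0) (by omega)
  refine hcl.inner a b h (Fin.ext ?_) hab hQ
  have := hcl.le a
  have := hcl.le b
  omega

/-- At level `j + 1` the cluster of `j + 1` contains `a` but not `0`. Whether or not it contains
`b`, one of the sides `{a, b}`, `{b, 0}` leaves it, and this side is not `{u j, v j}`. -/
theorem gap_of_triangle {j : Fin n} (hj : s(a, 0) = s(u j, v j)) (ha : a ≠ 0) (hb : b ≠ 0)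
    (hab : a ≠ b) (h1 : Q h a b) (h3 : Q h b 0) : S j + θ ≤ h := by
  obtain ⟨cl, hcl⟩ := H.exists_clustering (k := j + 1) (by omega)
  obtain ⟨x, y, hx, hy, hxy⟩ := H.edge_exits j hcl
  have h0 : cl 0 = 0 := hcl.fix 0 (by simp)
  have h0' : cl 0 ≠ j.succ := by rw [h0]; exact (Fin.succ_ne_zero j).symm
  have hca : cl a = j.succ := by
    rw [← hj] at hxy
    rcases Sym2.eq_iff.1 hxy with ⟨rfl, rfl⟩ | ⟨rfl, rfl⟩
    · exact hx
    · exact absurd hx h0'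
  by_cases hcb : cl b = j.succ
  · refine H.exit_gap j hcl hcb h0' h3 fun he => ?_
    rw [← hj] at he
    rcases Sym2.eq_iff.1 he with ⟨h, _⟩ | ⟨h, _⟩
    · exact hab h.symm
    · exact hb h
  · refine H.exit_gap j hcl hca hcb h1 fun he => ?_
    rw [← hj] at he
    rcases Sym2.eq_iff.1 he with ⟨_, h⟩ | ⟨h, _⟩
    · exact hb h
    · exact ha h

/-- One end of the edge lies in the cluster of `j + 1`, and its connection to `0` would be a second
exit at height `S j`. This is what excludes nontrivial phases on leading transitions between orbits.
-/
theorem not_triangle_of_edge (j : Fin n) (hu : u j ≠ 0) (hv : v j ≠ 0) :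
    ¬ (Q (S j) (u j) 0 ∧ Q (S j) (v j) 0) := by
  rintro ⟨h1, h2⟩
  obtain ⟨cl, hcl⟩ := H.exists_clustering (k := j + 1) (by omega)
  obtain ⟨x, y, hx, hy, hxy⟩ := H.edge_exits j hcl
  have h0 : cl 0 = 0 := hcl.fix 0 (by simp)
  have h0' : cl 0 ≠ j.succ := by rw [h0]; exact (Fin.succ_ne_zero j).symm
  have hx0 : Q (S j) x 0 := by
    rcases Sym2.eq_iff.1 hxy with ⟨rfl, rfl⟩ | ⟨rfl, rfl⟩ <;> assumption
  have := H.exit_gap j hcl hx h0' hx0 fun he => by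
    rcases Sym2.eq_iff.1 he with ⟨_, h⟩ | ⟨_, h⟩
    · exact hv h.symm
    · exact hu h.symm
  linarith [H.pos]

/-- The connection from `j + 1` to `{0, …, j}` in which the edge `{u j, v j}` is separated. -/
theorem exists_descent (j : Fin n) : ∃ x y p, p ≤ j.castSucc ∧ s(x, y) = s(u j, v j) ∧
    LowConn S u v θ 0 (S j) j.succ x ∧ LowConn S u v θ 0 (S j) y p := by
  obtain ⟨cl, hcl⟩ := H.exists_clustering (k := j + 1) (by omega)
  obtain ⟨x, y, hx, hy, hxy⟩ := H.edge_exits j hcl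
  have hQ := H.of_sym2 hxy
  have hne : cl x ≠ cl y := by rw [hx]; exact hy.symm
  refine ⟨x, y, cl y, ?_, hxy, ?_, ?_⟩
  · have h3 := hcl.le y
    have h4 : (cl y : ℕ) ≠ j + 1 := fun h => hy (Fin.ext (by simpa using h))
    rw [Fin.le_def, Fin.val_castSucc]
    omega
  · rw [← hx]
    exact (hcl.out x y _ hne hQ).mono (Nat.zero_le _) le_rfl
  · exact ((hcl.out y x _ hne.symm (H.symm _ _ _ hQ)).mono (Nat.zero_le _) le_rfl).symm

theorem exists_descent_lowConn (j : Fin n) :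
    ∃ p, p ≤ j.castSucc ∧ LowConn S u v θ 0 (S j + θ) j.succ p := by
  obtain ⟨x, y, p, hp, hxy, h1, h2⟩ := H.exists_descent j
  have hle : S j ≤ S j + θ := by linarith [H.pos]
  exact ⟨p, hp, (ReflTransGen.tail (h1.mono le_rfl hle) ⟨j, Nat.zero_le _, le_rfl, hxy⟩).trans
    (h2.mono le_rfl hle)⟩

/-- The minimal path from `i + 1` to its predecessors also leads to another of the states up to `j +
1`, so `order` at level `j` applies to it. This separates the eigenvalues. -/
theorem depth_anti {i j : Fin n} (hij : i < j) :
    S j - V j.succ + θ ≤ S i - V i.succ := by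
  obtain ⟨y, hy, hp⟩ := H.path i
  have hy' : (y : ℕ) ≤ i := by simpa [Fin.le_def] using hy
  refine H.order j i.succ y _ (Fin.succ_pos i) ?_ ?_ ?_ hp
  · simpa [Fin.le_def] using hij
  · rw [Fin.le_def, Fin.val_succ]; omega
  · rintro rfl; simp at hy'

/-- A state `j + 1` beyond `k + 1` is connected to `{0, …, k}` at a height which is low compared with
the depth of the well of `k + 1`. -/
theorem lowConn_of_lt (k : Fin n) : ∀ j : Fin n, k < j →
    ∃ p, p ≤ k.castSucc ∧ LowConn S u v θ 0 (V j.succ + (S k - V k.succ)) j.succ p := by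
  intro j
  induction j using WellFoundedLT.induction with
  | ind j ih =>
  intro hkj
  obtain ⟨p, hp, hc⟩ := H.exists_descent_lowConn j
  have hdepth := H.depth_anti hkj
  have hSj : S j + θ ≤ V j.succ + (S k - V k.succ) := by linarith
  have hpj : (p : ℕ) ≤ j := by simpa [Fin.le_def] using hp
  -- Read backwards, the connection leads from `p` up to `j + 1` at height `S j`, so `order` puts
  -- `p` lower than `j + 1` by `θ`. Hence the repeated descents stay under the height allowed at `j
  -- + 1`.
  have hV : p ≠ 0 → V p + θ ≤ V j.succ := fun hp0 => by
    have := H.order j p j.succ (S j) (Fin.pos_iff_ne_zero.2 hp0) hp le_rfl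
      (by rintro rfl; simp at hpj) ?_
    · linarith
    · refine (reflTransGen_mono ?_ hc.symm)
      rintro a b ⟨i, -, h2, h3⟩
      exact H.mono _ _ _ _ (by linarith) (H.of_sym2 h3)
  by_cases hpk : p ≤ k.castSucc
  · exact ⟨p, hpk, hc.mono le_rfl hSj⟩
  have hpk' : (k : ℕ) < p := by simpa [Fin.le_def] using hpk
  have hp0 : p ≠ 0 := by rintro rfl; simp at hpk'
  obtain ⟨i, rfl⟩ := Fin.exists_succ_eq.2 hp0
  have hVi := hV hp0
  simp only [Fin.val_succ] at hpk' hpj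
  -- If the descent stops at `k + 1` itself, one more descent is needed. Its height bound `S k + θ`
  -- is allowed because `V k.succ + θ ≤ V j.succ`.
  rcases (show k ≤ i by rw [Fin.le_def]; omega).eq_or_lt with rfl | hlt
  · obtain ⟨q, hq, hc'⟩ := H.exists_descent_lowConn k
    exact ⟨q, hq, (hc.mono le_rfl hSj).trans (hc'.mono le_rfl (by linarith))⟩
  · obtain ⟨q, hq, hc'⟩ := ih i (by rw [Fin.lt_def]; omega) hlt
    exact ⟨q, hq, (hc.mono le_rfl hSj).trans (hc'.mono le_rfl (by linarith [H.pos]))⟩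

/-- The bounds needed for trial functions that are constant on clusters. -/
theorem trial_bound (k : Fin n) {cl : Fin (n + 1) → Fin (n + 1)}
    (hcl : IsClustering Q S u v θ (k + 1) cl) (j : Fin n) (hjk : j < k)
    (hab : s(a, b) = s(u j, v j)) (hne : cl a ≠ cl b) (h0 : cl a ≠ 0) :
    S k - V k.succ + θ ≤ S j - V (cl a) := by
  have hQ := H.of_sym2 hab
  by_cases hk : cl a = k.succ
  · have := H.exit_gap k hcl hk (by rw [← hk]; exact hne.symm) hQ fun he => by
      exact hjk.ne (H.edge_injective (hab.symm.trans he))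
    rw [hk]
    linarith
  · have hle : (cl a : ℕ) ≤ k := by
      have h3 := hcl.le a
      have h4 : (cl a : ℕ) ≠ k + 1 := fun h => hk (Fin.ext (by simpa using h))
      omega
    refine H.order k (cl a) (cl b) _ (Fin.pos_iff_ne_zero.2 h0) (by simpa [Fin.le_def] using hle)
      (by simpa [Fin.le_def] using hcl.le b) hne.symm ?_
    -- The way out of the well of `cl a` goes through `{a, b}` to the other representative, all of
    -- it at height at most `S j`.
    have h1 := H.lowConn_reach (hcl.out a b _ hne hQ)
    have h2 := H.lowConn_reach (hcl.out b a _ hne.symm (H.symm _ _ _ hQ)).symm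
    exact (h1.tail hQ).trans h2

/-- From `cl y` one reaches `k + 1` at height `S k`, so by `order` the state `cl y`, unless it is
`0`, is lower than `k + 1` by `θ`. It therefore carries exponentially more mass, which controls the
cross term on this edge. -/
theorem trial_top (k : Fin n) {cl : Fin (n + 1) → Fin (n + 1)}
    (hcl : IsClustering Q S u v θ (k + 1) cl) : ∃ x y, s(x, y) = s(u k, v k) ∧
    cl x = k.succ ∧ cl y ≠ k.succ ∧ (cl y ≠ 0 → V (cl y) + θ ≤ V k.succ) := by
  obtain ⟨x, y, hx, hy, hxy⟩ := H.edge_exits k hcl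
  have hQ := H.of_sym2 hxy
  have hne : cl x ≠ cl y := by rw [hx]; exact hy.symm
  refine ⟨x, y, hxy, hx, hy, fun h0 => ?_⟩
  have h1 := H.lowConn_reach (hcl.out x y _ hne hQ)
  have h2 := H.lowConn_reach (hcl.out y x _ hne.symm (H.symm _ _ _ hQ))
  have hle : (cl y : ℕ) ≤ k := by
    have h3 := hcl.le y
    have h4 : (cl y : ℕ) ≠ k + 1 := fun h => hy (Fin.ext (by simpa using h))
    omega
  have := H.order k (cl y) (cl x) (S k) (Fin.pos_iff_ne_zero.2 h0)
    (by simpa [Fin.le_def] using hle) (by rw [hx]) hne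
    ((h2.tail (H.symm _ _ _ hQ)).trans
      (reflTransGen_symm (fun _ _ => H.symm _ _ _) h1))
  linarith

end GapHierarchy

end Hierarchy

/-! ### Min-max bounds for matrices self-adjoint with respect to weights. -/

section MinMax

open Matrix

variable {n : ℕ}

theorem Matrix.IsHermitian.exists_sorted_diagonalization {A : Matrix (Fin n) (Fin n) ℂ}
    (hA : A.IsHermitian) : ∃ (lam : Fin n → ℝ) (U : Matrix (Fin n) (Fin n) ℂ), Monotone lam ∧
      Uᴴ * U = 1 ∧ A * U = U * diagonal (fun i => (lam i : ℂ)) := by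
  set τ := Tuple.sort hA.eigenvalues
  have hU : (hA.eigenvectorUnitary : Matrix (Fin n) (Fin n) ℂ)ᴴ *
      (hA.eigenvectorUnitary : Matrix (Fin n) (Fin n) ℂ) = 1 :=
    (Matrix.mem_unitaryGroup_iff'.1 hA.eigenvectorUnitary.2)
  refine ⟨hA.eigenvalues ∘ τ, (hA.eigenvectorUnitary : Matrix (Fin n) (Fin n) ℂ).submatrix id τ,
    Tuple.monotone_sort _, ?_, ?_⟩
  · rw [conjTranspose_submatrix, ← submatrix_mul _ _ _ id _ Function.bijective_id, hU,
      submatrix_one_equiv]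
  · ext i j
    have := congrFun (hA.mulVec_eigenvectorBasis (τ j)) i
    simp only [mul_apply, submatrix_apply, id, diagonal_apply, eigenvectorUnitary_apply]
    simp only [mulVec, dotProduct, Pi.smul_apply] at this
    rw [this, Finset.sum_eq_single j]
    · simp [mul_comm]
    · intro b _ hb
      simp [hb]
    · simp

theorem star_dotProduct_self_re (f : Fin n → ℂ) : (star f ⬝ᵥ f).re = ∑ i, ‖f i‖ ^ 2 := by
  simp only [dotProduct, Pi.star_apply, Complex.re_sum]
  refine Finset.sum_congr rfl fun i _ => ?_
  rw [Complex.star_def, ← Complex.normSq_eq_conj_mul_self, Complex.ofReal_re,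
    Complex.normSq_eq_norm_sq]

theorem star_dotProduct_diagonal_re (lam : Fin n → ℝ) (f : Fin n → ℂ) :
    (star f ⬝ᵥ (diagonal (fun i => (lam i : ℂ)) *ᵥ f)).re = ∑ i, lam i * ‖f i‖ ^ 2 := by
  simp only [dotProduct, Pi.star_apply, Complex.re_sum, mulVec_diagonal]
  refine Finset.sum_congr rfl fun i _ => ?_
  rw [Complex.star_def, mul_left_comm, ← Complex.normSq_eq_conj_mul_self, ← Complex.ofReal_mul,
    Complex.ofReal_re, Complex.normSq_eq_norm_sq]

/-- **Min-max principle**: bounds of a Hermitian form on suitable subspaces give bounds of the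
ordered eigenvalues. -/
theorem Matrix.IsHermitian.exists_eigenvalue_bounds {A : Matrix (Fin n) (Fin n) ℂ}
    (hA : A.IsHermitian) {a b : Fin n → ℝ}
    (hlow : ∀ (k : Fin n) (f : Fin n → ℂ), (∀ i, i < k → f i = 0) →
      a k * (star f ⬝ᵥ f).re ≤ (star f ⬝ᵥ (A *ᵥ f)).re)
    (hup : ∀ k : Fin n, ∃ T : (Fin (k + 1) → ℂ) →ₗ[ℂ] (Fin n → ℂ), Function.Injective T ∧
      ∀ F, (star (T F) ⬝ᵥ (A *ᵥ (T F))).re ≤ b k * (star (T F) ⬝ᵥ (T F)).re) :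
    ∃ lam : Fin n → ℝ, ∀ k, a k ≤ lam k ∧ lam k ≤ b k ∧
      ∃ f : Fin n → ℂ, f ≠ 0 ∧ A *ᵥ f = (lam k : ℂ) • f := by
  obtain ⟨lam, U, hmono, hU, hAU⟩ := hA.exists_sorted_diagonalization
  have hU' : U * Uᴴ = 1 := mul_eq_one_comm.1 hU
  have hmass : ∀ c : Fin n → ℂ, (star (U *ᵥ c) ⬝ᵥ (U *ᵥ c)).re = ∑ i, ‖c i‖ ^ 2 := by
    intro c
    rw [star_mulVec, ← dotProduct_mulVec, mulVec_mulVec, hU, one_mulVec, star_dotProduct_self_re]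
  have hform : ∀ c : Fin n → ℂ, (star (U *ᵥ c) ⬝ᵥ (A *ᵥ (U *ᵥ c))).re =
      ∑ i, lam i * ‖c i‖ ^ 2 := by
    intro c
    rw [star_mulVec, ← dotProduct_mulVec, mulVec_mulVec, mulVec_mulVec, Matrix.mul_assoc, hAU, ← Matrix.mul_assoc, hU,
      Matrix.one_mul, star_dotProduct_diagonal_re]
  have hpos : ∀ c : Fin n → ℂ, c ≠ 0 → 0 < ∑ i, ‖c i‖ ^ 2 := by
    intro c hc
    obtain ⟨i, hi⟩ := Function.ne_iff.1 hc
    exact Finset.sum_pos' (fun _ _ => by positivity)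
      ⟨i, Finset.mem_univ _, by have : c i ≠ 0 := hi; positivity⟩
  refine ⟨lam, fun k => ⟨?_, ?_, ?_⟩⟩
  -- The span of the first `k + 1` eigenvectors has dimension larger than the number `k` of
  -- vanishing conditions, so it contains a nonzero vector admissible in `hlow`.
  · let emb : (Fin (k + 1) → ℂ) →ₗ[ℂ] (Fin n → ℂ) :=
      { toFun := fun c i => if h : (i : ℕ) < k + 1 then c ⟨i, h⟩ else 0
        map_add' := fun x y => by
          ext i
          by_cases h : (i : ℕ) < k + 1 <;>
            simp only [Pi.add_apply, h, dite_true, dite_false, add_zero]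
        map_smul' := fun r x => by
          ext i
          by_cases h : (i : ℕ) < k + 1 <;>
            simp only [Pi.smul_apply, h, dite_true, dite_false, smul_zero, RingHom.id_apply] }
    let res : (Fin n → ℂ) →ₗ[ℂ] (Fin k → ℂ) :=
      LinearMap.funLeft ℂ ℂ (fun i : Fin k => (⟨i, i.2.trans k.2⟩ : Fin n))
    obtain ⟨c, hc, hc0⟩ := (Submodule.ne_bot_iff _).1
      (LinearMap.ker_ne_bot_of_finrank_lt (f := res ∘ₗ U.mulVecLin ∘ₗ emb) (by simp))
    have hcz : emb c ≠ 0 := by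
      intro h
      apply hc0
      ext i
      have := congrFun h ⟨i, by omega⟩
      simpa only [emb, LinearMap.coe_mk, AddHom.coe_mk, i.2, dite_true, Fin.eta,
        Pi.zero_apply] using this
    have h1 := hlow k (U *ᵥ emb c) fun i hi => by
      have := congrFun (LinearMap.mem_ker.1 hc) ⟨i, hi⟩
      simpa [res, LinearMap.funLeft_apply] using this
    rw [hmass, hform] at h1
    have h2 : ∑ i, lam i * ‖emb c i‖ ^ 2 ≤ lam k * ∑ i, ‖emb c i‖ ^ 2 := by
      rw [Finset.mul_sum]
      refine Finset.sum_le_sum fun i _ => ?_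
      by_cases hi : (i : ℕ) < k + 1
      · exact mul_le_mul_of_nonneg_right (hmono (Fin.le_def.2 (by omega))) (by positivity)
      · simp only [emb, LinearMap.coe_mk, AddHom.coe_mk, hi, dite_false, norm_zero]
        simp
    exact le_of_mul_le_mul_right (h1.trans h2) (hpos _ hcz)
  -- Dually, the range of `T` has dimension `k + 1`, hence contains a nonzero vector orthogonal to
  -- the first `k` eigenvectors.
  · obtain ⟨T, hT, hTb⟩ := hup k
    let res : (Fin n → ℂ) →ₗ[ℂ] (Fin k → ℂ) :=
      LinearMap.funLeft ℂ ℂ (fun i : Fin k => (⟨i, i.2.trans k.2⟩ : Fin n))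
    obtain ⟨c, hc, hc0⟩ := (Submodule.ne_bot_iff _).1
      (LinearMap.ker_ne_bot_of_finrank_lt (f := res ∘ₗ Uᴴ.mulVecLin ∘ₗ T) (by simp))
    have hz : Uᴴ *ᵥ T c ≠ 0 := by
      intro h
      apply hc0
      apply hT
      have : U *ᵥ (Uᴴ *ᵥ T c) = 0 := by rw [h, mulVec_zero]
      rw [mulVec_mulVec, hU', one_mulVec] at this
      rw [this, map_zero]
    have hcomp : T c = U *ᵥ (Uᴴ *ᵥ T c) := by rw [mulVec_mulVec, hU', one_mulVec]
    have h1 := hTb c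
    rw [hcomp, hmass, hform] at h1
    have h2 : lam k * ∑ i, ‖(Uᴴ *ᵥ T c) i‖ ^ 2 ≤ ∑ i, lam i * ‖(Uᴴ *ᵥ T c) i‖ ^ 2 := by
      rw [Finset.mul_sum]
      refine Finset.sum_le_sum fun i _ => ?_
      by_cases hi : i < k
      · have := congrFun (LinearMap.mem_ker.1 hc) ⟨i, hi⟩
        have h0 : (Uᴴ *ᵥ T c) i = 0 := by
          simpa [res, LinearMap.funLeft_apply] using this
        simp [h0]
      · exact mul_le_mul_of_nonneg_right (hmono (not_lt.1 hi)) (by positivity)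
    exact le_of_mul_le_mul_right (h2.trans h1) (hpos _ hz)
  · refine ⟨U *ᵥ Pi.single k 1, ?_, ?_⟩
    · intro h
      have h2 := hmass (Pi.single k 1)
      have h3 := hpos (Pi.single k 1) (by simp)
      rw [h] at h2
      simp only [dotProduct_zero, Complex.zero_re] at h2
      linarith
    · rw [mulVec_mulVec, hAU, ← mulVec_mulVec]
      have : diagonal (fun i => (lam i : ℂ)) *ᵥ Pi.single k 1 =
          (lam k : ℂ) • (Pi.single k 1 : Fin n → ℂ) := by
        ext i
        rcases eq_or_ne i k with rfl | h
        · simp [mulVec_diagonal]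
        · simp [mulVec_diagonal, h]
      rw [this, mulVec_smul]

/-- Eigenvalue bounds for a matrix which is self-adjoint for the weights `μ`. -/
theorem exists_eigenvalue_bounds_of_weights {M : Matrix (Fin n) (Fin n) ℂ} {μ : Fin n → ℝ}
    (hμ : ∀ i, 0 < μ i) (hM : ∀ i j, (μ i : ℂ) * M i j = star ((μ j : ℂ) * M j i))
    {a b : Fin n → ℝ}
    (hlow : ∀ (k : Fin n) (f : Fin n → ℂ), (∀ i, i < k → f i = 0) →
      a k * ∑ i, μ i * ‖f i‖ ^ 2 ≤ -(∑ i, (μ i : ℂ) * (star (f i) * (M *ᵥ f) i)).re)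
    (hup : ∀ k : Fin n, ∃ T : (Fin (k + 1) → ℂ) →ₗ[ℂ] (Fin n → ℂ), Function.Injective T ∧
      ∀ F, -(∑ i, (μ i : ℂ) * (star (T F i) * (M *ᵥ (T F)) i)).re ≤
        b k * ∑ i, μ i * ‖T F i‖ ^ 2) :
    ∃ lam : Fin n → ℝ, ∀ k, a k ≤ -lam k ∧ -lam k ≤ b k ∧
      ∃ f : Fin n → ℂ, f ≠ 0 ∧ M *ᵥ f = (lam k : ℂ) • f := by
  set d : Fin n → ℂ := fun i => ((√(μ i) : ℝ) : ℂ) with hd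
  have hd0 : ∀ i, d i ≠ 0 := fun i =>
    Complex.ofReal_ne_zero.2 (Real.sqrt_pos.2 (hμ i)).ne'
  have hdd : ∀ i, d i * d i = μ i := fun i => by
    rw [hd, ← Complex.ofReal_mul, Real.mul_self_sqrt (hμ i).le]
  have hdstar : ∀ i, star (d i) = d i := fun i => Complex.conj_ofReal _
  -- Conjugation by the square roots of the weights makes the matrix Hermitian for the standard
  -- inner product. The sign turns the form into the Dirichlet form.
  set A : Matrix (Fin n) (Fin n) ℂ := Matrix.of fun i j => -(d i * M i j / d j) with hA'
  have hAdef : ∀ i j, A i j = -(d i * M i j / d j) := fun _ _ => rfl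
  clear_value A
  have hA : A.IsHermitian := by
    ext i j
    have h := hM j i
    rw [← hdd i, ← hdd j, star_mul', star_mul', hdstar] at h
    simp only [conjTranspose_apply, hAdef, star_neg, star_div₀, star_mul', hdstar]
    have := hd0 i
    have := hd0 j
    rw [neg_inj, div_eq_div_iff (hd0 i) (hd0 j)]
    have h' := congrArg star h
    simp only [star_mul', star_star, hdstar] at h'
    linear_combination h'
  have hmul : ∀ f : Fin n → ℂ, A *ᵥ (fun i => d i * f i) = fun i => -(d i * (M *ᵥ f) i) := by
    intro f
    ext i
    simp only [mulVec, dotProduct, hAdef, Finset.mul_sum, ← Finset.sum_neg_distrib]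
    refine Finset.sum_congr rfl fun j _ => ?_
    have := hd0 j
    field_simp
  have hform : ∀ f : Fin n → ℂ, (star (fun i => d i * f i) ⬝ᵥ (A *ᵥ (fun i => d i * f i))).re =
      -(∑ i, (μ i : ℂ) * (star (f i) * (M *ᵥ f) i)).re := by
    intro f
    rw [hmul, ← Complex.neg_re, ← Finset.sum_neg_distrib]
    simp only [dotProduct, Pi.star_apply, star_mul', hdstar, ← hdd]
    congr 1
    exact Finset.sum_congr rfl fun i _ => by ring
  have hmass : ∀ f : Fin n → ℂ, (star (fun i => d i * f i) ⬝ᵥ (fun i => d i * f i)).re =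
      ∑ i, μ i * ‖f i‖ ^ 2 := by
    intro f
    rw [star_dotProduct_self_re]
    refine Finset.sum_congr rfl fun i _ => ?_
    rw [norm_mul, mul_pow, hd, Complex.norm_real, Real.norm_eq_abs, sq_abs, Real.sq_sqrt (hμ i).le]
  have hinv : ∀ f : Fin n → ℂ, (fun i => d i * (f i / d i)) = f := fun f => by
    ext i
    have := hd0 i
    field_simp
  obtain ⟨lam, hlam⟩ : ∃ lam : Fin n → ℝ, ∀ k, a k ≤ lam k ∧ lam k ≤ b k ∧
      ∃ f : Fin n → ℂ, f ≠ 0 ∧ A *ᵥ f = (lam k : ℂ) • f := by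
    refine hA.exists_eigenvalue_bounds ?_ ?_
    · intro k f hf
      rw [← hinv f, hform, hmass]
      exact hlow k _ fun i hi => by simp [hf i hi]
    · intro k
      obtain ⟨T, hT, hTb⟩ := hup k
      let Dg : (Fin n → ℂ) →ₗ[ℂ] (Fin n → ℂ) :=
        { toFun := fun f i => d i * f i
          map_add' := fun x y => by ext i; simp [mul_add]
          map_smul' := fun r x => by ext i; simp [mul_left_comm] }
      refine ⟨Dg ∘ₗ T, ?_, fun F => ?_⟩
      · have : Function.Injective Dg := fun x y h => by
          ext i
          exact mul_left_cancel₀ (hd0 i) (congrFun h i)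
        exact this.comp hT
      · have := hTb F
        rw [← hform, ← hmass] at this
        exact this
  refine ⟨fun k => -lam k, fun k => ?_⟩
  obtain ⟨h1, h2, f, hf, hAf⟩ := hlam k
  refine ⟨by simpa using h1, by simpa using h2, fun i => f i / d i, ?_, ?_⟩
  · intro h
    apply hf
    rw [← hinv f]
    ext i
    have := congrFun h i
    simp only [Pi.zero_apply] at this ⊢
    rw [this, mul_zero]
  · rw [← hinv f, hmul] at hAf
    ext i
    have h3 := congrFun hAf i
    simp only [Pi.smul_apply, smul_eq_mul] at h3 ⊢
    have := hd0 i
    push_cast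
    apply mul_left_cancel₀ this
    rw [neg_eq_iff_eq_neg] at h3
    rw [h3]
    ring

end MinMax

/-! ### Energy and mass on the tree: lower and upper bounds of the Rayleigh quotient. -/

section Forms

open Relation

variable {n : ℕ}

/-- The energy of `f` carried by the edge `{u j, v j}`. -/
def treeTerm (c S : Fin n → ℝ) (u v : Fin n → Fin (n + 1)) (ε : ℝ) (f : Fin (n + 1) → ℂ)
    (j : Fin n) : ℝ :=
  c j * Real.exp (-S j / ε) * ‖f (u j) - f (v j)‖ ^ 2

/-- The energy of `f` carried by the edges `{u j, v j}`. -/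
def treeForm (c S : Fin n → ℝ) (u v : Fin n → Fin (n + 1)) (ε : ℝ) (f : Fin (n + 1) → ℂ) : ℝ :=
  ∑ j, treeTerm c S u v ε f j

open scoped Classical in
/-- The energy of `f` carried by the edges `{u j, v j}` of height at most `h - θ`. -/
def lowForm (c S : Fin n → ℝ) (u v : Fin n → Fin (n + 1)) (θ ε h : ℝ) (f : Fin (n + 1) → ℂ) : ℝ :=
  ∑ j ∈ Finset.univ.filter (fun j => S j + θ ≤ h), treeTerm c S u v ε f j

/-- The squared norm of `f`, weighted by the invariant measure, on the states different from `0`. -/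
def massForm (m : Fin n → ℝ) (V : Fin (n + 1) → ℝ) (ε : ℝ) (f : Fin (n + 1) → ℂ) : ℝ :=
  ∑ i, m i * Real.exp (-V i.succ / ε) * ‖f i.succ‖ ^ 2

/-- The Eyring-Kramers rate attached to the state `k + 1`. -/
def kramersRate (c S m : Fin n → ℝ) (V : Fin (n + 1) → ℝ) (ε : ℝ) (k : Fin n) : ℝ :=
  c k / m k * Real.exp (-(S k - V k.succ) / ε)

theorem norm_add_sq_le_weighted (x y : ℂ) {η : ℝ} (hη : 0 < η) :
    ‖x + y‖ ^ 2 ≤ (1 + η) * ‖x‖ ^ 2 + (1 + 1 / η) * ‖y‖ ^ 2 := by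
  have h1 : ‖x + y‖ ^ 2 ≤ (‖x‖ + ‖y‖) ^ 2 := by gcongr; exact norm_add_le x y
  have h2 : 0 ≤ (η * ‖x‖ - ‖y‖) ^ 2 / η := by positivity
  have h3 : (η * ‖x‖ - ‖y‖) ^ 2 / η = η * ‖x‖ ^ 2 - 2 * ‖x‖ * ‖y‖ + 1 / η * ‖y‖ ^ 2 := by
    field_simp
    ring
  nlinarith

theorem norm_add_sq_le (x y : ℂ) : ‖x + y‖ ^ 2 ≤ 2 * ‖x‖ ^ 2 + 2 * ‖y‖ ^ 2 := by
  have := norm_add_sq_le_weighted x y one_pos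
  norm_num at this
  exact this

variable {Q : ℝ → Fin (n + 1) → Fin (n + 1) → Prop} {c S m : Fin n → ℝ}
  {u v : Fin n → Fin (n + 1)} {V : Fin (n + 1) → ℝ} {θ ε : ℝ} {k : ℕ} {h : ℝ}
  {a b : Fin (n + 1)} {f : Fin (n + 1) → ℂ}

theorem treeTerm_nonneg (hc : ∀ j, 0 < c j) (j : Fin n) : 0 ≤ treeTerm c S u v ε f j := by
  have := hc j
  unfold treeTerm
  positivity

theorem treeForm_nonneg (hc : ∀ j, 0 < c j) : 0 ≤ treeForm c S u v ε f :=
  Finset.sum_nonneg fun j _ => treeTerm_nonneg hc j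

theorem lowForm_nonneg (hc : ∀ j, 0 < c j) : 0 ≤ lowForm c S u v θ ε h f :=
  Finset.sum_nonneg fun j _ => treeTerm_nonneg hc j

theorem lowForm_le_treeForm (hc : ∀ j, 0 < c j) :
    lowForm c S u v θ ε h f ≤ treeForm c S u v ε f :=
  Finset.sum_le_sum_of_subset_of_nonneg (Finset.subset_univ _) fun j _ _ => treeTerm_nonneg hc j

/-- Since `0 < θ`, the edge `j` is not counted in the low energy at height `S j`. The two parts can
thus be used side by side without losing a factor `2` in the leading order. -/
theorem treeTerm_add_lowForm_le (hc : ∀ j, 0 < c j) (hθ : 0 < θ) (j : Fin n) :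
    treeTerm c S u v ε f j + lowForm c S u v θ ε (S j) f ≤ treeForm c S u v ε f := by
  classical
  unfold lowForm treeForm
  rw [← Finset.add_sum_erase _ _ (Finset.mem_univ j)]
  gcongr
  · intros; exact treeTerm_nonneg hc _
  · intro i hi
    simp only [Finset.mem_filter, Finset.mem_univ, true_and] at hi
    simp only [Finset.mem_erase, Finset.mem_univ, and_true]
    rintro rfl
    linarith

theorem norm_sub_sq_of_sym2 {j : Fin n} (hab : s(a, b) = s(u j, v j)) :
    ‖f a - f b‖ ^ 2 = ‖f (u j) - f (v j)‖ ^ 2 := by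
  rcases Sym2.eq_iff.1 hab with ⟨rfl, rfl⟩ | ⟨rfl, rfl⟩
  · rfl
  · rw [norm_sub_rev]

/-- Every edge used has height at most `h - θ`, so a difference across it costs at most a multiple
of $e^{(h-\theta)/\varepsilon}$ times its energy. Compared with a conductance of order
$e^{-h/\varepsilon}$ this gains the factor $e^{-\theta/\varepsilon}$ of the error terms. -/
theorem LowConn.norm_sub_sq_le (hc : ∀ j, 0 < c j) (H : LowConn S u v θ k h a b) :
    ∃ K, 0 ≤ K ∧ ∀ ε : ℝ, 0 < ε → ∀ f : Fin (n + 1) → ℂ,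
      ‖f a - f b‖ ^ 2 ≤ K * Real.exp ((h - θ) / ε) * lowForm c S u v θ ε h f := by
  induction H with
  | refl =>
    refine ⟨0, le_rfl, fun ε _ f => ?_⟩
    simp
  | @tail x y _ hxy ih =>
    obtain ⟨K, hK, ih⟩ := ih
    obtain ⟨j, -, hj, hs⟩ := hxy
    have hcj := hc j
    refine ⟨2 * K + 2 / c j, by positivity, fun ε hε f => ?_⟩
    have h1 : ‖f x - f y‖ ^ 2 ≤
        1 / c j * Real.exp ((h - θ) / ε) * lowForm c S u v θ ε h f := by
      have h2 : treeTerm c S u v ε f j ≤ lowForm c S u v θ ε h f := by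
        classical
        exact Finset.single_le_sum (f := fun j => treeTerm c S u v ε f j)
          (fun i _ => treeTerm_nonneg hc i) (by simpa using hj)
      calc ‖f x - f y‖ ^ 2 = 1 / c j * Real.exp (S j / ε) * treeTerm c S u v ε f j := by
            rw [norm_sub_sq_of_sym2 hs, treeTerm, neg_div, Real.exp_neg]
            field_simp
        _ ≤ 1 / c j * Real.exp ((h - θ) / ε) * lowForm c S u v θ ε h f := by
            have := treeTerm_nonneg (S := S) (u := u) (v := v) (ε := ε) (f := f) hc j
            gcongr
            linarith
    calc ‖f a - f y‖ ^ 2 = ‖(f a - f x) + (f x - f y)‖ ^ 2 := by ring_nf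
      _ ≤ 2 * ‖f a - f x‖ ^ 2 + 2 * ‖f x - f y‖ ^ 2 := norm_add_sq_le _ _
      _ ≤ 2 * (K * Real.exp ((h - θ) / ε) * lowForm c S u v θ ε h f) +
          2 * (1 / c j * Real.exp ((h - θ) / ε) * lowForm c S u v θ ε h f) := by
            gcongr
            exact ih ε hε f
      _ = _ := by ring

theorem massForm_nonneg (hm : ∀ i, 0 < m i) : 0 ≤ massForm m V ε f :=
  Finset.sum_nonneg fun i _ => by have := hm i; positivity

theorem kramersRate_pos (hc : ∀ j, 0 < c j) (hm : ∀ i, 0 < m i) (k : Fin n) :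
    0 < kramersRate c S m V ε k := by
  have := hc k
  have := hm k
  unfold kramersRate
  positivity

theorem kramersRate_mul (hm : ∀ i, 0 < m i) (k : Fin n) :
    kramersRate c S m V ε k * (m k * Real.exp (-V k.succ / ε)) = c k * Real.exp (-S k / ε) := by
  have := (hm k).ne'
  rw [kramersRate]
  calc _ = c k * (Real.exp (-(S k - V k.succ) / ε) * Real.exp (-V k.succ / ε)) := by field_simp
    _ = _ := by rw [← Real.exp_add]; congr 2; ring

namespace GapHierarchy

variable (H : GapHierarchy Q S u v V θ)
include H

/-- As `f` vanishes at `p`, its value at `k + 1` is the jump across `{u k, v k}` plus increments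
along lower edges. The weighted square inequality with parameter of order $e^{-\theta/\varepsilon}$
keeps the constant `1` in front of the jump and charges the rest to the low energy. -/
theorem lower_bound_top (hc : ∀ j, 0 < c j) (k : Fin n) :
    ∃ K, 0 ≤ K ∧ ∀ ε : ℝ, 0 < ε → ∀ f : Fin (n + 1) → ℂ, (∀ i, i ≤ k.castSucc → f i = 0) →
      c k * Real.exp (-S k / ε) * ‖f k.succ‖ ^ 2 ≤
        (1 + K * Real.exp (-θ / ε)) * treeForm c S u v ε f := by
  obtain ⟨x, y, p, hp, hxy, h1, h2⟩ := H.exists_descent k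
  obtain ⟨K1, hK1, h1⟩ := h1.norm_sub_sq_le hc
  obtain ⟨K2, hK2, h2⟩ := h2.norm_sub_sq_le hc
  have hck := hc k
  -- The summand `1` only makes `B` positive, so that `B * δ` can serve as the parameter of the
  -- weighted inequality.
  set B : ℝ := c k * (2 * K1 + 2 * K2) + 1 with hB
  have hBpos : 0 < B := by positivity
  refine ⟨B, hBpos.le, fun ε hε f hf => ?_⟩
  set δ := Real.exp (-θ / ε) with hδ
  have hδpos : 0 < δ := Real.exp_pos _
  set L := lowForm c S u v θ ε (S k) f with hL
  have hLpos : 0 ≤ L := lowForm_nonneg hc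
  set w := c k * Real.exp (-S k / ε) with hw
  have hwpos : 0 < w := by positivity
  have hr : w * ‖(f k.succ - f x) + (f y - f p)‖ ^ 2 ≤ B * δ * L := by
    have h3 : Real.exp (-S k / ε) * Real.exp ((S k - θ) / ε) = δ := by
      rw [← Real.exp_add, hδ]; congr 1; ring
    calc w * ‖(f k.succ - f x) + (f y - f p)‖ ^ 2
        ≤ w * (2 * ‖f k.succ - f x‖ ^ 2 + 2 * ‖f y - f p‖ ^ 2) := by
          gcongr; exact norm_add_sq_le _ _
      _ ≤ w * (2 * (K1 * Real.exp ((S k - θ) / ε) * L) +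
            2 * (K2 * Real.exp ((S k - θ) / ε) * L)) := by
          gcongr
          · exact h1 ε hε f
          · exact h2 ε hε f
      _ = c k * (2 * K1 + 2 * K2) * (Real.exp (-S k / ε) * Real.exp ((S k - θ) / ε)) * L := by
          rw [hw]; ring
      _ ≤ B * δ * L := by
          rw [h3]; gcongr; linarith
  have hsum : w * ‖f x - f y‖ ^ 2 + L ≤ treeForm c S u v ε f := by
    have := treeTerm_add_lowForm_le (c := c) (S := S) (u := u) (v := v) (ε := ε) (f := f)
      hc H.pos k
    rw [treeTerm, ← norm_sub_sq_of_sym2 hxy] at this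
    exact this
  have hBδ : 0 < B * δ := by positivity
  calc w * ‖f k.succ‖ ^ 2
      = w * ‖(f x - f y) + ((f k.succ - f x) + (f y - f p))‖ ^ 2 := by
        rw [hf p hp]; ring_nf
    _ ≤ w * ((1 + B * δ) * ‖f x - f y‖ ^ 2 +
          (1 + 1 / (B * δ)) * ‖(f k.succ - f x) + (f y - f p)‖ ^ 2) := by
        gcongr; exact norm_add_sq_le_weighted _ _ hBδ
    _ = (1 + B * δ) * (w * ‖f x - f y‖ ^ 2) +
          (1 + 1 / (B * δ)) * (w * ‖(f k.succ - f x) + (f y - f p)‖ ^ 2) := by ring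
    _ ≤ (1 + B * δ) * (w * ‖f x - f y‖ ^ 2) + (1 + 1 / (B * δ)) * (B * δ * L) := by gcongr
    _ = (1 + B * δ) * (w * ‖f x - f y‖ ^ 2 + L) := by field_simp; ring
    _ ≤ _ := by gcongr

/-- The mass at `k + 1` gives the main term. The states below it do not contribute because `f`
vanishes there, and for those above it `lowConn_of_lt` supplies a connection whose exponent cancels
against rate and mass up to $-\theta$. -/
theorem lower_bound (hc : ∀ j, 0 < c j) (hm : ∀ i, 0 < m i) (k : Fin n) :
    ∃ K, 0 ≤ K ∧ ∀ ε : ℝ, 0 < ε → ∀ f : Fin (n + 1) → ℂ, (∀ i, i ≤ k.castSucc → f i = 0) →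
      kramersRate c S m V ε k * massForm m V ε f ≤
        (1 + K * Real.exp (-θ / ε)) * treeForm c S u v ε f := by
  have key : ∀ i : Fin n, ∃ K, 0 ≤ K ∧ ∀ ε : ℝ, 0 < ε → ∀ f : Fin (n + 1) → ℂ,
      (∀ i, i ≤ k.castSucc → f i = 0) →
      kramersRate c S m V ε k * (m i * Real.exp (-V i.succ / ε) * ‖f i.succ‖ ^ 2) ≤
        ((if i = k then 1 else 0) + K * Real.exp (-θ / ε)) * treeForm c S u v ε f := by
    intro i
    rcases lt_trichotomy i k with hik | rfl | hik
    · refine ⟨0, le_rfl, fun ε _ f hf => ?_⟩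
      rw [hf i.succ (by simpa [Fin.le_def] using hik)]
      simp [hik.ne]
    · obtain ⟨K, hK, hb⟩ := H.lower_bound_top hc i
      refine ⟨K, hK, fun ε hε f hf => ?_⟩
      rw [if_pos rfl, ← mul_assoc, kramersRate_mul hm]
      exact hb ε hε f hf
    · obtain ⟨p, hp, hconn⟩ := H.lowConn_of_lt k i hik
      obtain ⟨K, hK, hb⟩ := hconn.norm_sub_sq_le hc
      have hck := hc k
      have hmi := hm i
      have hmk := hm k
      refine ⟨c k * m i / m k * K, by positivity, fun ε hε f hf => ?_⟩
      rw [if_neg hik.ne', zero_add]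
      have h1 := hb ε hε f
      rw [hf p hp, sub_zero] at h1
      calc kramersRate c S m V ε k * (m i * Real.exp (-V i.succ / ε) * ‖f i.succ‖ ^ 2)
          ≤ kramersRate c S m V ε k * (m i * Real.exp (-V i.succ / ε) *
            (K * Real.exp ((V i.succ + (S k - V k.succ) - θ) / ε) * treeForm c S u v ε f)) := by
            have := (kramersRate_pos (S := S) (V := V) (ε := ε) hc hm k).le
            gcongr
            exact h1.trans (by gcongr; exact lowForm_le_treeForm hc)
        _ = c k * m i / m k * K * (Real.exp (-(S k - V k.succ) / ε) * Real.exp (-V i.succ / ε) *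
            Real.exp ((V i.succ + (S k - V k.succ) - θ) / ε)) * treeForm c S u v ε f := by
            rw [kramersRate]; ring
        _ ≤ _ := by
            rw [← Real.exp_add, ← Real.exp_add]
            apply le_of_eq
            congr 4
            ring
  choose K hK hb using key
  refine ⟨∑ i, K i, Finset.sum_nonneg fun i _ => hK i, fun ε hε f hf => ?_⟩
  calc kramersRate c S m V ε k * massForm m V ε f
      = ∑ i, kramersRate c S m V ε k * (m i * Real.exp (-V i.succ / ε) * ‖f i.succ‖ ^ 2) := by
        rw [massForm, Finset.mul_sum]
    _ ≤ ∑ i, ((if i = k then 1 else 0) + K i * Real.exp (-θ / ε)) * treeForm c S u v ε f :=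
        Finset.sum_le_sum fun i _ => hb i ε hε f hf
    _ = _ := by
        rw [← Finset.sum_mul, Finset.sum_add_distrib, ← Finset.sum_mul]
        simp

/-- For `f` constant on the clusters of level `k + 1`, the edges after `k` carry no energy because
they are internal, those before `k` are negligible by `trial_bound`, and the edge `k` gives the
Kramers rate by `trial_top`. -/
theorem upper_bound (hc : ∀ j, 0 < c j) (hm : ∀ i, 0 < m i) (k : Fin n)
    {cl : Fin (n + 1) → Fin (n + 1)} (hcl : IsClustering Q S u v θ (k + 1) cl) :
    ∃ K, 0 ≤ K ∧ ∀ ε : ℝ, 0 < ε → ∀ f : Fin (n + 1) → ℂ, f 0 = 0 → (∀ a, f (cl a) = f a) →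
      treeForm c S u v ε f ≤
        kramersRate c S m V ε k * (1 + K * Real.exp (-θ / ε)) * massForm m V ε f := by
  have hck := hc k
  have hmk := hm k
  have hterm : ∀ (ε : ℝ) (f : Fin (n + 1) → ℂ) (i : Fin n),
      m i * Real.exp (-V i.succ / ε) * ‖f i.succ‖ ^ 2 ≤ massForm m V ε f := fun ε f i =>
    Finset.single_le_sum (f := fun i => m i * Real.exp (-V i.succ / ε) * ‖f i.succ‖ ^ 2)
      (fun i _ => by have := hm i; positivity) (Finset.mem_univ i)
  -- The value at an end `a` is the value at the representative of its cluster, whose mass outweighs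
  -- the conductance of the edge.
  have half : ∀ (j : Fin n) (a b : Fin (n + 1)), j < k → s(a, b) = s(u j, v j) → cl a ≠ cl b →
      ∃ K, 0 ≤ K ∧ ∀ ε : ℝ, 0 < ε → ∀ f : Fin (n + 1) → ℂ, f 0 = 0 → (∀ a, f (cl a) = f a) →
        c j * Real.exp (-S j / ε) * ‖f a‖ ^ 2 ≤
          K * Real.exp (-θ / ε) * (kramersRate c S m V ε k * massForm m V ε f) := by
    intro j a b hjk hab hne
    by_cases h0 : cl a = 0
    · refine ⟨0, le_rfl, fun ε _ f hf0 hf => ?_⟩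
      rw [← hf a, h0, hf0]
      simp
    · have hbound := H.trial_bound k hcl j hjk hab hne h0
      obtain ⟨i, hi⟩ := Fin.exists_succ_eq.2 h0
      rw [← hi] at hbound
      have hmi := hm i
      have hcj := hc j
      refine ⟨c j * m k / (c k * m i), by positivity, fun ε hε f hf0 hf => ?_⟩
      rw [← hf a, ← hi]
      have hexp : Real.exp (-S j / ε) ≤ Real.exp (-θ / ε) * Real.exp (-(S k - V k.succ) / ε) *
          Real.exp (-V i.succ / ε) := by
        rw [← Real.exp_add, ← Real.exp_add, ← add_div, ← add_div]
        gcongr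
        linarith
      calc c j * Real.exp (-S j / ε) * ‖f i.succ‖ ^ 2
          ≤ c j * (Real.exp (-θ / ε) * Real.exp (-(S k - V k.succ) / ε) *
            Real.exp (-V i.succ / ε)) * ‖f i.succ‖ ^ 2 := by gcongr
        _ = c j * m k / (c k * m i) * Real.exp (-θ / ε) * (kramersRate c S m V ε k *
            (m i * Real.exp (-V i.succ / ε) * ‖f i.succ‖ ^ 2)) := by
            rw [kramersRate]; field_simp
        _ ≤ _ := by
            have := (kramersRate_pos (S := S) (V := V) (ε := ε) hc hm k).le
            gcongr
            exact hterm ε f i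
  have key : ∀ j : Fin n, ∃ K, 0 ≤ K ∧ ∀ ε : ℝ, 0 < ε → ∀ f : Fin (n + 1) → ℂ, f 0 = 0 →
      (∀ a, f (cl a) = f a) → treeTerm c S u v ε f j ≤
        ((if j = k then 1 else 0) + K * Real.exp (-θ / ε)) *
          (kramersRate c S m V ε k * massForm m V ε f) := by
    intro j
    rcases lt_trichotomy j k with hjk | rfl | hjk
    · by_cases hne : cl (u j) = cl (v j)
      · refine ⟨0, le_rfl, fun ε _ f _ hf => ?_⟩
        rw [treeTerm, ← hf (u j), ← hf (v j), hne]
        simp [hjk.ne]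
      · obtain ⟨K1, hK1, h1⟩ := half j _ _ hjk rfl hne
        obtain ⟨K2, hK2, h2⟩ := half j (v j) (u j) hjk Sym2.eq_swap (Ne.symm hne)
        refine ⟨2 * K1 + 2 * K2, by positivity, fun ε hε f hf0 hf => ?_⟩
        rw [if_neg hjk.ne, zero_add]
        have h1 := h1 ε hε f hf0 hf
        have h2 := h2 ε hε f hf0 hf
        have h3 := norm_add_sq_le (f (u j)) (-f (v j))
        rw [norm_neg, ← sub_eq_add_neg] at h3
        have hcj := hc j
        calc treeTerm c S u v ε f j ≤ c j * Real.exp (-S j / ε) *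
              (2 * ‖f (u j)‖ ^ 2 + 2 * ‖f (v j)‖ ^ 2) := by rw [treeTerm]; gcongr
          _ = 2 * (c j * Real.exp (-S j / ε) * ‖f (u j)‖ ^ 2) +
              2 * (c j * Real.exp (-S j / ε) * ‖f (v j)‖ ^ 2) := by ring
          _ ≤ _ := by linarith
    · obtain ⟨x, y, hxy, hx, hy, hV⟩ := H.trial_top j hcl
      by_cases h0 : cl y = 0
      · refine ⟨0, le_rfl, fun ε hε f hf0 hf => ?_⟩
        rw [treeTerm, ← norm_sub_sq_of_sym2 hxy, ← hf x, ← hf y, hx, h0, hf0, sub_zero, if_pos rfl,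
          zero_mul, add_zero, one_mul, ← kramersRate_mul (V := V) hm, mul_assoc]
        have := (kramersRate_pos (S := S) (V := V) (ε := ε) hc hm j).le
        gcongr
        exact hterm ε f j
      · have hV := hV h0
        obtain ⟨i, hi⟩ := Fin.exists_succ_eq.2 h0
        rw [← hi] at hV hy
        have hij : i ≠ j := fun h => hy (by rw [h])
        have hmi := hm i
        refine ⟨m j / m i, by positivity, fun ε hε f hf0 hf => ?_⟩
        set B := m j / m i with hB
        have hBpos : 0 < B := by positivity
        set δ := Real.exp (-θ / ε) with hδ
        have hδpos : 0 < δ := Real.exp_pos _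
        have hΛ := (kramersRate_pos (S := S) (V := V) (ε := ε) hc hm j).le
        set Λ := kramersRate c S m V ε j with hΛdef
        have hBδ : 0 < B * δ := by positivity
        -- The mass of `j + 1` is exponentially smaller than that of `i + 1`. In the weighted
        -- inequality with parameter `B * δ`, the coefficient `1 + 1 / (B * δ)` of the second square
        -- is compensated by this ratio.
        have hexp : m j * Real.exp (-V j.succ / ε) ≤
            B * δ * (m i * Real.exp (-V i.succ / ε)) := by
          calc m j * Real.exp (-V j.succ / ε)
              ≤ m j * (δ * Real.exp (-V i.succ / ε)) := by
                rw [hδ, ← Real.exp_add, ← add_div]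
                gcongr
                linarith
            _ = _ := by rw [hB]; field_simp
        have hmass : m j * Real.exp (-V j.succ / ε) * ‖f j.succ‖ ^ 2 +
            m i * Real.exp (-V i.succ / ε) * ‖f i.succ‖ ^ 2 ≤ massForm m V ε f := by
          rw [massForm, ← Finset.add_sum_erase _ _ (Finset.mem_univ j)]
          gcongr
          exact Finset.single_le_sum
            (f := fun i => m i * Real.exp (-V i.succ / ε) * ‖f i.succ‖ ^ 2)
            (fun i _ => by have := hm i; positivity)
            (Finset.mem_erase.2 ⟨hij, Finset.mem_univ i⟩)
        rw [treeTerm, ← norm_sub_sq_of_sym2 hxy, ← hf x, ← hf y, hx, ← hi, if_pos rfl,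
          ← kramersRate_mul (V := V) hm, ← hΛdef]
        have h3 := norm_add_sq_le_weighted (f j.succ) (-f i.succ) hBδ
        rw [norm_neg, ← sub_eq_add_neg] at h3
        calc Λ * (m j * Real.exp (-V j.succ / ε)) * ‖f j.succ - f i.succ‖ ^ 2
            ≤ Λ * (m j * Real.exp (-V j.succ / ε)) * ((1 + B * δ) * ‖f j.succ‖ ^ 2 +
              (1 + 1 / (B * δ)) * ‖f i.succ‖ ^ 2) := by gcongr
          _ = Λ * ((1 + B * δ) * (m j * Real.exp (-V j.succ / ε) * ‖f j.succ‖ ^ 2) +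
              (1 + 1 / (B * δ)) * (m j * Real.exp (-V j.succ / ε) * ‖f i.succ‖ ^ 2)) := by ring
          _ ≤ Λ * ((1 + B * δ) * (m j * Real.exp (-V j.succ / ε) * ‖f j.succ‖ ^ 2) +
              (1 + 1 / (B * δ)) *
                (B * δ * (m i * Real.exp (-V i.succ / ε)) * ‖f i.succ‖ ^ 2)) := by gcongr
          _ = Λ * ((1 + B * δ) * (m j * Real.exp (-V j.succ / ε) * ‖f j.succ‖ ^ 2 +
              m i * Real.exp (-V i.succ / ε) * ‖f i.succ‖ ^ 2)) := by field_simp; ring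
          _ ≤ Λ * ((1 + B * δ) * massForm m V ε f) := by gcongr
          _ = _ := by ring
    · refine ⟨0, le_rfl, fun ε _ f _ hf => ?_⟩
      rw [treeTerm, ← hf (u j), ← hf (v j), hcl.edge j hjk]
      simp [hjk.ne']
  choose K hK hb using key
  refine ⟨∑ i, K i, Finset.sum_nonneg fun i _ => hK i, fun ε hε f hf0 hf => ?_⟩
  calc treeForm c S u v ε f
      ≤ ∑ j, ((if j = k then 1 else 0) + K j * Real.exp (-θ / ε)) *
          (kramersRate c S m V ε k * massForm m V ε f) :=
        Finset.sum_le_sum fun i _ => hb i ε hε f hf0 hf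
    _ = _ := by
        rw [← Finset.sum_mul, Finset.sum_add_distrib, ← Finset.sum_mul]
        simp
        ring

end GapHierarchy

end Forms

/-! ### From the energy bounds to distinct eigenvalues and the whole spectrum. -/

section Core

open Matrix

variable {n : ℕ}

/-- Extension of a function to the absorbing state `0` by zero. -/
def extendZero (f : Fin n → ℂ) : Fin (n + 1) → ℂ := Fin.cons 0 f

@[simp] theorem extendZero_zero (f : Fin n → ℂ) : extendZero f 0 = 0 := rfl

@[simp] theorem extendZero_succ (f : Fin n → ℂ) (i : Fin n) : extendZero f i.succ = f i := rfl

/-- Extension by zero as a linear map. -/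
def extendZeroLM (n : ℕ) : (Fin n → ℂ) →ₗ[ℂ] (Fin (n + 1) → ℂ) where
  toFun := extendZero
  map_add' x y := by ext i; refine Fin.cases ?_ (fun j => ?_) i <;> simp
  map_smul' r x := by ext i; refine Fin.cases ?_ (fun j => ?_) i <;> simp

variable {Q : ℝ → Fin (n + 1) → Fin (n + 1) → Prop} {c S m : Fin n → ℝ}
  {u v : Fin n → Fin (n + 1)} {V : Fin (n + 1) → ℝ} {θ : ℝ}

/-- The functions which are constant on the clusters of a clustering of level `k` and vanish on the
cluster of `0`. -/
theorem IsClustering.exists_trial {k : ℕ} (hk : k ≤ n) {cl : Fin (n + 1) → Fin (n + 1)}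
    (hcl : IsClustering Q S u v θ k cl) :
    ∃ T : (Fin k → ℂ) →ₗ[ℂ] (Fin n → ℂ), Function.Injective T ∧
      ∀ F a, extendZero (T F) (cl a) = extendZero (T F) a := by
  -- The label `0` belongs to the cluster of the absorbing state, where the trial function vanishes;
  -- the `k` other labels are the free parameters.
  let g : Fin (n + 1) → Fin (k + 1) := fun a => ⟨cl a, Nat.lt_succ_iff.2 (hcl.le a)⟩
  have hg : ∀ F : Fin k → ℂ, ∀ a, extendZero (fun i : Fin n => extendZero F (g i.succ)) a =
      extendZero F (g a) := by
    intro F a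
    refine Fin.cases ?_ (fun j => ?_) a
    · have : g 0 = 0 := by
        apply Fin.ext
        change (cl 0 : ℕ) = 0
        rw [hcl.fix 0 (by simp)]
        rfl
      rw [this]
      rfl
    · rfl
  refine ⟨LinearMap.funLeft ℂ ℂ (fun i : Fin n => g i.succ) ∘ₗ extendZeroLM k, ?_, ?_⟩
  · intro x y hxy
    ext i
    have h := congrFun hxy ⟨i, by omega⟩
    have hgi : g (Fin.succ ⟨i, by omega⟩) = i.succ := by
      apply Fin.ext
      change (cl _ : ℕ) = _
      rw [hcl.fix _ (by simp only [Fin.val_succ]; omega)]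
      rfl
    change extendZero x (g _) = extendZero y (g _) at h
    rwa [hgi] at h
  · intro F a
    change extendZero (fun i : Fin n => extendZero F (g i.succ)) (cl a) =
      extendZero (fun i : Fin n => extendZero F (g i.succ)) a
    rw [hg, hg]
    congr 1
    apply Fin.ext
    change (cl (cl a) : ℕ) = cl a
    rw [hcl.fix _ (hcl.le a)]

/-- The Eyring-Kramers law for a self-adjoint matrix whose form is comparable with the energy carried
by the highest edges of a metastable hierarchy. -/
theorem GapHierarchy.exists_eigenvalues (H : GapHierarchy Q S u v V θ) (hc : ∀ j, 0 < c j)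
    (hm : ∀ i, 0 < m i) {C₁ : ℝ} (hC₁ : 0 ≤ C₁) :
    ∃ C ε₀ : ℝ, 0 < C ∧ 0 < ε₀ ∧ ∀ ε : ℝ, 0 < ε → ε < ε₀ → ∀ M : Matrix (Fin n) (Fin n) ℂ,
      (∀ i j, ((m i * Real.exp (-V i.succ / ε) : ℝ) : ℂ) * M i j =
        star (((m j * Real.exp (-V j.succ / ε) : ℝ) : ℂ) * M j i)) →
      (∀ f : Fin n → ℂ, treeForm c S u v ε (extendZero f) ≤
        -(∑ i, ((m i * Real.exp (-V i.succ / ε) : ℝ) : ℂ) * (star (f i) * (M *ᵥ f) i)).re) →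
      (∀ f : Fin n → ℂ,
        -(∑ i, ((m i * Real.exp (-V i.succ / ε) : ℝ) : ℂ) * (star (f i) * (M *ᵥ f) i)).re ≤
        (1 + C₁ * Real.exp (-θ / ε)) * treeForm c S u v ε (extendZero f)) →
      ∃ lam : Fin n → ℝ, Function.Injective lam ∧
        (∀ k, ∃ f : Fin n → ℂ, f ≠ 0 ∧ M *ᵥ f = (lam k : ℂ) • f) ∧
        ∀ k, |lam k + kramersRate c S m V ε k| ≤
          C * Real.exp (-θ / ε) * kramersRate c S m V ε k := by
  choose K hK hlow using fun k => H.lower_bound hc hm k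
  have hup : ∀ k : Fin n, ∃ K, 0 ≤ K ∧ ∃ T : (Fin (k + 1) → ℂ) →ₗ[ℂ] (Fin n → ℂ),
      Function.Injective T ∧ ∀ ε : ℝ, 0 < ε → ∀ F,
      treeForm c S u v ε (extendZero (T F)) ≤ kramersRate c S m V ε k *
        (1 + K * Real.exp (-θ / ε)) * massForm m V ε (extendZero (T F)) := by
    intro k
    obtain ⟨cl, hcl⟩ := H.exists_clustering (k := k + 1) (by omega)
    obtain ⟨T, hT, hTcl⟩ := hcl.exists_trial (by omega)
    obtain ⟨K, hK, hb⟩ := H.upper_bound hc hm k hcl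
    exact ⟨K, hK, T, hT, fun ε hε F => hb ε hε _ rfl (hTcl F)⟩
  choose K' hK' T hT hTb using hup
  have hratio : ∀ i j : Fin n, ∃ B : ℝ, 0 ≤ B ∧ (i < j → ∀ ε : ℝ, 0 < ε →
      kramersRate c S m V ε i ≤ B * Real.exp (-θ / ε) * kramersRate c S m V ε j) := by
    intro i j
    have := hc i
    have := hc j
    have := hm i
    have := hm j
    refine ⟨c i * m j / (m i * c j), by positivity, fun hij ε hε => ?_⟩
    have hd := H.depth_anti hij
    calc kramersRate c S m V ε i
        ≤ c i / m i * (Real.exp (-θ / ε) * Real.exp (-(S j - V j.succ) / ε)) := by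
          rw [kramersRate, ← Real.exp_add, ← add_div]
          gcongr
          linarith
      _ = _ := by rw [kramersRate]; field_simp
  choose B hB hBb using hratio
  -- `C` dominates the error constants of both bounds, with `K' k * C₁` coming from the product of
  -- two factors `1 + O(δ)` with `δ ≤ 1`, and also the ratio constants `B i j` of the rates.
  set C : ℝ := 1 + ∑ k, (K k + K' k + C₁ + K' k * C₁) + ∑ i, ∑ j, B i j with hC
  have hCk : ∀ k, K k + K' k + C₁ + K' k * C₁ ≤ C := by
    intro k
    have h1 : K k + K' k + C₁ + K' k * C₁ ≤ ∑ k, (K k + K' k + C₁ + K' k * C₁) :=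
      Finset.single_le_sum (f := fun k => K k + K' k + C₁ + K' k * C₁)
        (fun i _ => by have := hK i; have := hK' i; positivity) (Finset.mem_univ k)
    have h2 : 0 ≤ ∑ i, ∑ j, B i j :=
      Finset.sum_nonneg fun i _ => Finset.sum_nonneg fun j _ => hB i j
    linarith
  have hCB : ∀ i j, B i j ≤ C := by
    intro i j
    have h1 : B i j ≤ ∑ i, ∑ j, B i j :=
      (Finset.single_le_sum (f := fun j => B i j) (fun j _ => hB i j) (Finset.mem_univ j)).trans
        (Finset.single_le_sum (f := fun i => ∑ j, B i j)
          (fun i _ => Finset.sum_nonneg fun j _ => hB i j) (Finset.mem_univ i))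
    have h2 : 0 ≤ ∑ k, (K k + K' k + C₁ + K' k * C₁) :=
      Finset.sum_nonneg fun i _ => by have := hK i; have := hK' i; positivity
    linarith
  have hCpos : 0 < C := by
    have h1 : 0 ≤ ∑ i, ∑ j, B i j :=
      Finset.sum_nonneg fun i _ => Finset.sum_nonneg fun j _ => hB i j
    have h2 : 0 ≤ ∑ k, (K k + K' k + C₁ + K' k * C₁) :=
      Finset.sum_nonneg fun i _ => by have := hK i; have := hK' i; positivity
    linarith
  have hθ := H.pos
  -- This threshold gives $Ce^{-\theta/\varepsilon}\le C\varepsilon/\theta\le 1/4$.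
  refine ⟨C, θ / (4 * C), hCpos, by positivity, fun ε hε hε₀ M hM hMlow hMup => ?_⟩
  set δ := Real.exp (-θ / ε) with hδ
  have hδpos : 0 < δ := Real.exp_pos _
  have hCδ : C * δ ≤ 1 / 4 := by
    have h1 : θ / ε < Real.exp (θ / ε) := by linarith [Real.add_one_le_exp (θ / ε)]
    have h2 : δ ≤ ε / θ := by
      rw [hδ, neg_div, Real.exp_neg, ← one_div, ← one_div_div θ ε]
      exact one_div_le_one_div_of_le (by positivity) h1.le
    have h3 : ε / θ ≤ 1 / (4 * C) := by
      rw [lt_div_iff₀ (by positivity)] at hε₀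
      rw [div_le_div_iff₀ hθ (by positivity)]
      linarith
    calc C * δ ≤ C * (1 / (4 * C)) := by gcongr; exact h2.trans h3
      _ = 1 / 4 := by field_simp
  have hδ1 : δ ≤ 1 := by
    rw [hδ, Real.exp_le_one_iff, neg_div]
    have : 0 < θ / ε := by positivity
    linarith
  have hΛ : ∀ k, 0 < kramersRate c S m V ε k := kramersRate_pos hc hm
  have hmass : ∀ f : Fin n → ℂ, massForm m V ε (extendZero f) =
      ∑ i, m i * Real.exp (-V i.succ / ε) * ‖f i‖ ^ 2 := fun f => rfl
  obtain ⟨lam, hlam⟩ := exists_eigenvalue_bounds_of_weights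
    (μ := fun i => m i * Real.exp (-V i.succ / ε)) (fun i => by have := hm i; positivity) hM
    (a := fun k => kramersRate c S m V ε k * (1 - C * δ))
    (b := fun k => kramersRate c S m V ε k * (1 + C * δ))
    (fun k f hf => by
      rw [← hmass]
      refine le_trans ?_ (hMlow f)
      have h1 := hlow k ε hε (extendZero f) fun i hi => by
        revert hi
        refine Fin.cases (fun _ => rfl) (fun j hj => ?_) i
        exact hf j (by simpa [Fin.le_def] using hj)
      have h2 : (1 - C * δ) * (1 + K k * δ) ≤ 1 := by
        have h3 : K k ≤ C := by
          have := hCk k; have := hK' k; have : 0 ≤ K' k * C₁ := by positivity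
          linarith
        have h4 : 0 ≤ C * δ * (K k * δ) := by have := hK k; positivity
        nlinarith [mul_le_mul_of_nonneg_right h3 hδpos.le]
      have h5 : 0 ≤ treeForm c S u v ε (extendZero f) := treeForm_nonneg hc
      calc kramersRate c S m V ε k * (1 - C * δ) * massForm m V ε (extendZero f)
          = (1 - C * δ) * (kramersRate c S m V ε k * massForm m V ε (extendZero f)) := by ring
        _ ≤ (1 - C * δ) * ((1 + K k * δ) * treeForm c S u v ε (extendZero f)) := by
            gcongr
            linarith
        _ = (1 - C * δ) * (1 + K k * δ) * treeForm c S u v ε (extendZero f) := by ring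
        _ ≤ 1 * treeForm c S u v ε (extendZero f) := by gcongr
        _ = _ := one_mul _)
    (fun k => ⟨T k, hT k, fun F => by
      rw [← hmass]
      refine (hMup _).trans ?_
      have h1 := hTb k ε hε F
      have h2 : (1 + C₁ * δ) * (1 + K' k * δ) ≤ 1 + C * δ := by
        have h3 := hCk k
        have h4 := hK k
        have h5 := hK' k
        have h6 : C₁ * K' k * δ * δ ≤ C₁ * K' k * δ * 1 := by gcongr
        nlinarith [mul_le_mul_of_nonneg_right h3 hδpos.le]
      have h7 : 0 ≤ massForm m V ε (extendZero (T k F)) := massForm_nonneg hm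
      have h8 := (hΛ k).le
      calc (1 + C₁ * δ) * treeForm c S u v ε (extendZero (T k F))
          ≤ (1 + C₁ * δ) * (kramersRate c S m V ε k * (1 + K' k * δ) *
            massForm m V ε (extendZero (T k F))) := by gcongr
        _ = kramersRate c S m V ε k * ((1 + C₁ * δ) * (1 + K' k * δ)) *
            massForm m V ε (extendZero (T k F)) := by ring
        _ ≤ _ := by gcongr⟩)
  refine ⟨lam, ?_, fun k => (hlam k).2.2, fun k => ?_⟩
  -- Each `-lam k` lies between `3/4` and `5/4` of its rate, and rates of different indices differ
  -- by a factor of at least `4`, so these intervals are disjoint.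
  · have key : ∀ i j : Fin n, i < j → lam i ≠ lam j := by
      intro i j hij he
      have h1 := (hlam i).2.1
      have h2 := (hlam j).1
      have h3 := hBb i j hij ε hε
      have h4 := hΛ i
      have h5 := hΛ j
      have h6 : kramersRate c S m V ε i ≤ 1 / 4 * kramersRate c S m V ε j := by
        refine h3.trans ?_
        gcongr
        exact (mul_le_mul_of_nonneg_right (hCB i j) hδpos.le).trans hCδ
      nlinarith [mul_le_mul_of_nonneg_left hCδ h4.le, mul_le_mul_of_nonneg_left hCδ h5.le]
    intro i j hij
    rcases lt_trichotomy i j with h | h | h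
    · exact absurd hij (key i j h)
    · exact h
    · exact absurd hij.symm (key j i h)
  · have h1 := (hlam k).1
    have h2 := (hlam k).2.1
    rw [abs_le]
    constructor <;> linarith

/-- An endomorphism of an `n`-dimensional space with `n` distinct eigenvalues. -/
theorem Module.End.spectrum_eq_range_of_injective {E : Type*} [AddCommGroup E] [Module ℂ E]
    [FiniteDimensional ℂ E] (hn : Module.finrank ℂ E = n) {L : Module.End ℂ E} {lam : Fin n → ℂ}
    (hlam : Function.Injective lam) (hL : ∀ k, ∃ x, x ≠ 0 ∧ L x = lam k • x) :
    spectrum ℂ L = Set.range lam ∧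
      ∀ k, Module.finrank ℂ (Module.End.eigenspace L (lam k)) = 1 := by
  choose x hx0 hx using hL
  have hev : ∀ k, L.HasEigenvector (lam k) (x k) := fun k =>
    ⟨Module.End.mem_eigenspace_iff.2 (hx k), hx0 k⟩
  have hli : LinearIndependent ℂ x :=
    Module.End.eigenvectors_linearIndependent' L lam hlam x hev
  let b := basisOfLinearIndependentOfCardEqFinrank' x hli (by simp [hn])
  have hb : ∀ i, b i = x i := fun i => by simp [b]
  have hcoord : ∀ (μ : ℂ) (y : E), L y = μ • y → ∀ i, lam i ≠ μ → b.repr y i = 0 := by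
    intro μ y hy i hi
    have h1 : b.repr (L y) i = lam i * b.repr y i := by
      conv_lhs => rw [← b.sum_repr y]
      simp only [map_sum, map_smul, hb, hx, Finsupp.coe_finsetSum, Finset.sum_apply,
        Finsupp.coe_smul, Pi.smul_apply, smul_eq_mul]
      simp only [← hb, b.repr_self]
      rw [Finset.sum_eq_single i]
      · simp; ring
      · intro j _ hj; simp [hj]
      · simp
    rw [hy] at h1
    simp only [map_smul, Finsupp.coe_smul, Pi.smul_apply, smul_eq_mul] at h1
    have h2 : (lam i - μ) * b.repr y i = 0 := by linear_combination -h1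
    exact (mul_eq_zero.1 h2).resolve_left (sub_ne_zero.2 hi)
  constructor
  · ext μ
    rw [← Module.End.hasEigenvalue_iff_mem_spectrum]
    constructor
    · intro hμ
      obtain ⟨y, hy⟩ := hμ.exists_hasEigenvector
      by_contra hne
      apply hy.2
      apply b.repr.injective
      ext i
      rw [hcoord μ y hy.apply_eq_smul i fun h => hne ⟨i, h⟩]
      simp
    · rintro ⟨k, rfl⟩
      exact Module.End.hasEigenvalue_of_hasEigenvector (hev k)
  · intro k
    refine finrank_eq_one ⟨x k, (hev k).1⟩ (fun h => hx0 k (congrArg Subtype.val h)) fun w => ?_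
    refine ⟨b.repr w k, Subtype.ext ?_⟩
    have h1 := b.sum_repr (w : E)
    rw [Finset.sum_eq_single k] at h1
    · rw [hb] at h1
      exact h1
    · intro i _ hi
      rw [hcoord (lam k) w (Module.End.mem_eigenspace_iff.1 w.2) i (hlam.ne hi), zero_smul]
    · simp

end Core

/-! ### Paths, heights, and the passage from the path formulation to `GapHierarchy`. -/

namespace JumpData

open Relation

section Paths

variable {S : Type*}

theorem steps_cons_cons (a b : S) (l : List S) : steps (a :: b :: l) = (a, b) :: steps (b :: l) :=
  rfl

theorem steps_subset_append (l₁ l₂ : List S) : steps l₂ ⊆ steps (l₁ ++ l₂) := by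
  induction l₁ with
  | nil => simp
  | cons a l₁ ih =>
    intro p hp
    have hp' := ih hp
    rw [List.cons_append]
    rcases h : l₁ ++ l₂ with _ | ⟨b, l⟩
    · simp [h, steps] at hp'
    · rw [h] at hp'
      rw [steps_cons_cons]
      exact List.mem_cons_of_mem _ hp'

theorem dropLast_subset_append (l₁ : List S) (l₂ : List S) (h : l₂ ≠ []) :
    l₂.dropLast ⊆ (l₁ ++ l₂).dropLast := by
  rw [List.dropLast_append_of_ne_nil h]
  exact List.subset_append_right _ _

/-- A walk gives a path without repeated vertices. -/
theorem exists_nodup_path {r : S → S → Prop} {x y : S} (h : ReflTransGen r x y) :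
    ∃ γ : List S, γ.head? = some x ∧ γ.Nodup ∧ γ.getLast? = some y ∧
      (∀ p ∈ steps γ, r p.1 p.2) ∧ ∀ z ∈ γ.dropLast, ∃ z', r z z' := by
  induction h using ReflTransGen.head_induction_on with
  | refl => exact ⟨[y], rfl, by simp, rfl, by simp [steps], by simp⟩
  | @head x z hxz _ ih =>
    obtain ⟨γ, h1, h2, h3, h4, h5⟩ := ih
    -- If the new first vertex already lies on the path, the loop is cut off.
    by_cases hx : x ∈ γ
    · obtain ⟨l₁, l₂, rfl⟩ := List.append_of_mem hx
      refine ⟨x :: l₂, rfl, (List.nodup_append.1 h2).2.1, ?_, fun p hp => ?_, fun p hp => ?_⟩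
      · rwa [List.getLast?_append_of_ne_nil _ (by simp)] at h3
      · exact h4 p (steps_subset_append _ _ hp)
      · exact h5 p (dropLast_subset_append _ _ (by simp) hp)
    · rcases γ with _ | ⟨w, l⟩
      · simp at h1
      · obtain rfl : w = z := by simpa using h1
        refine ⟨x :: w :: l, rfl, List.nodup_cons.2 ⟨hx, h2⟩, ?_, fun p hp => ?_, fun p hp => ?_⟩
        · rw [List.getLast?_cons_cons]; exact h3
        · rw [steps_cons_cons, List.mem_cons] at hp
          rcases hp with rfl | hp
          · exact hxz
          · exact h4 p hp
        · rw [List.dropLast_cons_cons, List.mem_cons] at hp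
          rcases hp with rfl | hp
          · exact ⟨w, hxz⟩
          · exact h5 p hp

theorem reflTransGen_first_hit {r : S → S → Prop} {A : Set S} {x y : S} (h : ReflTransGen r x y)
    (hy : y ∈ A) : ∃ y' ∈ A, ReflTransGen (fun z z' => r z z' ∧ z ∉ A) x y' := by
  induction h using ReflTransGen.head_induction_on with
  | refl => exact ⟨y, hy, .refl⟩
  | @head x z hxz _ ih =>
    by_cases hx : x ∈ A
    · exact ⟨x, hx, .refl⟩
    · obtain ⟨y', hy', h⟩ := ih
      exact ⟨y', hy', .head ⟨hxz, hx⟩ h⟩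

theorem exists_isPathTo {r : S → S → Prop} {A : Set S} {x y : S} (h : ReflTransGen r x y)
    (hy : y ∈ A) : ∃ γ, IsPathTo A x γ ∧ ∀ p ∈ steps γ, r p.1 p.2 ∧ p.1 ∉ A := by
  obtain ⟨y', hy', h⟩ := reflTransGen_first_hit h hy
  obtain ⟨γ, h1, h2, h3, h4, h5⟩ := exists_nodup_path h
  refine ⟨γ, ⟨h1, h2, ⟨y', hy', h3⟩, fun z hz => ?_⟩, h4⟩
  obtain ⟨z', hz'⟩ := h5 z hz
  exact hz'.2

theorem reflTransGen_of_list {γ : List S} {x y : S} (hx : γ.head? = some x)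
    (hy : γ.getLast? = some y) : ReflTransGen (fun a b => (a, b) ∈ steps γ) x y := by
  induction γ generalizing x with
  | nil => simp at hx
  | cons a l ih =>
    obtain rfl : a = x := by simpa using hx
    rcases l with _ | ⟨b, l⟩
    · obtain rfl : a = y := by simpa using hy
      exact .refl
    · rw [List.getLast?_cons_cons] at hy
      refine .head (b := b) (by simp [steps_cons_cons]) ?_
      refine reflTransGen_mono (fun u v h => ?_) (ih rfl hy)
      rw [steps_cons_cons]
      exact List.mem_cons_of_mem _ h

variable (D : JumpData S)

theorem saddle_le_pathHeight {γ : List S} {p : S × S} (hp : p ∈ steps γ) :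
    D.saddle p.1 p.2 ≤ D.pathHeight γ :=
  le_iSup₂ (f := fun (p : S × S) (_ : p ∈ steps γ) => D.saddle p.1 p.2) p hp

theorem exists_step_of_isPathTo {A : Set S} {x : S} {γ : List S} (hγ : IsPathTo A x γ)
    (hx : x ∉ A) : ∃ y, (x, y) ∈ steps γ := by
  obtain ⟨h1, -, ⟨y, hy, h3⟩, -⟩ := hγ
  rcases γ with _ | ⟨a, _ | ⟨b, l⟩⟩
  · simp at h1
  · obtain rfl : a = x := by simpa using h1
    obtain rfl : a = y := by simpa using h3
    exact absurd hy hx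
  · obtain rfl : a = x := by simpa using h1
    exact ⟨b, by simp [steps_cons_cons]⟩

/-- The supremum runs over finitely many steps, at least one of which exists because the path starts
outside `A`. -/
theorem exists_pathHeight_eq {A : Set S} {x : S} {γ : List S} (hγ : IsPathTo A x γ)
    (hx : x ∉ A) : ∃ p ∈ steps γ, D.pathHeight γ = D.saddle p.1 p.2 := by
  classical
  obtain ⟨y, hy⟩ := exists_step_of_isPathTo hγ hx
  obtain ⟨p, hp, hmax⟩ := (steps γ).toFinset.exists_max_image (fun p => D.saddle p.1 p.2)
    ⟨_, List.mem_toFinset.2 hy⟩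
  exact ⟨p, List.mem_toFinset.1 hp, le_antisymm
    (iSup₂_le fun q hq => hmax q (List.mem_toFinset.2 hq))
    (D.saddle_le_pathHeight (List.mem_toFinset.1 hp))⟩

theorem V_le_pathHeight {A : Set S} {x : S} {γ : List S} (hγ : IsPathTo A x γ) (hx : x ∉ A) :
    (D.V x : ℝ≥0∞) ≤ D.pathHeight γ := by
  obtain ⟨y, hy⟩ := exists_step_of_isPathTo hγ hx
  exact le_self_add.trans (D.saddle_le_pathHeight hy)

theorem V_le_passHeight {A : Set S} {x : S} (hx : x ∉ A) : (D.V x : ℝ≥0∞) ≤ D.passHeight x A :=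
  le_iInf₂ fun _ hγ => D.V_le_pathHeight hγ hx

end Paths

section Absorbing

variable {S : Type*} (D : JumpData S)

/-- `x` and `y` are joined by a saddle of height at most `h`. -/
def OpenAt (h : ℝ) (x y : S) : Prop :=
  x ≠ y ∧ ∃ a b, s(x, y) = s(a, b) ∧ D.saddle a b ≠ ⊤ ∧ (D.saddle a b).toReal ≤ h

variable {D}

theorem OpenAt.symm {h : ℝ} {x y : S} (H : D.OpenAt h x y) : D.OpenAt h y x := by
  obtain ⟨h1, a, b, h2, h3⟩ := H
  exact ⟨h1.symm, a, b, by rw [Sym2.eq_swap, h2], h3⟩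

theorem OpenAt.mono {h h' : ℝ} (hh : h ≤ h') {x y : S} (H : D.OpenAt h x y) : D.OpenAt h' x y := by
  obtain ⟨h1, a, b, h2, h3, h4⟩ := H
  exact ⟨h1, a, b, h2, h3, h4.trans hh⟩

variable {o : S} (ho : ∀ y, D.h o y = ⊤)
  (hsymm : ∀ x y, x ≠ o → y ≠ o → x ≠ y → D.saddle x y = D.saddle y x)
include ho

theorem saddle_absorbing (y : S) : D.saddle o y = ⊤ := by simp [saddle, ho]

include hsymm in
-- Openness is unoriented because the cemetery has no exits. Away from `o` the saddle is symmetric,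
-- and an edge ending in `o` can only have been opened in the direction towards `o`.
theorem OpenAt.saddle_le {h : ℝ} {x y : S} (hx : x ≠ o) (H : D.OpenAt h x y) :
    D.saddle x y ≠ ⊤ ∧ (D.saddle x y).toReal ≤ h := by
  obtain ⟨h1, a, b, h2, h3⟩ := H
  rcases Sym2.eq_iff.1 h2 with ⟨rfl, rfl⟩ | ⟨rfl, rfl⟩
  · exact h3
  · have hy : y ≠ o := by rintro rfl; exact h3.1 (saddle_absorbing ho _)
    rwa [hsymm _ _ hx hy h1]

include hsymm in
-- The walk is stopped when it first meets `A`. Since `o ∈ A`, it never steps out of `o`, so all its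
-- unoriented steps are allowed in the direction in which they are used.
theorem exists_path_of_openAt {A : Set S} (hoA : o ∈ A) {x y : S} (hx : x ∉ A) (hy : y ∈ A)
    {h : ℝ} {P : S → S → Prop} (hw : ReflTransGen (fun a b => D.OpenAt h a b ∧ P a b) x y) :
    ∃ γ, IsPathTo A x γ ∧ (∀ p ∈ steps γ, P p.1 p.2) ∧ D.pathHeight γ ≠ ⊤ ∧
      (D.pathHeight γ).toReal ≤ h := by
  obtain ⟨γ, hγ, hst⟩ := exists_isPathTo hw hy
  obtain ⟨p, hp, heq⟩ := D.exists_pathHeight_eq hγ hx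
  have hpo : p.1 ≠ o := fun hpo => (hst p hp).2 (by rwa [hpo])
  refine ⟨γ, hγ, fun p hp => (hst p hp).1.2, ?_⟩
  rw [heq]
  exact OpenAt.saddle_le ho hsymm hpo (hst p hp).1.1

variable {θ : ℝ≥0} {n : ℕ} {σ : Fin (n + 1) ≃ S} {e : Fin n → S × S}
  (hier : D.IsMetastableHierarchy θ σ e)
include hier

omit ho in
theorem IsMetastableHierarchy.saddle_ne_top (k : Fin n) : D.saddle (e k).1 (e k).2 ≠ ⊤ := by
  simp [saddle, (hier.edge k).2]

omit ho hier in
theorem not_mem_firstStates (k : Fin n) : σ k.succ ∉ firstStates σ (k + 1) := by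
  simp [firstStates]

/-- Any later state has an exit edge of finite height, but a path leaving `o` begins with an
infinite saddle. -/
theorem IsMetastableHierarchy.first_eq_absorbing : σ 0 = o := by
  obtain ⟨i, rfl⟩ := σ.surjective o
  by_contra hne
  have hi : i ≠ 0 := by rintro rfl; exact hne rfl
  obtain ⟨k, rfl⟩ := Fin.exists_succ_eq.2 hi
  apply hier.saddle_ne_top k
  rw [hier.edge_height, passHeight, iInf₂_eq_top]
  intro γ hγ
  obtain ⟨y, hy⟩ := exists_step_of_isPathTo hγ (not_mem_firstStates k)
  have := D.saddle_le_pathHeight hy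
  rwa [saddle_absorbing ho, top_le_iff] at this

omit ho in
theorem IsMetastableHierarchy.passHeight_ne_top (k : Fin n) :
    D.passHeight (σ k.succ) (firstStates σ (k + 1)) ≠ ⊤ := by
  rw [← hier.edge_height]
  exact hier.saddle_ne_top k

omit ho in
theorem IsMetastableHierarchy.commHeight_toReal (k : Fin n) :
    (D.commHeight (σ k.succ) (firstStates σ (k + 1))).toReal =
      (D.saddle (e k).1 (e k).2).toReal - D.V (σ k.succ) := by
  rw [commHeight, ENNReal.toReal_sub_of_le (D.V_le_passHeight (not_mem_firstStates k))
    (hier.passHeight_ne_top k), hier.edge_height]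
  rfl

omit ho in
theorem IsMetastableHierarchy.commHeight_ne_top (k : Fin n) :
    D.commHeight (σ k.succ) (firstStates σ (k + 1)) ≠ ⊤ :=
  ne_top_of_le_ne_top (hier.passHeight_ne_top k) tsub_le_self

include hsymm in
-- Walks at height `h` become paths and conversely. The state `0` is left out of `order` because it
-- is the absorbing one, from which unoriented walks do not correspond to paths of the process.
theorem IsMetastableHierarchy.gapHierarchy (hθ : 0 < θ) :
    GapHierarchy (fun h a b => D.OpenAt h (σ a) (σ b))
      (fun k => (D.saddle (e k).1 (e k).2).toReal) (fun k => σ.symm (e k).1)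
      (fun k => σ.symm (e k).2) (fun i => D.V (σ i)) θ := by
  have h0 : σ 0 = o := hier.first_eq_absorbing ho
  have hmem : ∀ {k : ℕ} {y : Fin (n + 1)}, σ y ∈ firstStates σ k ↔ (y : ℕ) < k := by
    intro k y; simp [firstStates]
  have hoA : ∀ k : ℕ, o ∈ firstStates σ (k + 1) := fun k => by rw [← h0, hmem]; simp
  have htrans : ∀ {h : ℝ} {P : S → S → Prop} {a b : Fin (n + 1)},
      ReflTransGen (fun a b => D.OpenAt h (σ a) (σ b) ∧ P (σ a) (σ b)) a b →
        ReflTransGen (fun a b => D.OpenAt h a b ∧ P a b) (σ a) (σ b) :=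
    fun {h P a b} hab => ReflTransGen.lift σ (fun _ _ h => h) _ _ hab
  refine ⟨by exact_mod_cast hθ, fun h a b => OpenAt.symm, fun h h' a b hh => OpenAt.mono hh,
    fun k => ?_, fun k h hQ => ?_, fun k => ?_, fun k h y hy hw => ?_,
    fun k i y h hi hik hy hyi hw => ?_⟩
  · simp only [Equiv.apply_symm_apply]
    exact ⟨(hier.edge k).1, _, _, rfl, hier.saddle_ne_top k, le_rfl⟩
  · simp only [Equiv.apply_symm_apply] at hQ
    refine (OpenAt.saddle_le ho hsymm ?_ hQ).2
    intro he
    apply hier.saddle_ne_top k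
    rw [he, saddle_absorbing ho]
  · obtain ⟨γ, hγ, heq⟩ : ∃ γ, IsPathTo (firstStates σ (k + 1)) (σ k.succ) γ ∧
        D.pathHeight γ = D.passHeight (σ k.succ) (firstStates σ (k + 1)) := by
      -- If no path attained the infimum, `gap` would place every path, hence the infimum itself,
      -- higher by `θ`.
      by_contra! hne
      have h1 : D.saddle (e k).1 (e k).2 + θ ≤
          D.passHeight (σ k.succ) (firstStates σ (k + 1)) :=
        le_iInf₂ fun γ hγ => hier.gap k γ hγ (hne γ hγ)
      rw [← hier.edge_height] at h1
      exact absurd h1 (not_le.2 (ENNReal.lt_add_right (hier.saddle_ne_top k) (by simpa using hθ.ne')))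
    obtain ⟨y, hy, hlast⟩ := hγ.finish
    have hw := reflTransGen_of_list hγ.start hlast
    have hnd : ∀ (l : List S), l.Nodup → ∀ p ∈ steps l, p.1 ≠ p.2 := by
      intro l
      induction l with
      | nil => simp [steps]
      | cons a l ih =>
        rcases l with _ | ⟨b, l⟩
        · simp [steps]
        · intro hl p hp
          rw [steps_cons_cons, List.mem_cons] at hp
          rcases hp with rfl | hp
          · rintro h
            simp only at h
            simp [h] at hl
          · exact ih (List.nodup_cons.1 hl).2 p hp
    refine ⟨σ.symm y, ?_, ?_⟩
    · have : (σ.symm y : ℕ) < k + 1 := hy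
      rw [Fin.le_def, Fin.val_castSucc]
      omega
    · rw [← σ.symm_apply_apply k.succ]
      refine ReflTransGen.lift (p := fun a b => D.OpenAt (D.saddle (e k).1 (e k).2).toReal
        (σ a) (σ b)) σ.symm (fun a b hab => ?_) _ _ hw
      · have hle : D.saddle a b ≤ D.saddle (e k).1 (e k).2 := by
          rw [hier.edge_height, ← heq]
          exact D.saddle_le_pathHeight hab
        simp only [Function.onFun, σ.apply_symm_apply]
        exact ⟨hnd γ hγ.nodup _ hab, a, b, rfl, ne_top_of_le_ne_top (hier.saddle_ne_top k) hle,
          ENNReal.toReal_mono (hier.saddle_ne_top k) hle⟩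
  · have hne : ∀ a b, s(a, b) ≠ s(σ.symm (e k).1, σ.symm (e k).2) →
        s(σ a, σ b) ≠ s((e k).1, (e k).2) := by
      intro a b hab he
      apply hab
      rcases Sym2.eq_iff.1 he with ⟨h1, h2⟩ | ⟨h1, h2⟩
      · rw [← h1, ← h2, σ.symm_apply_apply, σ.symm_apply_apply]
      · rw [← h1, ← h2, σ.symm_apply_apply, σ.symm_apply_apply, Sym2.eq_swap]
    have hw' := htrans (P := fun a b => s(a, b) ≠ s((e k).1, (e k).2)) (reflTransGen_mono
      (fun a b hab => ⟨hab.1, hne a b hab.2⟩) hw)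
    obtain ⟨γ, hγ, hP, hfin, hle⟩ := exists_path_of_openAt ho hsymm (hoA k)
      (not_mem_firstStates k) (hmem.2 (by
        rw [Fin.le_def, Fin.val_castSucc] at hy
        omega)) hw'
    -- A minimal path would meet its height on the excluded edge by `unique`, so the path is not
    -- minimal and `gap` applies.
    by_cases heq : D.pathHeight γ = D.passHeight (σ k.succ) (firstStates σ (k + 1))
    · obtain ⟨p, hp, hpe⟩ := D.exists_pathHeight_eq hγ (not_mem_firstStates k)
      exact absurd (hier.unique k γ hγ heq p hp (by rw [← hpe, heq])) (hP p hp)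
    · have h1 := ENNReal.toReal_mono hfin (hier.gap k γ hγ heq)
      rw [ENNReal.toReal_add (hier.saddle_ne_top k) ENNReal.coe_ne_top] at h1
      exact h1.trans hle
  · have hik' : (i : ℕ) ≤ k := by simpa [Fin.le_def] using hik
    have hi0 : i ≠ 0 := hi.ne'
    -- Since `i ≠ 0`, the cemetery stays in the target set, as `exists_path_of_openAt` requires.
    have hoA' : o ∈ firstStates σ (k + 2) \ {σ i} := by
      refine ⟨hoA _, fun h => hi0 ?_⟩
      rw [Set.mem_singleton_iff, ← h0] at h
      exact (σ.injective h).symm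
    have hyA : σ y ∈ firstStates σ (k + 2) \ {σ i} := by
      refine ⟨hmem.2 ?_, fun h => hyi (σ.injective h)⟩
      rw [Fin.le_def, Fin.val_succ] at hy
      omega
    have hiA : σ i ∉ firstStates σ (k + 2) \ {σ i} := fun h => h.2 rfl
    obtain ⟨γ, hγ, -, hfin, hle⟩ := exists_path_of_openAt ho hsymm hoA' hiA hyA
      (htrans (P := fun _ _ => True) (reflTransGen_mono (fun a b hab => ⟨hab, trivial⟩) hw))
    have h1 := hier.order k i (by rw [Fin.lt_def, Fin.val_succ]; omega)
    have h2 : D.commHeight (σ i) (firstStates σ (k + 2) \ {σ i}) ≤ D.pathHeight γ - D.V (σ i) :=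
      tsub_le_tsub_right (iInf₂_le γ hγ) _
    have h3 := ENNReal.toReal_mono (ne_top_of_le_ne_top hfin tsub_le_self) (h1.trans h2)
    rw [ENNReal.toReal_add (hier.commHeight_ne_top k) ENNReal.coe_ne_top,
      hier.commHeight_toReal, ENNReal.toReal_sub_of_le (D.V_le_pathHeight hγ hiA) hfin] at h3
    simp only [ENNReal.coe_toReal] at h3
    linarith

end Absorbing

end JumpData

/-! ### Active orbits, phases and sums over orbits. -/

section Characters

open MulAction
open scoped Classical

variable {X G : Type*} [Fintype X] [Group G] [Fintype G] [MulAction G X]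

theorem norm_character (χ : G →* ℂˣ) (g : G) : ‖(χ g : ℂ)‖ = 1 := by
  refine Complex.norm_eq_one_of_pow_eq_one (n := Fintype.card G) ?_ Fintype.card_ne_zero
  rw [← Units.val_pow_eq_pow_val, ← map_pow, pow_card_eq_one, map_one, Units.val_one]

theorem conj_character (χ : G →* ℂˣ) (g : G) : starRingEnd ℂ (χ g : ℂ) = (χ g⁻¹ : ℂ) := by
  rw [map_inv, Units.val_inv_eq_inv_val]
  exact (RCLike.inv_eq_conj (norm_character χ g)).symm

omit [Fintype X] [Fintype G] in
theorem orbitOf_smul (g : G) (a : X) : orbitOf G (g • a) = orbitOf G a :=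
  Quotient.sound ⟨g, rfl⟩

omit [Fintype X] [Fintype G] in
theorem orbitOf_eq_iff {a b : X} : orbitOf G a = orbitOf G b ↔ ∃ g : G, g • b = a := by
  constructor
  · intro h
    exact Quotient.exact h
  · rintro ⟨g, rfl⟩
    exact orbitOf_smul g b

omit [Fintype X] in
theorem card_filter_smul_eq (a b : X) (h : orbitOf G b = orbitOf G a) :
    (Finset.univ.filter (fun g : G => g • a = b)).card = Nat.card (stabilizer G b) := by
  obtain ⟨k, rfl⟩ := orbitOf_eq_iff.1 h
  rw [Nat.card_eq_fintype_card, Fintype.card_subtype]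
  refine Finset.card_bij (fun g _ => g * k⁻¹) ?_ ?_ ?_
  · intro g hg
    simp only [Finset.mem_filter, Finset.mem_univ, true_and] at hg ⊢
    simp [mem_stabilizer_iff, mul_smul, hg]
  · intro g _ g' _ h
    exact mul_right_cancel h
  · intro g hg
    simp only [Finset.mem_filter, Finset.mem_univ, true_and, mem_stabilizer_iff] at hg
    exact ⟨g * k, by simp [mul_smul, hg], by simp⟩

theorem card_orbit_mul_card_stabilizer (a : X) :
    (Finset.univ.filter (fun b : X => orbitOf G b = orbitOf G a)).card *
      Nat.card (stabilizer G a) = Fintype.card G := by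
  rw [← MulAction.card_orbit_mul_card_stabilizer_eq_card_group G a, Nat.card_eq_fintype_card]
  congr 1
  rw [Fintype.card_subtype]
  congr 1
  ext b
  simp only [Finset.mem_filter, Finset.mem_univ, true_and]
  rw [orbitOf_eq_iff]
  rfl

/-- The trace is an average of the character sums over the stabilisers of the points. Such a sum is
the order of the stabiliser if `χ` is trivial on it, and vanishes otherwise. Stabilisers in an orbit
are conjugate, so the same case holds at all its points and the trace is `1` or `0`. -/
theorem isActive_iff {χ : G →* ℂˣ} {A : orbitRel.Quotient G X} :
    IsActive χ A ↔ ∀ a : X, orbitOf G a = A → ∀ g : G, g • a = a → χ g = 1 := by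
  have htrace : (projMat A.orbit χ).trace = (Fintype.card G : ℂ)⁻¹ *
      ∑ a : A.orbit, ∑ g : G, if g • (a : X) = a then (χ g⁻¹ : ℂ) else 0 := by
    simp only [Matrix.trace, projMat, Matrix.diag_apply, Matrix.smul_apply, Matrix.sum_apply,
      smul_eq_mul, permMat, conj_character, ← Finset.mul_sum]
    congr 1
    refine Finset.sum_congr rfl fun a _ => Finset.sum_congr rfl fun g _ => ?_
    simp only [Subtype.ext_iff, orbitRel.Quotient.orbit.coe_smul]
    split_ifs <;> simp
  unfold IsActive
  constructor
  · intro h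
    by_contra! hne
    obtain ⟨a, ha, g₀, hg₀, hχ⟩ := hne
    have hz : ∀ b : A.orbit, (∑ g : G, if g • (b : X) = b then (χ g⁻¹ : ℂ) else 0) = 0 := by
      rintro ⟨b, hb⟩
      have hb' : orbitOf G b = A := orbitRel.Quotient.mem_orbit.1 hb
      obtain ⟨k, hk⟩ := orbitOf_eq_iff.1 (hb'.trans ha.symm)
      set s : G := k * g₀ * k⁻¹ with hs
      have hsb : s • b = b := by
        rw [hs, ← hk]; simp [mul_smul, hg₀]
      have hχs : (χ s : ℂ) ≠ 1 := by
        rw [hs, map_mul, map_mul, map_inv, mul_comm (χ k), mul_assoc, mul_inv_cancel, mul_one]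
        exact fun h => hχ (Units.ext h)
      -- Translation by an element `s` of the stabiliser permutes the terms and multiplies the sum
      -- by `χ s ≠ 1`.
      have hshift : (∑ g : G, if g • b = b then (χ g⁻¹ : ℂ) else 0) =
          (χ s : ℂ) * ∑ g : G, if g • b = b then (χ g⁻¹ : ℂ) else 0 := by
        conv_lhs => rw [← Equiv.sum_comp (Equiv.mulLeft s⁻¹)]
        rw [Finset.mul_sum]
        refine Finset.sum_congr rfl fun g _ => ?_
        have h1 : (s⁻¹ * g) • b = b ↔ g • b = b := by
          rw [mul_smul, inv_smul_eq_iff, hsb]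
        simp only [Equiv.coe_mulLeft, h1]
        split_ifs
        · rw [mul_inv_rev, inv_inv, map_mul, Units.val_mul, mul_comm]
        · simp
      have h2 : (1 - (χ s : ℂ)) * ∑ g : G, (if g • b = b then (χ g⁻¹ : ℂ) else 0) = 0 := by
        rw [sub_mul, one_mul, ← hshift, sub_self]
      exact (mul_eq_zero.1 h2).resolve_left (sub_ne_zero.2 hχs.symm)
    rw [htrace, Finset.sum_eq_zero (fun b _ => hz b), mul_zero] at h
    exact zero_ne_one h
  · intro h
    have hone : ∀ b : A.orbit, (∑ g : G, if g • (b : X) = b then (χ g⁻¹ : ℂ) else 0) =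
        (Nat.card (stabilizer G (b : X)) : ℂ) := by
      rintro ⟨b, hb⟩
      have hb' : orbitOf G b = A := orbitRel.Quotient.mem_orbit.1 hb
      rw [← card_filter_smul_eq b b rfl, Finset.card_filter]
      push_cast
      refine Finset.sum_congr rfl fun g _ => ?_
      split_ifs with hg
      · rw [map_inv, h b hb' g hg]; simp
      · rfl
    have hcard : ∀ b : A.orbit, (Nat.card (stabilizer G (b : X)) : ℂ) =
        Fintype.card G * (Fintype.card A.orbit : ℂ)⁻¹ := by
      rintro ⟨b, hb⟩
      have hb' : orbitOf G b = A := orbitRel.Quotient.mem_orbit.1 hb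
      have h1 := card_orbit_mul_card_stabilizer (G := G) b
      have h2 : (Finset.univ.filter (fun x : X => orbitOf G x = orbitOf G b)).card =
          Fintype.card A.orbit := by
        rw [Fintype.card_subtype]
        congr 1
        ext x
        simp only [Finset.mem_filter, Finset.mem_univ, true_and]
        rw [hb']
        exact orbitRel.Quotient.mem_orbit.symm
      rw [h2] at h1
      have h3 : (Fintype.card A.orbit : ℂ) ≠ 0 := by
        have : Nonempty A.orbit := ⟨⟨b, hb⟩⟩
        exact_mod_cast Fintype.card_ne_zero
      rw [← h1]
      push_cast
      field_simp
    rw [htrace]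
    simp only [hone, hcard]
    rw [Finset.sum_const, Finset.card_univ, nsmul_eq_mul]
    have h3 : (Fintype.card A.orbit : ℂ) ≠ 0 := by
      have : Nonempty A.orbit := ⟨⟨Quotient.out A, orbitRel.Quotient.mem_orbit.2 (Quotient.out_eq' A)⟩⟩
      exact_mod_cast Fintype.card_ne_zero
    have h4 : (Fintype.card G : ℂ) ≠ 0 := by exact_mod_cast Fintype.card_ne_zero
    field_simp

variable (χ : G →* ℂˣ) {rep : orbitRel.Quotient G X → X} (hrep : ∀ A, orbitOf G (rep A) = A)
include hrep

omit [Fintype X] [Fintype G] in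
theorem exists_smul_rep (b : X) : ∃ g : G, g • rep (orbitOf G b) = b :=
  orbitOf_eq_iff.1 (hrep _).symm

variable {χ}

/-- Two elements carrying the representative to `b` differ by an element of its stabiliser, where
`χ` is trivial; their number is the order of the stabiliser of `b`. -/
theorem phase_of_active {b : X} (hb : IsActive χ (orbitOf G b)) {g : G}
    (hg : g • rep (orbitOf G b) = b) : phase χ rep b = χ g := by
  have hact := isActive_iff.1 hb
  have h1 : ∀ k ∈ Finset.univ.filter (fun k : G => k • rep (orbitOf G b) = b),
      (χ k : ℂ) = χ g := by
    intro k hk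
    simp only [Finset.mem_filter, Finset.mem_univ, true_and] at hk
    have h2 : χ (g⁻¹ * k) = 1 := hact _ (hrep _) _ (by rw [mul_smul, hk, inv_smul_eq_iff, hg])
    rw [map_mul, map_inv, inv_mul_eq_one] at h2
    rw [h2]
  rw [phase, Finset.sum_congr rfl h1, Finset.sum_const, card_filter_smul_eq _ _ (hrep _).symm,
    nsmul_eq_mul, ← mul_assoc, inv_mul_cancel₀, one_mul]
  exact_mod_cast Nat.card_pos.ne'

omit hrep in
theorem phase_of_not_active {b : X} (hb : ¬ IsActive χ (orbitOf G b)) : phase χ rep b = 0 := by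
  rw [isActive_iff] at hb
  push Not at hb
  obtain ⟨a, ha, g₀, hg₀, hχ⟩ := hb
  obtain ⟨k, hk⟩ := orbitOf_eq_iff.1 ha.symm
  set s : G := k * g₀ * k⁻¹ with hs
  have hsb : s • b = b := by rw [hs, ← hk]; simp [mul_smul, hg₀]
  have hχs : (χ s : ℂ) ≠ 1 := by
    rw [hs, map_mul, map_mul, map_inv, mul_comm (χ k), mul_assoc, mul_inv_cancel, mul_one]
    exact fun h => hχ (Units.ext h)
  rw [phase]
  have hshift : ∑ g ∈ Finset.univ.filter (fun g : G => g • rep (orbitOf G b) = b), (χ g : ℂ) =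
      (χ s : ℂ) * ∑ g ∈ Finset.univ.filter (fun g : G => g • rep (orbitOf G b) = b), (χ g : ℂ) := by
    rw [Finset.mul_sum, Finset.sum_filter, Finset.sum_filter]
    conv_lhs => rw [← Equiv.sum_comp (Equiv.mulLeft s)]
    refine Finset.sum_congr rfl fun g _ => ?_
    have h1 : (s * g) • rep (orbitOf G b) = b ↔ g • rep (orbitOf G b) = b := by
      rw [mul_smul, ← eq_inv_smul_iff, show s⁻¹ • b = b by rw [inv_smul_eq_iff, hsb]]
    simp only [Equiv.coe_mulLeft, h1, map_mul, Units.val_mul]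
  have h2 : (1 - (χ s : ℂ)) *
      ∑ g ∈ Finset.univ.filter (fun g : G => g • rep (orbitOf G b) = b), (χ g : ℂ) = 0 := by
    rw [sub_mul, one_mul, ← hshift, sub_self]
  rw [(mul_eq_zero.1 h2).resolve_left (sub_ne_zero.2 hχs.symm), mul_zero]

theorem phase_smul (g : G) (b : X) : phase χ rep (g • b) = χ g * phase χ rep b := by
  by_cases hb : IsActive χ (orbitOf G b)
  · obtain ⟨k, hk⟩ := exists_smul_rep hrep b
    rw [phase_of_active hrep hb hk, phase_of_active hrep (g := g * k)
      (by rwa [orbitOf_smul]) (by rw [orbitOf_smul, mul_smul, hk]), map_mul, Units.val_mul]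
  · rw [phase_of_not_active hb, phase_of_not_active (by rwa [orbitOf_smul]), mul_zero]

theorem norm_phase {b : X} (hb : IsActive χ (orbitOf G b)) : ‖phase χ rep b‖ = 1 := by
  obtain ⟨k, hk⟩ := exists_smul_rep hrep b
  rw [phase_of_active hrep hb hk, norm_character]

theorem norm_phase_le (b : X) : ‖phase χ rep b‖ ≤ 1 := by
  by_cases hb : IsActive χ (orbitOf G b)
  · exact (norm_phase hrep hb).le
  · rw [phase_of_not_active hb]; simp

theorem phase_rep {A : orbitRel.Quotient G X} (hA : IsActive χ A) : phase χ rep (rep A) = 1 := by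
  rw [phase_of_active hrep (g := 1) (by rwa [hrep]) (by rw [hrep, one_smul]), map_one,
    Units.val_one]

/-- In the closed unit disc only the point `1` has real part `1`. This positivity prevents
cancellations among the killing terms. -/
theorem one_sub_phase_re_pos {b : X} (hb : phase χ rep b ≠ 1) : 0 < (1 - phase χ rep b).re := by
  have h1 := norm_phase_le (χ := χ) hrep b
  have h2 := (Complex.re_le_norm (phase χ rep b)).trans h1
  rw [Complex.sub_re, Complex.one_re, sub_pos]
  refine lt_of_le_of_ne h2 fun h3 => hb ?_
  have h4 : (phase χ rep b).im = 0 := by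
    have := Complex.sq_norm (phase χ rep b)
    rw [Complex.normSq_apply, h3] at this
    nlinarith [norm_nonneg (phase χ rep b)]
  exact Complex.ext h3 h4

theorem one_sub_phase_re_nonneg (b : X) : 0 ≤ (1 - phase χ rep b).re := by
  by_cases hb : phase χ rep b = 1
  · simp [hb]
  · exact (one_sub_phase_re_pos hrep hb).le

/-- Orbit-stabiliser: normalising by the stabiliser at one point amounts to normalising by the group
over the whole orbit, which makes the two orbits in `orbit_sum_swap` play symmetric roles. -/
theorem orbit_sum_rep {R : Type*} [Field R] [CharZero R] (A : orbitRel.Quotient G X) {q : X → R}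
    (hq : ∀ (g : G) a, q (g • a) = q a) :
    (Nat.card (stabilizer G (rep A)) : R)⁻¹ * q (rep A) =
      (Fintype.card G : R)⁻¹ * ∑ a ∈ Finset.univ.filter (fun a : X => orbitOf G a = A), q a := by
  have h1 : ∀ a ∈ Finset.univ.filter (fun a : X => orbitOf G a = A), q a = q (rep A) := by
    intro a ha
    simp only [Finset.mem_filter, Finset.mem_univ, true_and] at ha
    obtain ⟨g, hg⟩ := exists_smul_rep hrep a
    rw [← hg, hq, ha]
  have h2 := card_orbit_mul_card_stabilizer (G := G) (rep A)
  rw [hrep] at h2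
  rw [Finset.sum_congr rfl h1, Finset.sum_const, nsmul_eq_mul, ← h2]
  have h3 : (Nat.card (stabilizer G (rep A)) : R) ≠ 0 := by exact_mod_cast Nat.card_pos.ne'
  have h4 : ((Finset.univ.filter (fun a : X => orbitOf G a = A)).card : R) ≠ 0 := by
    have : (Finset.univ.filter (fun a : X => orbitOf G a = A)).card ≠ 0 :=
      Finset.card_ne_zero.2 ⟨rep A, by simp [hrep]⟩
    exact_mod_cast this
  push_cast
  field_simp

/-- Exchange of the roles of two orbits in a sum of an invariant function of two points. -/
theorem orbit_sum_swap {R : Type*} [Field R] [CharZero R] (A B : orbitRel.Quotient G X)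
    {w : X → X → R} (hw : ∀ (g : G) a b, w (g • a) (g • b) = w a b) :
    (Nat.card (stabilizer G (rep A)) : R)⁻¹ *
        ∑ b ∈ Finset.univ.filter (fun b : X => orbitOf G b = B), w (rep A) b =
      (Nat.card (stabilizer G (rep B)) : R)⁻¹ *
        ∑ a ∈ Finset.univ.filter (fun a : X => orbitOf G a = A), w a (rep B) := by
  rw [orbit_sum_rep hrep A
    (q := fun a => ∑ b ∈ Finset.univ.filter (fun b : X => orbitOf G b = B), w a b),
    orbit_sum_rep hrep B
    (q := fun b => ∑ a ∈ Finset.univ.filter (fun a : X => orbitOf G a = A), w a b),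
    Finset.sum_comm]
  · intro g b
    rw [Finset.sum_filter, Finset.sum_filter, ← Equiv.sum_comp (MulAction.toPerm g)]
    simp only [MulAction.toPerm_apply, hw, orbitOf_smul]
  · intro g b
    rw [Finset.sum_filter, Finset.sum_filter, ← Equiv.sum_comp (MulAction.toPerm g)]
    simp only [MulAction.toPerm_apply, hw, orbitOf_smul]

end Characters

/-! ### Arrhenius factors with possibly infinite exponent. -/

section Arrhenius

theorem arrhenius_top (ε : ℝ) : arrhenius ⊤ ε = 0 := by simp [arrhenius]

theorem arrhenius_of_ne_top {h : ℝ≥0∞} (hh : h ≠ ⊤) (ε : ℝ) :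
    arrhenius h ε = Real.exp (-h.toReal / ε) := by simp [arrhenius, hh]

theorem arrhenius_nonneg (h : ℝ≥0∞) (ε : ℝ) : 0 ≤ arrhenius h ε := by
  unfold arrhenius
  split_ifs <;> positivity

theorem arrhenius_add (a b : ℝ≥0∞) (ε : ℝ) :
    arrhenius (a + b) ε = arrhenius a ε * arrhenius b ε := by
  by_cases ha : a = ⊤
  · simp [ha, arrhenius_top]
  by_cases hb : b = ⊤
  · simp [hb, arrhenius_top]
  rw [arrhenius_of_ne_top ha, arrhenius_of_ne_top hb, arrhenius_of_ne_top (by simp [ha, hb]),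
    ENNReal.toReal_add ha hb, ← Real.exp_add]
  congr 1
  ring

theorem arrhenius_coe (a : ℝ≥0) (ε : ℝ) : arrhenius a ε = Real.exp (-a / ε) := by
  rw [arrhenius_of_ne_top ENNReal.coe_ne_top, ENNReal.coe_toReal]

theorem arrhenius_anti {a b : ℝ≥0∞} (hab : a ≤ b) {ε : ℝ} (hε : 0 < ε) :
    arrhenius b ε ≤ arrhenius a ε := by
  by_cases hb : b = ⊤
  · rw [hb, arrhenius_top]
    exact arrhenius_nonneg _ _
  have ha : a ≠ ⊤ := ne_top_of_le_ne_top hb hab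
  rw [arrhenius_of_ne_top ha, arrhenius_of_ne_top hb]
  have := ENNReal.toReal_mono hb hab
  gcongr

end Arrhenius

/-! ### Invariance of the data, and the matrix of the restricted generator. -/

namespace JumpData

open MulAction Relation

section Invariance

open scoped Classical

variable {X G : Type*} [Fintype X] [Group G] [MulAction G X] {D : JumpData X}
  (hD : D.IsReversible) (hinv : D.IsInvariant G)

include hD in
omit [Fintype X] in
-- The difference `f (g • a) - f a` is unchanged along transitions, hence constant by
-- irreducibility. Iterating `g` up to its order returns to the starting point, so the constant is
-- zero.
theorem invariant_of_increment {f : X → ℝ} {g : G}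
    (hf : ∀ a b, a ≠ b → D.h a b ≠ ⊤ → f (g • a) - f a = f (g • b) - f b) [Finite G] (a : X) :
    f (g • a) = f a := by
  have hconst : ∀ b, f (g • b) - f b = f (g • a) - f a := by
    intro b
    have := hD.irreducible a b
    induction this with
    | refl => rfl
    | @tail y z _ hyz ih => rw [← ih, hf y z hyz.1 hyz.2]
  have hpow : ∀ k : ℕ, f (g ^ k • a) = f a + k * (f (g • a) - f a) := by
    intro k
    induction k with
    | zero => simp
    | succ k ih =>
      have := hconst (g ^ k • a)
      rw [pow_succ', mul_smul]
      push_cast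
      linarith
  have h1 := hpow (orderOf g)
  rw [pow_orderOf_eq_one, one_smul] at h1
  have h2 : (orderOf g : ℝ) ≠ 0 := by exact_mod_cast (orderOf_pos g).ne'
  have h3 : (orderOf g : ℝ) * (f (g • a) - f a) = 0 := by linarith
  linarith [(mul_eq_zero.1 h3).resolve_left h2]

include hinv in
theorem gen_smul {ε : ℝ} (hε : 0 < ε) (g : G) (a b : X) :
    D.gen ε (g • a) (g • b) = D.gen ε a b := by
  have h := congrFun (congrFun (hinv ε hε g) a) (g • b)
  simp only [Matrix.mul_apply, permMat, ite_mul, one_mul, zero_mul, mul_ite, mul_one, mul_zero,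
    Finset.sum_ite_eq, Finset.mem_univ, if_true, smul_left_cancel_iff, Finset.sum_ite_eq'] at h
  simpa only [genC, Matrix.map_apply, Complex.ofReal_inj] using h

include hinv in
theorem rate_smul {ε : ℝ} (hε : 0 < ε) (g : G) {a b : X} (hab : a ≠ b) :
    D.rate ε (g • a) (g • b) = D.rate ε a b := by
  have h := gen_smul hinv hε g a b
  have hab' : g • a ≠ g • b := fun h => hab (smul_left_cancel g h)
  simpa [gen, hab, hab'] using h

include hD hinv in
-- Invariance holds for every noise intensity. Comparing the rates at `ε = 1` and `ε = 1 / 2`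
-- eliminates the prefactors and leaves equal exponents.
theorem h_smul (g : G) {a b : X} (hab : a ≠ b) : D.h (g • a) (g • b) = D.h a b := by
  have hab' : g • a ≠ g • b := fun h => hab (smul_left_cancel g h)
  have hp : 0 < D.c a b / D.m a := div_pos (hD.c_pos _ _ hab) (hD.m_pos _)
  have hp' : 0 < D.c (g • a) (g • b) / D.m (g • a) := div_pos (hD.c_pos _ _ hab') (hD.m_pos _)
  have h1 := rate_smul hinv one_pos g hab
  have h2 := rate_smul hinv (ε := 1 / 2) (by norm_num) g hab
  simp only [rate] at h1 h2
  by_cases ht : D.h a b = ⊤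
  · rw [ht, arrhenius_top, mul_zero] at h1
    have h3 := (mul_eq_zero.1 h1).resolve_left hp'.ne'
    by_contra hne
    rw [ht] at hne
    rw [arrhenius_of_ne_top hne] at h3
    exact (Real.exp_pos _).ne' h3
  · by_cases ht' : D.h (g • a) (g • b) = ⊤
    · rw [ht', arrhenius_top, mul_zero] at h1
      have h3 := (mul_eq_zero.1 h1.symm).resolve_left hp.ne'
      rw [arrhenius_of_ne_top ht] at h3
      exact absurd h3 (Real.exp_pos _).ne'
    · rw [arrhenius_of_ne_top ht, arrhenius_of_ne_top ht'] at h1 h2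
      set x := (D.h a b).toReal
      set x' := (D.h (g • a) (g • b)).toReal
      have e1 : Real.exp (-x / (1 / 2)) = Real.exp (-x / 1) * Real.exp (-x / 1) := by
        rw [← Real.exp_add]; congr 1; ring
      have e2 : Real.exp (-x' / (1 / 2)) = Real.exp (-x' / 1) * Real.exp (-x' / 1) := by
        rw [← Real.exp_add]; congr 1; ring
      rw [e1, e2, ← mul_assoc, ← mul_assoc, h1] at h2
      have h3 := mul_left_cancel₀ (mul_pos hp (Real.exp_pos _)).ne' h2
      rw [Real.exp_eq_exp] at h3
      have h4 : x' = x := by linarith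
      exact (ENNReal.toReal_eq_toReal_iff' ht' ht).1 h4

include hD hinv in
theorem c_div_m_smul (g : G) {a b : X} (hab : a ≠ b) (ht : D.h a b ≠ ⊤) :
    D.c (g • a) (g • b) / D.m (g • a) = D.c a b / D.m a := by
  have h1 := rate_smul hinv one_pos g hab
  rw [rate, rate, h_smul hD hinv g hab, arrhenius_of_ne_top ht] at h1
  exact mul_right_cancel₀ (Real.exp_pos _).ne' h1

include hD in
omit [Fintype X] in
theorem h_ne_top_symm {a b : X} (hab : a ≠ b) (ht : D.h a b ≠ ⊤) : D.h b a ≠ ⊤ := by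
  intro h
  have := hD.reversible a b hab
  rw [h, add_top] at this
  simp [ht] at this

variable [Finite G]

include hD hinv in
theorem V_smul (g : G) (a : X) : D.V (g • a) = D.V a := by
  have key := invariant_of_increment hD (f := fun x => (D.V x : ℝ)) (g := g) ?_ a
  · exact_mod_cast key
  · intro a b hab ht
    have hab' : g • a ≠ g • b := fun h => hab (smul_left_cancel g h)
    have ht' := h_ne_top_symm hD hab ht
    have h1 := congrArg ENNReal.toReal (hD.reversible a b hab)
    have h2 := congrArg ENNReal.toReal (hD.reversible _ _ hab')
    rw [h_smul hD hinv g hab, h_smul hD hinv g hab.symm] at h2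
    rw [ENNReal.toReal_add ENNReal.coe_ne_top ht, ENNReal.toReal_add ENNReal.coe_ne_top ht'] at h1 h2
    simp only [ENNReal.coe_toReal] at h1 h2
    linarith

include hD hinv in
-- The rates only determine `c / m`. By symmetry of `c`, the ratio of these quotients for the two
-- directions of a transition is a ratio of masses, so the increments of `log m` are invariant.
theorem m_smul (g : G) (a : X) : D.m (g • a) = D.m a := by
  have key := invariant_of_increment hD (f := fun x => Real.log (D.m x)) (g := g) ?_ a
  · exact Real.log_injOn_pos (hD.m_pos _) (hD.m_pos _) key
  · intro a b hab ht
    have hab' : g • a ≠ g • b := fun h => hab (smul_left_cancel g h)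
    have h1 := c_div_m_smul hD hinv g hab ht
    have h2 := c_div_m_smul hD hinv g hab.symm (h_ne_top_symm hD hab ht)
    rw [hD.c_symm b a, hD.c_symm (g • b)] at h2
    have p1 := (hD.m_pos a).ne'
    have p2 := (hD.m_pos b).ne'
    have p3 := (hD.m_pos (g • a)).ne'
    have p4 := (hD.m_pos (g • b)).ne'
    have p5 := (hD.c_pos _ _ hab).ne'
    rw [← Real.log_div p3 p1, ← Real.log_div p4 p2]
    congr 1
    rw [div_eq_div_iff p3 p1] at h1
    rw [div_eq_div_iff p4 p2] at h2
    rw [div_eq_div_iff p1 p2]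
    have p6 := (hD.c_pos _ _ hab').ne'
    apply mul_left_cancel₀ (mul_ne_zero p5 p6)
    linear_combination (D.c a b * D.m (g • a)) * h2 - (D.c a b * D.m (g • b)) * h1

include hD hinv in
theorem c_smul (g : G) {a b : X} (hab : a ≠ b) (ht : D.h a b ≠ ⊤) :
    D.c (g • a) (g • b) = D.c a b := by
  have h := c_div_m_smul hD hinv g hab ht
  rw [m_smul hD hinv] at h
  have p1 := (hD.m_pos a).ne'
  field_simp at h
  exact h

include hD hinv in
theorem saddle_smul (g : G) {a b : X} (hab : a ≠ b) : D.saddle (g • a) (g • b) = D.saddle a b := by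
  rw [saddle, saddle, V_smul hD hinv, h_smul hD hinv g hab]

include hD in
omit [Fintype X] [Finite G] in
theorem saddle_comm {a b : X} (hab : a ≠ b) : D.saddle a b = D.saddle b a :=
  hD.reversible a b hab

omit [Fintype X] in
theorem saddle_ne_top_iff {a b : X} : D.saddle a b ≠ ⊤ ↔ D.h a b ≠ ⊤ := by
  simp [saddle]

omit [Fintype X] [MulAction G X] [Finite G] [Group G] in
theorem weight_mul_rate {a b : X} (hm : D.m a ≠ 0) (ε : ℝ) :
    D.m a * Real.exp (-D.V a / ε) * D.rate ε a b = D.c a b * arrhenius (D.saddle a b) ε := by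
  rw [rate, saddle, arrhenius_add, arrhenius_coe]
  field_simp

end Invariance

section Lift

open scoped Classical

variable {X G : Type*} [Fintype X] [Group G] [Fintype G] [MulAction G X] {D : JumpData X}
  {χ : G →* ℂˣ} {rep : orbitRel.Quotient G X → X} (hrep : ∀ A, orbitOf G (rep A) = A)

theorem projMat_mulVec (v : X → ℂ) (a : X) : (projMat X χ).mulVec v a =
    (Fintype.card G : ℂ)⁻¹ * ∑ g : G, (χ g⁻¹ : ℂ) * v (g • a) := by
  simp only [Matrix.mulVec, dotProduct, projMat, Matrix.smul_apply, Matrix.sum_apply, smul_eq_mul,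
    conj_character, mul_assoc, ← Finset.mul_sum, Finset.sum_mul]
  rw [Finset.sum_comm]
  congr 1
  simp [permMat]

theorem mem_isotypic_iff {u : X → ℂ} :
    u ∈ isotypic X χ ↔ ∀ (g : G) a, u (g • a) = χ g * u a := by
  constructor
  · rintro ⟨v, rfl⟩ g a
    simp only [Matrix.mulVecLin_apply, projMat_mulVec]
    rw [mul_left_comm]
    congr 1
    rw [← Equiv.sum_comp (Equiv.mulRight g) (fun k => (χ k⁻¹ : ℂ) * v (k • a)), Finset.mul_sum]
    refine Finset.sum_congr rfl fun k _ => ?_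
    simp only [Equiv.coe_mulRight, mul_inv_rev, map_mul, map_inv, Units.val_mul, mul_smul]
    rw [← mul_assoc, ← mul_assoc, Units.mul_inv, one_mul]
  · intro hu
    refine ⟨u, ?_⟩
    ext a
    rw [Matrix.mulVecLin_apply, projMat_mulVec]
    have h1 : ∀ g ∈ (Finset.univ : Finset G), (χ g⁻¹ : ℂ) * u (g • a) = u a := by
      intro g _
      rw [hu, map_inv, ← mul_assoc, Units.inv_mul, one_mul]
    rw [Finset.sum_congr rfl h1, Finset.sum_const, Finset.card_univ, nsmul_eq_mul, ← mul_assoc,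
      inv_mul_cancel₀, one_mul]
    exact_mod_cast Fintype.card_ne_zero

variable (χ rep) in
/-- The equivariant function with given values at the representatives of the active orbits. -/
def lift : (ActiveOrbit X χ → ℂ) →ₗ[ℂ] (X → ℂ) where
  toFun F b := phase χ rep b * if h : IsActive χ (orbitOf G b) then F ⟨_, h⟩ else 0
  map_add' F F' := by
    ext b
    by_cases h : IsActive χ (orbitOf G b) <;> simp [h, mul_add]
  map_smul' r F := by
    ext b
    by_cases h : IsActive χ (orbitOf G b) <;> simp [h, mul_left_comm]

theorem lift_of_active (F : ActiveOrbit X χ → ℂ) {b : X} {B : ActiveOrbit X χ}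
    (hb : orbitOf G b = B.1) : lift χ rep F b = phase χ rep b * F B := by
  obtain ⟨B, hB⟩ := B
  subst hb
  change phase χ rep b * (if h : IsActive χ (orbitOf G b) then F ⟨_, h⟩ else 0) = _
  rw [dif_pos hB]

theorem lift_of_not_active (F : ActiveOrbit X χ → ℂ) {b : X} (hb : ¬ IsActive χ (orbitOf G b)) :
    lift χ rep F b = 0 := by
  change phase χ rep b * (if h : IsActive χ (orbitOf G b) then F ⟨_, h⟩ else 0) = _
  rw [dif_neg hb, mul_zero]

include hrep

theorem lift_rep (F : ActiveOrbit X χ → ℂ) (A : ActiveOrbit X χ) :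
    lift χ rep F (rep A.1) = F A := by
  rw [lift_of_active F (hrep A.1), phase_rep hrep A.2, one_mul]

theorem lift_mem_isotypic (F : ActiveOrbit X χ → ℂ) : lift χ rep F ∈ isotypic X χ := by
  rw [mem_isotypic_iff]
  intro g a
  by_cases h : IsActive χ (orbitOf G a)
  · rw [lift_of_active F (B := ⟨_, h⟩) rfl, lift_of_active F (B := ⟨_, h⟩) (orbitOf_smul g a),
      phase_smul hrep, mul_assoc]
  · rw [lift_of_not_active F h, lift_of_not_active F (by rwa [orbitOf_smul]), mul_zero]

/-- At a point of an inactive orbit, a stabilising element with `χ g ≠ 1` at some point of the orbit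
forces the function to vanish; on an active orbit equivariance propagates the value at the
representative. -/
theorem eq_lift_of_mem_isotypic {u : X → ℂ} (hu : u ∈ isotypic X χ) :
    u = lift χ rep (fun A => u (rep A.1)) := by
  rw [mem_isotypic_iff] at hu
  ext b
  by_cases h : IsActive χ (orbitOf G b)
  · obtain ⟨g, hg⟩ := exists_smul_rep hrep b
    rw [lift_of_active _ (B := ⟨_, h⟩) rfl, phase_of_active hrep h hg]
    conv_lhs => rw [← hg, hu]
  · rw [lift_of_not_active _ h]
    rw [isActive_iff] at h
    push Not at h
    obtain ⟨a, ha, g, hg, hχ⟩ := h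
    obtain ⟨k, rfl⟩ := orbitOf_eq_iff.1 ha.symm
    have h1 := hu g a
    rw [hg] at h1
    have h2 : (1 - (χ g : ℂ)) * u a = 0 := by linear_combination h1
    have h3 : u a = 0 := (mul_eq_zero.1 h2).resolve_left
      (sub_ne_zero.2 fun h => hχ (Units.ext h.symm))
    rw [hu, h3, mul_zero]

theorem finrank_isotypic : Module.finrank ℂ (isotypic X χ) = numActive X χ := by
  have hrange : LinearMap.range (lift χ rep) = isotypic X χ := by
    ext u
    constructor
    · rintro ⟨F, rfl⟩
      exact lift_mem_isotypic hrep F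
    · intro hu
      exact ⟨_, (eq_lift_of_mem_isotypic hrep hu).symm⟩
  have hinj : Function.Injective (lift χ rep) := by
    intro F F' h
    ext A
    rw [← lift_rep hrep F A, h, lift_rep hrep]
  have : Fintype (ActiveOrbit X χ) := Fintype.ofFinite _
  rw [← hrange, LinearMap.finrank_range_of_inj hinj, Module.finrank_fintype_fun_eq_card, numActive,
    Nat.card_eq_fintype_card]

omit hrep [Fintype X] in
theorem basisVec_apply (A : orbitRel.Quotient G X) (b : X) :
    basisVec χ rep A b = if orbitOf G b = A then phase χ rep b else 0 := rfl

theorem basisVec_mem_isotypic (A : orbitRel.Quotient G X) : basisVec χ rep A ∈ isotypic X χ := by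
  rw [mem_isotypic_iff]
  intro g a
  simp only [basisVec_apply, orbitOf_smul, phase_smul hrep]
  split_ifs <;> simp

/-- Both factors have the same equivariance and phases have modulus `1`, so the summand is constant
on the orbit. Matrix elements thereby become values at representatives. -/
theorem dotProduct_basisVec {w : X → ℂ} (hw : w ∈ isotypic X χ) (A : ActiveOrbit X χ) :
    star (basisVec χ rep A.1) ⬝ᵥ w =
      (Finset.univ.filter (fun b : X => orbitOf G b = A.1)).card * w (rep A.1) := by
  have hw' := eq_lift_of_mem_isotypic hrep hw
  simp only [dotProduct, Pi.star_apply, basisVec_apply]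
  rw [← nsmul_eq_mul, ← Finset.sum_const, Finset.sum_filter]
  refine Finset.sum_congr rfl fun b _ => ?_
  split_ifs with h
  · conv_lhs => rw [hw', lift_of_active _ h]
    have h1 := norm_phase (χ := χ) hrep (b := b) (by rw [h]; exact A.2)
    rw [← mul_assoc, Complex.star_def, ← Complex.normSq_eq_conj_mul_self,
      Complex.normSq_eq_norm_sq, h1]
    simp
  · simp

theorem restrictedEntry_eq (hinv : D.IsInvariant G) {ε : ℝ} (hε : 0 < ε) (A : ActiveOrbit X χ)
    (B : orbitRel.Quotient G X) : D.restrictedEntry χ rep ε A.1 B =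
      (D.genC ε).mulVec (basisVec χ rep B) (rep A.1) := by
  rw [restrictedEntry, ← Matrix.mulVecLin_apply, dotProduct_basisVec hrep (genC_mapsTo hinv χ hε _
    (basisVec_mem_isotypic hrep B)), dotProduct_basisVec hrep (basisVec_mem_isotypic hrep _),
    basisVec_apply, if_pos (hrep _), phase_rep hrep A.2, mul_one,
    mul_div_cancel_left₀]
  have : (Finset.univ.filter (fun b : X => orbitOf G b = A.1)).card ≠ 0 :=
    Finset.card_ne_zero.2 ⟨rep A.1, by simp [hrep]⟩
  exact_mod_cast this

omit hrep in
theorem lift_eq_sum [Fintype (ActiveOrbit X χ)] (F : ActiveOrbit X χ → ℂ) :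
    lift χ rep F = ∑ B : ActiveOrbit X χ, F B • basisVec χ rep B.1 := by
  ext b
  simp only [Finset.sum_apply, Pi.smul_apply, basisVec_apply, smul_eq_mul, mul_ite, mul_zero]
  by_cases h : IsActive χ (orbitOf G b)
  · rw [lift_of_active F (B := ⟨_, h⟩) rfl, Finset.sum_eq_single ⟨_, h⟩]
    · simp [mul_comm]
    · intro B _ hB
      rw [if_neg]
      rintro h'
      exact hB (Subtype.ext h'.symm)
    · simp
  · rw [lift_of_not_active F h, Finset.sum_eq_zero]
    intro B _
    rw [if_neg]
    rintro h'
    exact h (h' ▸ B.2)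

variable (D χ rep) in
/-- The restricted generator in the basis of the vectors `u_A`. -/
def restrictedMatrix (ε : ℝ) : Matrix (ActiveOrbit X χ) (ActiveOrbit X χ) ℂ :=
  fun A B => D.restrictedEntry χ rep ε A.1 B.1

theorem restrictedMatrix_mulVec [Fintype (ActiveOrbit X χ)] (hinv : D.IsInvariant G) {ε : ℝ}
    (hε : 0 < ε) (F : ActiveOrbit X χ → ℂ) (A : ActiveOrbit X χ) :
    (restrictedMatrix D χ rep ε).mulVec F A =
      (D.genC ε).mulVec (lift χ rep F) (rep A.1) := by
  rw [lift_eq_sum, Matrix.mulVec_sum, Finset.sum_apply]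
  simp only [Matrix.mulVec_smul, Pi.smul_apply, ← restrictedEntry_eq hrep hinv hε, smul_eq_mul]
  exact Finset.sum_congr rfl fun B _ => mul_comm _ _

theorem genC_lift [Fintype (ActiveOrbit X χ)] (hinv : D.IsInvariant G) {ε : ℝ}
    (hε : 0 < ε) (F : ActiveOrbit X χ → ℂ) :
    (D.genC ε).mulVec (lift χ rep F) = lift χ rep ((restrictedMatrix D χ rep ε).mulVec F) := by
  have h := eq_lift_of_mem_isotypic hrep (genC_mapsTo hinv χ hε _ (lift_mem_isotypic hrep F))
  rw [Matrix.mulVecLin_apply] at h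
  rw [h]
  congr 1
  ext A
  rw [restrictedMatrix_mulVec hrep hinv hε]

/-- An eigenvector of the restricted matrix is an eigenvector of the restricted generator. -/
theorem exists_eigenvector_restriction [Fintype (ActiveOrbit X χ)] (hinv : D.IsInvariant G) {ε : ℝ}
    (hε : 0 < ε) {F : ActiveOrbit X χ → ℂ} (hF : F ≠ 0) {μ : ℂ}
    (h : (restrictedMatrix D χ rep ε).mulVec F = μ • F) :
    ∃ x : isotypic X χ, x ≠ 0 ∧ restriction hinv χ hε x = μ • x := by
  refine ⟨⟨lift χ rep F, lift_mem_isotypic hrep F⟩, fun h0 => hF ?_, Subtype.ext ?_⟩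
  · ext A
    have h1 : lift χ rep F = 0 := congrArg Subtype.val h0
    rw [← lift_rep hrep F A, h1]
    rfl
  · change (D.genC ε).mulVec (lift χ rep F) = μ • lift χ rep F
    rw [genC_lift hrep hinv hε, h, map_smul]

omit hrep [Fintype G] [MulAction G X] [Group G] in
theorem genC_mulVec (ε : ℝ) (f : X → ℂ) (a : X) : (D.genC ε).mulVec f a =
    ∑ b ∈ Finset.univ.erase a, (D.rate ε a b : ℂ) * (f b - f a) := by
  rw [Matrix.mulVec, dotProduct, ← Finset.add_sum_erase _ _ (Finset.mem_univ a)]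
  have h1 : ∀ b ∈ Finset.univ.erase a, D.genC ε a b * f b = (D.rate ε a b : ℂ) * f b := by
    intro b hb
    rw [genC, Matrix.map_apply, gen, if_neg (Finset.ne_of_mem_erase hb).symm]
  have h2 : D.genC ε a a = -∑ b ∈ Finset.univ.erase a, (D.rate ε a b : ℂ) := by
    rw [genC, Matrix.map_apply, gen, if_pos rfl]
    push_cast
    rfl
  rw [Finset.sum_congr rfl h1, h2, neg_mul, Finset.sum_mul, ← Finset.sum_neg_distrib,
    ← Finset.sum_add_distrib]
  exact Finset.sum_congr rfl fun b _ => by ring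

theorem restrictedEntry_of_ne (hinv : D.IsInvariant G) {ε : ℝ} (hε : 0 < ε)
    {A B : ActiveOrbit X χ} (hAB : A ≠ B) : D.restrictedEntry χ rep ε A.1 B.1 =
      ∑ b ∈ Finset.univ.filter (fun b : X => orbitOf G b = B.1),
        (D.rate ε (rep A.1) b : ℂ) * phase χ rep b := by
  rw [restrictedEntry_eq hrep hinv hε, genC_mulVec]
  have h0 : basisVec χ rep B.1 (rep A.1) = 0 := by
    rw [basisVec_apply, if_neg]
    rw [hrep]
    exact fun h => hAB (Subtype.ext h)
  simp only [h0, sub_zero, basisVec_apply, mul_ite, mul_zero]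
  rw [← Finset.sum_filter]
  refine Finset.sum_congr ?_ fun _ _ => rfl
  ext b
  simp only [Finset.mem_filter, Finset.mem_erase, Finset.mem_univ, and_true, true_and,
    and_iff_right_iff_imp]
  rintro hb rfl
  rw [hrep] at hb
  exact hAB (Subtype.ext hb)

/-- The row sum is the generator applied to the lift of the constant `1`, which is the phase
function. -/
theorem neg_finsum_restrictedEntry (hinv : D.IsInvariant G) {ε : ℝ} (hε : 0 < ε)
    (A : ActiveOrbit X χ) : -∑ᶠ B : ActiveOrbit X χ, D.restrictedEntry χ rep ε A.1 B.1 =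
      ∑ b ∈ Finset.univ.erase (rep A.1),
        (D.rate ε (rep A.1) b : ℂ) * (1 - phase χ rep b) := by
  have : Fintype (ActiveOrbit X χ) := Fintype.ofFinite _
  have h1 : ∑ᶠ B : ActiveOrbit X χ, D.restrictedEntry χ rep ε A.1 B.1 =
      (restrictedMatrix D χ rep ε).mulVec (fun _ => 1) A := by
    rw [finsum_eq_sum_of_fintype, Matrix.mulVec, dotProduct]
    simp [restrictedMatrix]
  rw [h1, restrictedMatrix_mulVec hrep hinv hε, genC_mulVec, ← Finset.sum_neg_distrib]
  refine Finset.sum_congr rfl fun b _ => ?_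
  have h2 : lift χ rep (fun _ => 1) b = phase χ rep b := by
    by_cases h : IsActive χ (orbitOf G b)
    · rw [lift_of_active _ (B := ⟨_, h⟩) rfl, mul_one]
    · rw [lift_of_not_active _ h, phase_of_not_active h]
  rw [h2, lift_rep hrep]
  ring

/-- The restricted matrix is self-adjoint for the weights of the augmented process. -/
theorem restrictedMatrix_symm (hD : D.IsReversible) (hinv : D.IsInvariant G) {ε : ℝ} (hε : 0 < ε)
    (A B : ActiveOrbit X χ) :
    (((D.augmented χ rep).m (some A) * Real.exp (-(D.augmented χ rep).V (some A) / ε) : ℝ) : ℂ) *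
        restrictedMatrix D χ rep ε A B =
      star ((((D.augmented χ rep).m (some B) *
        Real.exp (-(D.augmented χ rep).V (some B) / ε) : ℝ) : ℂ) *
        restrictedMatrix D χ rep ε B A) := by
  set K : X → X → ℝ := fun a b => D.m a * Real.exp (-D.V a / ε) * D.gen ε a b with hK
  have hKsymm : ∀ a b, K a b = K b a := by
    intro a b
    by_cases hab : a = b
    · rw [hab]
    · simp only [hK, gen, if_neg hab, if_neg (Ne.symm hab)]
      rw [weight_mul_rate (hD.m_pos a).ne', weight_mul_rate (hD.m_pos b).ne', saddle_comm hD hab,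
        hD.c_symm]
  have hKinv : ∀ (g : G) a b, K (g • a) (g • b) = K a b := by
    intro g a b
    simp only [hK]
    rw [m_smul hD hinv, V_smul hD hinv, gen_smul hinv hε]
  have hentry : ∀ A B : ActiveOrbit X χ,
      (((D.augmented χ rep).m (some A) * Real.exp (-(D.augmented χ rep).V (some A) / ε) : ℝ) : ℂ) *
        restrictedMatrix D χ rep ε A B = (Nat.card (stabilizer G (rep A.1)) : ℂ)⁻¹ *
        ∑ b ∈ Finset.univ.filter (fun b : X => orbitOf G b = B.1),
          (K (rep A.1) b : ℂ) * phase χ rep b := by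
    intro A B
    rw [restrictedMatrix, restrictedEntry_eq hrep hinv hε, Matrix.mulVec, dotProduct,
      Finset.sum_filter]
    simp only [augmented, Finset.mul_sum, basisVec_apply, genC, Matrix.map_apply, hK]
    refine Finset.sum_congr rfl fun b _ => ?_
    split_ifs
    · push_cast; ring
    · simp
  rw [hentry, hentry, star_mul', star_inv₀, star_natCast, star_sum]
  -- The factor `conj (phase a) * phase b` makes the summand invariant under the group; it reduces
  -- to a single phase when one of the points is a representative.
  have h1 := orbit_sum_swap (R := ℂ) hrep A.1 B.1
    (w := fun a b => (K a b : ℂ) * (starRingEnd ℂ (phase χ rep a) * phase χ rep b)) (by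
      intro g a b
      simp only [hKinv, phase_smul hrep, map_mul, conj_character]
      congr 1
      rw [mul_mul_mul_comm, map_inv, Units.inv_mul, one_mul])
  simp only [phase_rep hrep A.2, phase_rep hrep B.2, map_one, one_mul, mul_one] at h1
  rw [h1]
  congr 1
  refine Finset.sum_congr rfl fun a _ => ?_
  rw [star_mul', hKsymm (rep B.1) a]
  simp

end Lift

end JumpData

/-! ### The augmented process as leading part of the augmented matrix. -/

namespace JumpData

open MulAction Relation
open scoped Classical

/-- A sum of exponentials is equivalent to the part with the smallest exponent. -/
theorem leading_part_asymptotics {κ : Type*} (s : Finset κ) (z : κ → ℂ) (h : κ → ℝ≥0∞) (h₀ : ℝ≥0∞)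
    (θ : ℝ≥0) (hle : ∀ b ∈ s, h b = h₀ ∨ h₀ + θ ≤ h b)
    (hne : h₀ ≠ ⊤ → ∑ b ∈ s.filter (fun b => h b = h₀), z b ≠ 0) :
    ∃ C : ℝ, 0 ≤ C ∧ ∀ ε : ℝ, 0 < ε →
      |‖∑ b ∈ s, z b * (arrhenius (h b) ε : ℂ)‖ -
        ‖∑ b ∈ s.filter (fun b => h b = h₀), z b‖ * arrhenius h₀ ε| ≤
      C * Real.exp (-θ / ε) * (‖∑ b ∈ s.filter (fun b => h b = h₀), z b‖ * arrhenius h₀ ε) := by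
  by_cases ht : h₀ = ⊤
  · refine ⟨0, le_rfl, fun ε _ => ?_⟩
    have h1 : ∀ b ∈ s, z b * (arrhenius (h b) ε : ℂ) = 0 := by
      intro b hb
      have h2 : h b = ⊤ := by
        rcases hle b hb with h2 | h2
        · rw [h2, ht]
        · rw [ht, top_add, top_le_iff] at h2
          exact h2
      rw [h2, arrhenius_top]
      simp
    rw [Finset.sum_eq_zero h1, ht, arrhenius_top]
    simp
  · set Z := ∑ b ∈ s.filter (fun b => h b = h₀), z b with hZ
    have hZpos : 0 < ‖Z‖ := norm_pos_iff.2 (hne ht)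
    refine ⟨(∑ b ∈ s, ‖z b‖) / ‖Z‖, by positivity, fun ε hε => ?_⟩
    have hlead : ∑ b ∈ s.filter (fun b => h b = h₀), z b * (arrhenius (h b) ε : ℂ) =
        Z * (arrhenius h₀ ε : ℂ) := by
      rw [hZ, Finset.sum_mul]
      refine Finset.sum_congr rfl fun b hb => ?_
      rw [(Finset.mem_filter.1 hb).2]
    have hnorm : ‖Z * (arrhenius h₀ ε : ℂ)‖ = ‖Z‖ * arrhenius h₀ ε := by
      rw [norm_mul, Complex.norm_real, Real.norm_eq_abs, abs_of_nonneg (arrhenius_nonneg _ _)]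
    rw [← Finset.sum_filter_add_sum_filter_not s (fun b => h b = h₀), hlead, ← hnorm]
    refine (abs_norm_sub_norm_le _ _).trans ?_
    rw [add_sub_cancel_left, hnorm]
    calc ‖∑ b ∈ s.filter (fun b => ¬ h b = h₀), z b * (arrhenius (h b) ε : ℂ)‖
        ≤ ∑ b ∈ s.filter (fun b => ¬ h b = h₀), ‖z b‖ * arrhenius (h₀ + θ) ε := by
          refine (norm_sum_le _ _).trans (Finset.sum_le_sum fun b hb => ?_)
          rw [Finset.mem_filter] at hb
          rw [norm_mul, Complex.norm_real, Real.norm_eq_abs, abs_of_nonneg (arrhenius_nonneg _ _)]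
          gcongr
          exact arrhenius_anti ((hle b hb.1).resolve_left hb.2) hε
      _ ≤ ∑ b ∈ s, ‖z b‖ * arrhenius (h₀ + θ) ε :=
          Finset.sum_le_sum_of_subset_of_nonneg (Finset.filter_subset _ _) fun b _ _ =>
            mul_nonneg (norm_nonneg _) (arrhenius_nonneg _ _)
      _ = _ := by
          rw [← Finset.sum_mul, arrhenius_add, arrhenius_coe]
          field_simp

variable {X G : Type*} [Fintype X] [Group G] [Fintype G] [MulAction G X] {D : JumpData X}
  (hD : D.IsReversible) (hinv : D.IsInvariant G)
  {χ : G →* ℂˣ} {rep : orbitRel.Quotient G X → X} (hrep : ∀ A, orbitOf G (rep A) = A)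

omit [Fintype X] [Fintype G] in
theorem orbitExponent_le {a b : X} : D.orbitExponent (orbitOf G a) (orbitOf G b) ≤ D.h a b :=
  iInf_le_of_le a (iInf_le_of_le b (iInf_le_of_le rfl (iInf_le_of_le rfl le_rfl)))

omit [Fintype X] in
theorem killExponent_le {A : orbitRel.Quotient G X} {b : X} (hb : b ≠ rep A)
    (hφ : phase χ rep b ≠ 1) : D.killExponent χ rep A ≤ D.h (rep A) b :=
  iInf_le_of_le b (iInf_le_of_le hb (iInf_le_of_le hφ le_rfl))

theorem exists_killExponent_eq {A : orbitRel.Quotient G X} (hA : D.killExponent χ rep A ≠ ⊤) :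
    ∃ b, b ≠ rep A ∧ phase χ rep b ≠ 1 ∧ D.h (rep A) b = D.killExponent χ rep A := by
  have hne : (Finset.univ.filter (fun b : X => b ≠ rep A ∧ phase χ rep b ≠ 1)).Nonempty := by
    by_contra hne
    apply hA
    rw [Finset.not_nonempty_iff_eq_empty, Finset.filter_eq_empty_iff] at hne
    rw [killExponent, iInf_eq_top]
    intro b
    rw [iInf_eq_top]
    intro hb
    rw [iInf_eq_top]
    intro hφ
    exact absurd ⟨hb, hφ⟩ (hne (Finset.mem_univ b))
  obtain ⟨b, hb, hmin⟩ := Finset.exists_min_image _ (fun b => D.h (rep A) b) hne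
  rw [Finset.mem_filter] at hb
  refine ⟨b, hb.2.1, hb.2.2, le_antisymm ?_ (killExponent_le hb.2.1 hb.2.2)⟩
  exact le_iInf fun b' => le_iInf fun h1 => le_iInf fun h2 =>
    hmin b' (Finset.mem_filter.2 ⟨Finset.mem_univ _, h1, h2⟩)

include hrep

omit hrep [Fintype X] [Fintype G] in
theorem ne_of_orbit_ne {A B : orbitRel.Quotient G X} (hAB : A ≠ B) {a b : X}
    (ha : orbitOf G a = A) (hb : orbitOf G b = B) : a ≠ b := by
  rintro rfl
  exact hAB (ha.symm.trans hb)

include hD hinv in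
omit [Fintype G] in
-- By invariance of `h`, a minimising transition can be moved so that it starts at the
-- representative.
theorem exists_orbitExponent_eq {A B : orbitRel.Quotient G X} (hAB : A ≠ B) :
    ∃ b, orbitOf G b = B ∧ D.h (rep A) b = D.orbitExponent A B := by
  obtain ⟨b, hb, hmin⟩ := Finset.exists_min_image
    (Finset.univ.filter (fun b : X => orbitOf G b = B)) (fun b => D.h (rep A) b)
    ⟨rep B, by simp [hrep]⟩
  simp only [Finset.mem_filter, Finset.mem_univ, true_and] at hb hmin
  refine ⟨b, hb, le_antisymm ?_ ?_⟩
  · refine le_iInf fun a => le_iInf fun b' => le_iInf fun ha => le_iInf fun hb' => ?_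
    obtain ⟨g, hg⟩ := exists_smul_rep hrep a
    rw [ha] at hg
    have h1 : orbitOf G (g⁻¹ • b') = B := by rw [orbitOf_smul, hb']
    have h2 := h_smul hD hinv g (ne_of_orbit_ne hAB (hrep A) h1)
    rw [smul_inv_smul, hg] at h2
    rw [h2]
    exact hmin _ h1
  · have := orbitExponent_le (G := G) (D := D) (a := rep A) (b := b)
    rwa [hrep, hb] at this

include hD hinv in
omit [Fintype G] in
-- The best transition from `B` to `A`, reversed, has the same saddle height and is a candidate for
-- `A`. Exchanging the orbits gives equality.
theorem orbit_saddle_le [Finite G] {A B : orbitRel.Quotient G X} (hAB : A ≠ B) :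
    (D.V (rep A) : ℝ≥0∞) + D.orbitExponent A B ≤ D.V (rep B) + D.orbitExponent B A := by
  obtain ⟨a, ha, hBa⟩ := exists_orbitExponent_eq hD hinv hrep hAB.symm
  have hne := ne_of_orbit_ne hAB ha (hrep B)
  rw [← hBa]
  change _ ≤ D.saddle (rep B) a
  rw [saddle_comm hD hne.symm, saddle]
  obtain ⟨g, hg⟩ := exists_smul_rep hrep a
  rw [ha] at hg
  have h1 : D.V a = D.V (rep A) := by rw [← hg, V_smul hD hinv]
  have h2 := orbitExponent_le (G := G) (D := D) (a := a) (b := rep B)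
  rw [ha, hrep] at h2
  rw [h1]
  gcongr

include hD hinv in
theorem augmented_saddle_comm (x y : Option (ActiveOrbit X χ)) (hx : x ≠ none) (hy : y ≠ none)
    (hxy : x ≠ y) : (D.augmented χ rep).saddle x y = (D.augmented χ rep).saddle y x := by
  obtain ⟨A, rfl⟩ := Option.ne_none_iff_exists'.1 hx
  obtain ⟨B, rfl⟩ := Option.ne_none_iff_exists'.1 hy
  have hAB : A.1 ≠ B.1 := fun h => hxy (congrArg some (Subtype.ext h))
  exact le_antisymm (orbit_saddle_le hD hinv hrep hAB) (orbit_saddle_le hD hinv hrep hAB.symm)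

theorem killCoeff_pos (hD : D.IsReversible) {A : orbitRel.Quotient G X}
    (hA : D.killExponent χ rep A ≠ ⊤) :
    0 < D.killCoeff χ rep A := by
  obtain ⟨b, hb, hφ, hh⟩ := exists_killExponent_eq hA
  refine mul_pos (inv_pos.2 (by exact_mod_cast Nat.card_pos)) (norm_pos_iff.2 fun h0 => ?_)
  have h1 := congrArg Complex.re h0
  rw [Complex.re_sum, Complex.zero_re] at h1
  refine absurd h1 (Finset.sum_pos (fun b hb => ?_) ⟨b, by simp [hb, hφ, hh]⟩).ne'
  simp only [Finset.mem_filter, Finset.mem_univ, true_and] at hb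
  rw [Complex.re_mul_ofReal]
  exact mul_pos (one_sub_phase_re_pos hrep hb.2.1) (hD.c_pos _ _ hb.1.symm)

include hD hinv in
theorem orbitCoeff_pos {A B : orbitRel.Quotient G X} (hAB : A ≠ B) :
    0 < D.orbitCoeff rep A B := by
  obtain ⟨b, hb, hh⟩ := exists_orbitExponent_eq hD hinv hrep hAB
  refine mul_pos (inv_pos.2 (by exact_mod_cast Nat.card_pos))
    (Finset.sum_pos (fun b hb => ?_) ⟨b, by simp [hb, hh]⟩)
  simp only [Finset.mem_filter, Finset.mem_univ, true_and] at hb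
  exact hD.c_pos _ _ (ne_of_orbit_ne hAB (hrep A) hb.1)

include hD in
omit hrep in
theorem augmented_m_pos (x : Option (ActiveOrbit X χ)) : 0 < (D.augmented χ rep).m x := by
  rcases x with _ | A
  · exact one_pos
  · exact div_pos (hD.m_pos _) (by exact_mod_cast Nat.card_pos)

include hD hinv hrep in
theorem augmented_rate_nonneg (ε : ℝ) {x y : Option (ActiveOrbit X χ)} (hxy : x ≠ y) :
    0 ≤ (D.augmented χ rep).rate ε x y := by
  rw [rate]
  refine mul_nonneg (div_nonneg ?_ (augmented_m_pos hD _).le) (arrhenius_nonneg _ _)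
  have hk : ∀ A, 0 ≤ D.killCoeff χ rep A := fun A =>
    mul_nonneg (inv_nonneg.2 (Nat.cast_nonneg _)) (norm_nonneg _)
  rcases x with _ | A <;> rcases y with _ | B
  · exact le_rfl
  · exact hk _
  · exact hk _
  · exact (orbitCoeff_pos hD hinv hrep fun h => hxy (congrArg some (Subtype.ext h))).le

/-- The leading transitions between two different active orbits have the same phase. -/
theorem phase_eq_of_leading (hnd : D.IsNondegenerate G) {A B : ActiveOrbit X χ} (hAB : A ≠ B)
    {b b' : X} (hb : orbitOf G b = B.1) (hb' : orbitOf G b' = B.1)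
    (ht : D.h (rep A.1) b ≠ ⊤) (hh : D.h (rep A.1) b = D.h (rep A.1) b') :
    phase χ rep b' = phase χ rep b := by
  have hAB' : A.1 ≠ B.1 := fun h => hAB (Subtype.ext h)
  have hne := ne_of_orbit_ne hAB' (hrep A.1) hb
  have hne' := ne_of_orbit_ne hAB' (hrep A.1) hb'
  obtain ⟨g, hg⟩ := hnd _ _ _ _ hne hne' ht hh
  rcases Sym2.eq_iff.1 hg with ⟨h1, h2⟩ | ⟨h1, h2⟩
  · rw [← h2, phase_smul hrep, isActive_iff.1 A.2 _ (hrep _) g h1, Units.val_one, one_mul]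
  -- A group element reversing the pair would map `A` to `B`.
  · exfalso
    apply hAB'
    rw [← hrep A.1, ← orbitOf_smul g, h1, hb']

/-- The augmented process is the leading-order part of the augmented matrix. -/
theorem augmentedMatrix_asymptotics (hD : D.IsReversible) (hinv : D.IsInvariant G)
    (hnd : D.IsNondegenerate G) {θ : ℝ≥0} (hgap : D.IsGap χ rep θ) :
    ∃ C : ℝ, 0 ≤ C ∧ ∀ ε : ℝ, 0 < ε → ∀ x y, x ≠ y →
      |‖D.augmentedMatrix χ rep ε x y‖ - (D.augmented χ rep).rate ε x y| ≤
        C * Real.exp (-θ / ε) * (D.augmented χ rep).rate ε x y := by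
  have hcard : ∀ A : orbitRel.Quotient G X, (Nat.card (stabilizer G (rep A)) : ℝ) ≠ 0 :=
    fun A => by exact_mod_cast Nat.card_pos.ne'
  have hpair : ∀ x y : Option (ActiveOrbit X χ), ∃ C : ℝ, 0 ≤ C ∧ (x ≠ y → ∀ ε : ℝ, 0 < ε →
      |‖D.augmentedMatrix χ rep ε x y‖ - (D.augmented χ rep).rate ε x y| ≤
        C * Real.exp (-θ / ε) * (D.augmented χ rep).rate ε x y) := by
    rintro (_ | A) y
    · refine ⟨0, le_rfl, fun _ ε _ => ?_⟩
      have h1 : (D.augmented χ rep).rate ε none y = 0 := by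
        rw [rate, show (D.augmented χ rep).h none y = ⊤ from rfl, arrhenius_top, mul_zero]
      rw [h1]
      simp [augmentedMatrix]
    · rcases y with _ | B
      · have hm := hD.m_pos (rep A.1)
        have hZ : ∑ b ∈ ((Finset.univ.erase (rep A.1)).filter
            (fun b => phase χ rep b ≠ 1)).filter
              (fun b => D.h (rep A.1) b = D.killExponent χ rep A.1),
            (D.c (rep A.1) b / D.m (rep A.1) : ℂ) * (1 - phase χ rep b) =
            (D.m (rep A.1) : ℂ)⁻¹ * ∑ b ∈ Finset.univ.filter
              (fun b : X => b ≠ rep A.1 ∧ phase χ rep b ≠ 1 ∧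
                D.h (rep A.1) b = D.killExponent χ rep A.1),
              (1 - phase χ rep b) * (D.c (rep A.1) b : ℂ) := by
          rw [Finset.mul_sum]
          refine Finset.sum_congr ?_ fun b _ => by ring
          ext b
          simp [and_assoc]
        have hZnorm : ‖∑ b ∈ ((Finset.univ.erase (rep A.1)).filter
            (fun b => phase χ rep b ≠ 1)).filter
              (fun b => D.h (rep A.1) b = D.killExponent χ rep A.1),
            (D.c (rep A.1) b / D.m (rep A.1) : ℂ) * (1 - phase χ rep b)‖ =
            (D.augmented χ rep).c (some A) none / (D.augmented χ rep).m (some A) := by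
          rw [hZ, norm_mul, norm_inv, Complex.norm_real, Real.norm_eq_abs, abs_of_pos hm]
          simp only [augmented, killCoeff]
          have := hcard A.1
          field_simp
        obtain ⟨C, hC, hb⟩ := leading_part_asymptotics
          ((Finset.univ.erase (rep A.1)).filter (fun b => phase χ rep b ≠ 1))
          (fun b => (D.c (rep A.1) b / D.m (rep A.1) : ℂ) * (1 - phase χ rep b))
          (fun b => D.h (rep A.1) b) (D.killExponent χ rep A.1) θ
          (fun b hb => by
            simp only [Finset.mem_filter, Finset.mem_erase, Finset.mem_univ, and_true] at hb
            rcases (killExponent_le (D := D) hb.1 hb.2).eq_or_lt with h | h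
            · exact Or.inl h.symm
            · exact Or.inr (hgap.kill A b hb.1 hb.2 h))
          (fun ht => by
            rw [← norm_pos_iff, hZnorm]
            exact div_pos (killCoeff_pos hrep hD ht) (augmented_m_pos hD _))
        refine ⟨C, hC, fun _ ε hε => ?_⟩
        have h1 := hb ε hε
        have hr : (D.augmented χ rep).rate ε (some A) none =
          (D.augmented χ rep).c (some A) none / (D.augmented χ rep).m (some A) *
            arrhenius (D.killExponent χ rep A.1) ε := rfl
        rw [hZnorm, ← hr] at h1
        convert h1 using 3
        congr 1
        change -∑ᶠ B : ActiveOrbit X χ, D.restrictedEntry χ rep ε A.1 B.1 = _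
        rw [neg_finsum_restrictedEntry hrep hinv hε, Finset.sum_filter]
        refine Finset.sum_congr rfl fun b _ => ?_
        by_cases hφ : phase χ rep b = 1
        · simp [hφ]
        · simp only [ne_eq, hφ, not_false_eq_true, if_true, rate]
          push_cast
          ring
      · by_cases hAB : A = B
        · exact ⟨0, le_rfl, fun h => absurd (congrArg some hAB) h⟩
        have hAB' : A.1 ≠ B.1 := fun h => hAB (Subtype.ext h)
        have hm := hD.m_pos (rep A.1)
        obtain ⟨b₀, hb₀, hh₀⟩ := exists_orbitExponent_eq hD hinv hrep hAB'
        -- Nondegeneracy gives all leading terms the phase of `b₀`, so the modulus of the sum is the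
        -- sum of the positive coefficients.
        have hZnorm : D.orbitExponent A.1 B.1 ≠ ⊤ →
            ‖∑ b ∈ (Finset.univ.filter (fun b : X => orbitOf G b = B.1)).filter
              (fun b => D.h (rep A.1) b = D.orbitExponent A.1 B.1),
            (D.c (rep A.1) b / D.m (rep A.1) : ℂ) * phase χ rep b‖ =
            (D.augmented χ rep).c (some A) (some B) / (D.augmented χ rep).m (some A) := by
          intro ht
          have h1 : ∀ b ∈ (Finset.univ.filter (fun b : X => orbitOf G b = B.1)).filter
              (fun b => D.h (rep A.1) b = D.orbitExponent A.1 B.1),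
              (D.c (rep A.1) b / D.m (rep A.1) : ℂ) * phase χ rep b =
              ((D.c (rep A.1) b / D.m (rep A.1) : ℝ) : ℂ) * phase χ rep b₀ := by
            intro b hb
            simp only [Finset.mem_filter, Finset.mem_univ, true_and] at hb
            rw [phase_eq_of_leading hrep hnd hAB hb₀ hb.1 (by rwa [hh₀]) (by rw [hh₀, hb.2])]
            push_cast
            rfl
          rw [Finset.sum_congr rfl h1, ← Finset.sum_mul, norm_mul,
            norm_phase hrep (by rw [hb₀]; exact B.2), mul_one, ← Complex.ofReal_sum,
            Complex.norm_real, Real.norm_eq_abs, abs_of_nonneg, Finset.filter_filter]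
          · simp only [augmented, orbitCoeff]
            rw [← Finset.sum_div]
            have := hcard A.1
            field_simp
          · refine Finset.sum_nonneg fun b hb => ?_
            simp only [Finset.mem_filter, Finset.mem_univ, true_and] at hb
            exact (div_pos (hD.c_pos _ _ (ne_of_orbit_ne hAB' (hrep A.1) hb.1)) hm).le
        obtain ⟨C, hC, hb⟩ := leading_part_asymptotics
          (Finset.univ.filter (fun b : X => orbitOf G b = B.1))
          (fun b => (D.c (rep A.1) b / D.m (rep A.1) : ℂ) * phase χ rep b)
          (fun b => D.h (rep A.1) b) (D.orbitExponent A.1 B.1) θ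
          (fun b hb => by
            simp only [Finset.mem_filter, Finset.mem_univ, true_and] at hb
            have h2 := orbitExponent_le (G := G) (D := D) (a := rep A.1) (b := b)
            rw [hrep, hb] at h2
            rcases h2.eq_or_lt with h | h
            · exact Or.inl h.symm
            · exact Or.inr (hgap.orbit A B hAB _ b (hrep _) hb h))
          (fun ht => by
            rw [← norm_pos_iff, hZnorm ht]
            exact div_pos (orbitCoeff_pos hD hinv hrep hAB') (augmented_m_pos hD _))
        refine ⟨C, hC, fun _ ε hε => ?_⟩
        have h1 := hb ε hε
        have h2 : ‖∑ b ∈ (Finset.univ.filter (fun b : X => orbitOf G b = B.1)).filter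
              (fun b => D.h (rep A.1) b = D.orbitExponent A.1 B.1),
            (D.c (rep A.1) b / D.m (rep A.1) : ℂ) * phase χ rep b‖ *
              arrhenius (D.orbitExponent A.1 B.1) ε =
            (D.augmented χ rep).rate ε (some A) (some B) := by
          by_cases ht : D.orbitExponent A.1 B.1 = ⊤
          · rw [rate, show (D.augmented χ rep).h (some A) (some B) = ⊤ from ht, ht, arrhenius_top]
            simp
          · rw [hZnorm ht]
            rfl
        rw [h2] at h1
        convert h1 using 3
        congr 1
        change D.restrictedEntry χ rep ε A.1 B.1 = _
        rw [restrictedEntry_of_ne hrep hinv hε hAB]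
        refine Finset.sum_congr rfl fun b _ => ?_
        rw [rate]
        push_cast
        ring
  have : Fintype (ActiveOrbit X χ) := Fintype.ofFinite _
  choose C hC hb using hpair
  refine ⟨∑ x, ∑ y, C x y, Finset.sum_nonneg fun x _ => Finset.sum_nonneg fun y _ => hC x y,
    fun ε hε x y hxy => (hb x y hxy ε hε).trans ?_⟩
  have h1 : C x y ≤ ∑ x, ∑ y, C x y :=
    (Finset.single_le_sum (f := fun y => C x y) (fun y _ => hC x y) (Finset.mem_univ y)).trans
      (Finset.single_le_sum (f := fun x => ∑ y, C x y)
        (fun x _ => Finset.sum_nonneg fun y _ => hC x y) (Finset.mem_univ x))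
  have h2 := augmented_rate_nonneg hD hinv hrep ε hxy
  gcongr

end JumpData

/-! ### The Dirichlet form of the restricted generator. -/

namespace JumpData

open MulAction Relation
open scoped Classical

variable {X G : Type*} [Fintype X] [Group G] [Fintype G] [MulAction G X] {D : JumpData X}
  (hD : D.IsReversible) (hinv : D.IsInvariant G)
  {χ : G →* ℂˣ} {rep : orbitRel.Quotient G X → X} (hrep : ∀ A, orbitOf G (rep A) = A)

variable (D) in
/-- The conductance between `a` and `b`. -/
def conductance (ε : ℝ) (a b : X) : ℝ := D.c a b * arrhenius (D.saddle a b) ε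

include hD hinv in
omit [Fintype G] in
theorem conductance_smul [Finite G] (ε : ℝ) (g : G) {a b : X} (hab : a ≠ b) :
    D.conductance ε (g • a) (g • b) = D.conductance ε a b := by
  rw [conductance, conductance, saddle_smul hD hinv g hab]
  by_cases ht : D.saddle a b = ⊤
  · rw [ht, arrhenius_top, mul_zero, mul_zero]
  · rw [c_smul hD hinv g hab (saddle_ne_top_iff.1 ht)]

include hD in
omit [Fintype X] in
theorem conductance_comm (ε : ℝ) {a b : X} (hab : a ≠ b) :
    D.conductance ε a b = D.conductance ε b a := by
  rw [conductance, conductance, saddle_comm hD hab, hD.c_symm]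

include hD in
omit [Fintype X] in
theorem conductance_nonneg (ε : ℝ) {a b : X} (hab : a ≠ b) : 0 ≤ D.conductance ε a b :=
  mul_nonneg (hD.c_pos _ _ hab).le (arrhenius_nonneg _ _)

variable (D rep) in
/-- The conductance between the orbit `A` and the point `b`, counted per element of the group. -/
def orbitWeight (ε : ℝ) (A : orbitRel.Quotient G X) (b : X) : ℝ :=
  (Nat.card (stabilizer G (rep A)) : ℝ)⁻¹ * D.conductance ε (rep A) b

include hD in
omit [Fintype X] [Fintype G] in
theorem orbitWeight_nonneg (ε : ℝ) {A : orbitRel.Quotient G X} {b : X} (hb : b ≠ rep A) :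
    0 ≤ D.orbitWeight rep ε A b :=
  mul_nonneg (inv_nonneg.2 (Nat.cast_nonneg _)) (conductance_nonneg hD ε hb.symm)

include hD in
theorem augmented_weight_mul_rate (ε : ℝ) (A : ActiveOrbit X χ) (b : X) :
    (D.augmented χ rep).m (some A) * Real.exp (-(D.augmented χ rep).V (some A) / ε) *
      D.rate ε (rep A.1) b = D.orbitWeight rep ε A.1 b := by
  rw [orbitWeight, conductance, ← weight_mul_rate (hD.m_pos _).ne']
  simp only [augmented]
  ring

variable (χ rep) in
/-- The energy of `F` carried by the transition from the orbit `A` to the point `b`. -/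
def pairEnergy (F : ActiveOrbit X χ → ℂ) (A : ActiveOrbit X χ) (b : X) : ℝ :=
  if IsActive χ (orbitOf G b) ∧ orbitOf G b ≠ A.1 then ‖F A - lift χ rep F b‖ ^ 2 / 2
  else (1 - phase χ rep b).re * ‖F A‖ ^ 2

include hrep in
theorem pairEnergy_nonneg (F : ActiveOrbit X χ → ℂ) (A : ActiveOrbit X χ) (b : X) :
    0 ≤ pairEnergy χ rep F A b := by
  unfold pairEnergy
  split_ifs
  · positivity
  · exact mul_nonneg (one_sub_phase_re_nonneg hrep b) (sq_nonneg _)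

include hrep in
-- Between different active orbits this is polarisation, and the difference of squares is the part
-- that cancels by detailed balance. Inside the orbit, and on inactive orbits, the lift at `b` is
-- the phase times `F A` and the identity is direct.
theorem re_star_mul_sub_lift (F : ActiveOrbit X χ → ℂ) (A : ActiveOrbit X χ) (b : X) :
    (star (F A) * (F A - lift χ rep F b)).re = pairEnergy χ rep F A b +
      if h : IsActive χ (orbitOf G b) then (‖F A‖ ^ 2 - ‖F ⟨_, h⟩‖ ^ 2) / 2 else 0 := by
  have key : ∀ x y : ℂ, (star x * (x - y)).re = ‖x - y‖ ^ 2 / 2 + (‖x‖ ^ 2 - ‖y‖ ^ 2) / 2 := by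
    intro x y
    simp only [← Complex.normSq_eq_norm_sq, Complex.normSq_apply, Complex.mul_re, Complex.star_def,
      Complex.conj_re, Complex.conj_im, Complex.sub_re, Complex.sub_im]
    ring
  have key2 : ∀ x z : ℂ, (star x * (x - z * x)).re = (1 - z).re * ‖x‖ ^ 2 := by
    intro x z
    simp only [← Complex.normSq_eq_norm_sq, Complex.normSq_apply, Complex.mul_re, Complex.star_def,
      Complex.conj_re, Complex.conj_im, Complex.sub_re, Complex.sub_im, Complex.mul_im,
      Complex.one_re]
    ring
  unfold pairEnergy
  by_cases hb : IsActive χ (orbitOf G b)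
  · rw [dif_pos hb]
    have hl : lift χ rep F b = phase χ rep b * F ⟨_, hb⟩ := lift_of_active F rfl
    by_cases hA : orbitOf G b = A.1
    · rw [if_neg (by simp [hA])]
      obtain rfl : (⟨_, hb⟩ : ActiveOrbit X χ) = A := Subtype.ext hA
      rw [hl, key2]
      simp
    · rw [if_pos ⟨hb, hA⟩, key, hl, norm_mul, norm_phase hrep hb, one_mul]
  · rw [dif_neg hb, if_neg (by simp [hb]), lift_of_not_active F hb, phase_of_not_active hb, add_zero,
      ← key2, zero_mul]

include hD hinv hrep in
theorem sum_orbitWeight_symm (ε : ℝ) {A B : orbitRel.Quotient G X} (hAB : A ≠ B) :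
    ∑ b ∈ Finset.univ.filter (fun b : X => orbitOf G b = B), D.orbitWeight rep ε A b =
      ∑ a ∈ Finset.univ.filter (fun a : X => orbitOf G a = A), D.orbitWeight rep ε B a := by
  have h := orbit_sum_swap (R := ℝ) hrep A B
    -- Diagonal values of `c` and `h` are not controlled, so they are masked to obtain an invariant
    -- function.
    (w := fun a b => if a = b then 0 else D.conductance ε a b) (by
      intro g a b
      simp only [smul_left_cancel_iff]
      split_ifs with hab
      · rfl
      · exact conductance_smul hD hinv ε g hab)
  rw [Finset.mul_sum, Finset.mul_sum] at h
  simp only [orbitWeight]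
  rw [← Finset.sum_congr rfl (fun b hb => ?_), h]
  · refine Finset.sum_congr rfl fun a ha => ?_
    simp only [Finset.mem_filter, Finset.mem_univ, true_and] at ha
    have hne := ne_of_orbit_ne hAB ha (hrep B)
    rw [if_neg hne, conductance_comm hD ε hne]
  · simp only [Finset.mem_filter, Finset.mem_univ, true_and] at hb
    rw [if_neg (ne_of_orbit_ne hAB (hrep A) hb)]

include hD hinv hrep in
theorem sum_orbitWeight_antisymm [Fintype (ActiveOrbit X χ)] (ε : ℝ) (N : ActiveOrbit X χ → ℝ) :
    ∑ A : ActiveOrbit X χ, ∑ b ∈ Finset.univ.erase (rep A.1), D.orbitWeight rep ε A.1 b *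
      (if h : IsActive χ (orbitOf G b) then (N A - N ⟨_, h⟩) / 2 else 0) = 0 := by
  set T : ActiveOrbit X χ → ActiveOrbit X χ → ℝ := fun A B =>
    (∑ b ∈ Finset.univ.filter (fun b : X => orbitOf G b = B.1), D.orbitWeight rep ε A.1 b) *
      ((N A - N B) / 2) with hT
  have h1 : ∀ A : ActiveOrbit X χ, ∑ b ∈ Finset.univ.erase (rep A.1), D.orbitWeight rep ε A.1 b *
      (if h : IsActive χ (orbitOf G b) then (N A - N ⟨_, h⟩) / 2 else 0) = ∑ B, T A B := by
    intro A
    rw [Finset.sum_erase _ (by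
      have h0 : IsActive χ (orbitOf G (rep A.1)) := by rw [hrep]; exact A.2
      rw [dif_pos h0]
      have : (⟨_, h0⟩ : ActiveOrbit X χ) = A := Subtype.ext (hrep _)
      rw [this, sub_self, zero_div, mul_zero])]
    simp only [hT, Finset.sum_mul, Finset.sum_filter]
    rw [Finset.sum_comm]
    refine Finset.sum_congr rfl fun b _ => ?_
    by_cases hb : IsActive χ (orbitOf G b)
    · rw [dif_pos hb, Finset.sum_eq_single ⟨_, hb⟩, if_pos rfl]
      · intro B _ hB
        rw [if_neg (fun h => hB (Subtype.ext h.symm)), zero_mul]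
      · simp
    · rw [dif_neg hb, mul_zero, Finset.sum_eq_zero]
      intro B _
      rw [if_neg (fun h : orbitOf G b = B.1 => hb (h ▸ B.2)), zero_mul]
  have h2 : ∀ A B, T A B = -T B A := by
    intro A B
    by_cases hAB : A = B
    · simp [hT, hAB]
    · simp only [hT]
      rw [sum_orbitWeight_symm hD hinv hrep ε fun h => hAB (Subtype.ext h)]
      ring
  rw [Finset.sum_congr rfl fun A _ => h1 A]
  have h3 : ∑ A, ∑ B, T A B = -∑ A, ∑ B, T A B := by
    conv_lhs => rw [Finset.sum_comm]
    rw [← Finset.sum_neg_distrib]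
    refine Finset.sum_congr rfl fun A _ => ?_
    rw [← Finset.sum_neg_distrib]
    exact Finset.sum_congr rfl fun B _ => h2 B A
  linarith

include hD hinv hrep in
/-- The Dirichlet form of the restricted generator, as a sum over transitions. -/
theorem dirichlet_form_eq [Fintype (ActiveOrbit X χ)] {ε : ℝ} (hε : 0 < ε)
    (F : ActiveOrbit X χ → ℂ) :
    -(∑ A, (((D.augmented χ rep).m (some A) *
        Real.exp (-(D.augmented χ rep).V (some A) / ε) : ℝ) : ℂ) *
        (star (F A) * (restrictedMatrix D χ rep ε).mulVec F A)).re =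
      ∑ A : ActiveOrbit X χ, ∑ b ∈ Finset.univ.erase (rep A.1),
        D.orbitWeight rep ε A.1 b * pairEnergy χ rep F A b := by
  have h1 := sum_orbitWeight_antisymm hD hinv hrep ε (fun A : ActiveOrbit X χ => ‖F A‖ ^ 2)
  refine Eq.trans ?_ (add_zero _)
  rw [← h1, ← Finset.sum_add_distrib, Complex.re_sum, ← Finset.sum_neg_distrib]
  refine Finset.sum_congr rfl fun A _ => ?_
  rw [← Finset.sum_add_distrib, restrictedMatrix_mulVec hrep hinv hε, genC_mulVec, lift_rep hrep,
    Finset.mul_sum, Finset.mul_sum, Complex.re_sum, ← Finset.sum_neg_distrib]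
  refine Finset.sum_congr rfl fun b _ => ?_
  rw [← mul_add, ← re_star_mul_sub_lift hrep, ← augmented_weight_mul_rate (χ := χ) hD ε A b,
    ← Complex.re_ofReal_mul, ← Complex.neg_re]
  congr 1
  push_cast
  ring

end JumpData

/-! ### Energy of the highest edges, in terms of the states of the process. -/

namespace JumpData

open Relation

section EdgeForm

variable {S : Type*} (D : JumpData S) {n : ℕ} (e : Fin n → S × S)

/-- The energy of `Φ` carried by the edge `e k`. -/
def edgeTerm (ε : ℝ) (Φ : S → ℂ) (k : Fin n) : ℝ :=
  D.c (e k).1 (e k).2 * Real.exp (-(D.saddle (e k).1 (e k).2).toReal / ε) *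
    ‖Φ (e k).1 - Φ (e k).2‖ ^ 2

/-- The energy of `Φ` carried by the edges `e k`. -/
def edgeForm (ε : ℝ) (Φ : S → ℂ) : ℝ := ∑ k, D.edgeTerm e ε Φ k

variable {D e}

theorem treeForm_comp (σ : Fin (n + 1) ≃ S) (ε : ℝ) (Φ : S → ℂ) :
    treeForm (fun k => D.c (e k).1 (e k).2) (fun k => (D.saddle (e k).1 (e k).2).toReal)
      (fun k => σ.symm (e k).1) (fun k => σ.symm (e k).2) ε (Φ ∘ σ) = D.edgeForm e ε Φ := by
  simp [treeForm, treeTerm, edgeForm, edgeTerm]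

variable {o : S} (ho : ∀ y, D.h o y = ⊤)
  (hsymm : ∀ x y, x ≠ o → y ≠ o → x ≠ y → D.saddle x y = D.saddle y x)
  {θ : ℝ≥0} {σ : Fin (n + 1) ≃ S} (hier : D.IsMetastableHierarchy θ σ e) (hθ : 0 < θ)
  (hc : ∀ k, 0 < D.c (e k).1 (e k).2)

theorem sym2_symm_iff {x y x' y' : S} :
    s(σ.symm x, σ.symm y) = s(σ.symm x', σ.symm y') ↔ s(x, y) = s(x', y') := by
  simp

include hc in
omit hier in
theorem energy_le_of_lowConn {h : ℝ} {x y : S}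
    (H : LowConn (fun k => (D.saddle (e k).1 (e k).2).toReal) (fun k => σ.symm (e k).1)
      (fun k => σ.symm (e k).2) θ 0 h (σ.symm x) (σ.symm y)) :
    ∃ K, 0 ≤ K ∧ ∀ ε : ℝ, 0 < ε → ∀ Φ : S → ℂ,
      Real.exp (-h / ε) * ‖Φ x - Φ y‖ ^ 2 ≤ K * Real.exp (-θ / ε) * D.edgeForm e ε Φ := by
  obtain ⟨K, hK, hb⟩ := LowConn.norm_sub_sq_le (c := fun k => D.c (e k).1 (e k).2) hc H
  refine ⟨K, hK, fun ε hε Φ => ?_⟩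
  have h1 := hb ε hε (Φ ∘ σ)
  simp only [Function.comp_apply, Equiv.apply_symm_apply] at h1
  calc Real.exp (-h / ε) * ‖Φ x - Φ y‖ ^ 2
      ≤ Real.exp (-h / ε) * (K * Real.exp ((h - θ) / ε) * D.edgeForm e ε Φ) := by
        rw [← treeForm_comp σ]
        gcongr
        exact h1.trans (by gcongr; exact lowForm_le_treeForm hc)
    _ = K * (Real.exp (-h / ε) * Real.exp ((h - θ) / ε)) * D.edgeForm e ε Φ := by ring
    _ = _ := by rw [← Real.exp_add]; congr 3; ring

include ho hsymm hier hθ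

/-- A transition which is not the leading part of one of the highest edges carries little energy. -/
theorem IsMetastableHierarchy.energy_le (hc : ∀ k, 0 < D.c (e k).1 (e k).2) {h : ℝ} {x y : S}
    (hQ : D.OpenAt h x y)
    (hgap : ∀ k, s(x, y) = s((e k).1, (e k).2) → (D.saddle (e k).1 (e k).2).toReal + θ ≤ h) :
    ∃ K, 0 ≤ K ∧ ∀ ε : ℝ, 0 < ε → ∀ Φ : S → ℂ,
      Real.exp (-h / ε) * ‖Φ x - Φ y‖ ^ 2 ≤ K * Real.exp (-θ / ε) * D.edgeForm e ε Φ := by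
  refine energy_le_of_lowConn (σ := σ) hc ?_
  rcases (hier.gapHierarchy ho hsymm hθ).tree_or_lowConn (h := h) (σ.symm.injective.ne hQ.1)
    (by simpa using hQ) with ⟨j, hj⟩ | H
  · exact ReflTransGen.single ⟨j, Nat.zero_le _, hgap j (sym2_symm_iff.1 hj), hj⟩
  · exact H

omit hsymm hθ in
theorem IsMetastableHierarchy.symm_absorbing : σ.symm o = 0 := by
  rw [← hier.first_eq_absorbing ho, Equiv.symm_apply_apply]

theorem IsMetastableHierarchy.gap_of_triangle {h : ℝ} {x y : S} {k : Fin n}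
    (hk : s(x, o) = s((e k).1, (e k).2)) (hx : x ≠ o) (hy : y ≠ o) (h1 : D.OpenAt h x y)
    (h2 : D.OpenAt h y o) : (D.saddle (e k).1 (e k).2).toReal + θ ≤ h := by
  have h0 := hier.symm_absorbing ho
  refine (hier.gapHierarchy ho hsymm hθ).gap_of_triangle (a := σ.symm x) (b := σ.symm y) (j := k)
    (h := h) ?_ ?_ ?_ (σ.symm.injective.ne h1.1) (by simpa using h1) ?_
  · rw [← h0]; exact sym2_symm_iff.2 hk
  · rw [← h0]; exact σ.symm.injective.ne hx
  · rw [← h0]; exact σ.symm.injective.ne hy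
  · rw [← h0]; simpa using h2

theorem IsMetastableHierarchy.energy_le_of_triangle (hc : ∀ k, 0 < D.c (e k).1 (e k).2) {h : ℝ}
    {x y : S} (hx : x ≠ o) (hy : y ≠ o) (h1 : D.OpenAt h x y) (h2 : D.OpenAt h x o)
    (h3 : D.OpenAt h y o) :
    ∃ K, 0 ≤ K ∧ ∀ ε : ℝ, 0 < ε → ∀ Φ : S → ℂ,
      Real.exp (-h / ε) * ‖Φ x - Φ o‖ ^ 2 ≤ K * Real.exp (-θ / ε) * D.edgeForm e ε Φ :=
  hier.energy_le ho hsymm hθ hc h2 fun _ hk => hier.gap_of_triangle ho hsymm hθ hk hx hy h1 h3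

theorem IsMetastableHierarchy.not_triangle {x y : S} {k : Fin n}
    (hk : s(x, y) = s((e k).1, (e k).2)) (hx : x ≠ o) (hy : y ≠ o)
    (h1 : D.OpenAt (D.saddle (e k).1 (e k).2).toReal x o)
    (h2 : D.OpenAt (D.saddle (e k).1 (e k).2).toReal y o) : False := by
  have h0 := hier.symm_absorbing ho
  have hσ : ∀ {z : S}, z ≠ o → σ.symm z ≠ 0 := fun hz => by
    rw [← h0]; exact σ.symm.injective.ne hz
  have hk' := Sym2.eq_iff.1 hk
  refine (hier.gapHierarchy ho hsymm hθ).not_triangle_of_edge k (hσ ?_) (hσ ?_) ?_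
  · rcases hk' with ⟨h, -⟩ | ⟨-, h⟩ <;> rwa [← h]
  · rcases hk' with ⟨-, h⟩ | ⟨h, -⟩ <;> rwa [← h]
  · rw [← h0]
    simp only [Equiv.apply_symm_apply]
    rcases hk' with ⟨ha, hb⟩ | ⟨ha, hb⟩ <;> rw [ha] at h1 <;> rw [hb] at h2
    · exact ⟨h1, h2⟩
    · exact ⟨h2, h1⟩

theorem IsMetastableHierarchy.edge_injective {k k' : Fin n}
    (h : s((e k).1, (e k).2) = s((e k').1, (e k').2)) : k = k' :=
  (hier.gapHierarchy ho hsymm hθ).edge_injective (sym2_symm_iff.2 h)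

end EdgeForm

end JumpData

/-! ### Transitions outside the leading parts carry little energy. -/

namespace JumpData

open MulAction Relation
open scoped Classical

variable {X G : Type*} [Fintype X] [Group G] [Fintype G] [MulAction G X] {D : JumpData X}
  (hD : D.IsReversible) (hinv : D.IsInvariant G)
  {χ : G →* ℂˣ} {rep : orbitRel.Quotient G X → X} (hrep : ∀ A, orbitOf G (rep A) = A)
  {θ : ℝ≥0} (hgap : D.IsGap χ rep θ)

include hrep in
theorem augmented_saddle_le {A B : ActiveOrbit X χ} {b : X} (hb : orbitOf G b = B.1) :
    (D.augmented χ rep).saddle (some A) (some B) ≤ D.saddle (rep A.1) b := by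
  have h := orbitExponent_le (G := G) (D := D) (a := rep A.1) (b := b)
  rw [hrep, hb] at h
  exact add_le_add le_rfl h

omit [Fintype G] in
theorem add_right_ne_of_ne {v x y : ℝ≥0∞} (h : v + x ≠ v + y) : x ≠ y := fun h' => h (by rw [h'])

include hrep hgap in
theorem augmented_saddle_gap {A B : ActiveOrbit X χ} (hAB : A ≠ B) {b : X}
    (hb : orbitOf G b = B.1)
    (hne : D.saddle (rep A.1) b ≠ (D.augmented χ rep).saddle (some A) (some B)) :
    (D.augmented χ rep).saddle (some A) (some B) + θ ≤ D.saddle (rep A.1) b := by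
  have h := orbitExponent_le (G := G) (D := D) (a := rep A.1) (b := b)
  rw [hrep, hb] at h
  have h2 := hgap.orbit A B hAB _ b (hrep _) hb (lt_of_le_of_ne h (add_right_ne_of_ne hne).symm)
  change (D.V (rep A.1) : ℝ≥0∞) + D.orbitExponent A.1 B.1 + θ ≤ D.V (rep A.1) + D.h (rep A.1) b
  rw [add_assoc]
  gcongr

theorem augmented_saddle_none_le {A : ActiveOrbit X χ} {b : X} (hb : b ≠ rep A.1)
    (hφ : phase χ rep b ≠ 1) :
    (D.augmented χ rep).saddle (some A) none ≤ D.saddle (rep A.1) b :=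
  add_le_add le_rfl (killExponent_le hb hφ)

include hgap in
theorem augmented_saddle_none_gap {A : ActiveOrbit X χ} {b : X} (hb : b ≠ rep A.1)
    (hφ : phase χ rep b ≠ 1)
    (hne : D.saddle (rep A.1) b ≠ (D.augmented χ rep).saddle (some A) none) :
    (D.augmented χ rep).saddle (some A) none + θ ≤ D.saddle (rep A.1) b := by
  have h2 := hgap.kill A b hb hφ (lt_of_le_of_ne (killExponent_le hb hφ)
    (add_right_ne_of_ne hne).symm)
  change (D.V (rep A.1) : ℝ≥0∞) + D.killExponent χ rep A.1 + θ ≤ D.V (rep A.1) + D.h (rep A.1) b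
  rw [add_assoc]
  gcongr

include hrep in
theorem openAt_some {A B : ActiveOrbit X χ} (hAB : A ≠ B) {b : X} (hb : orbitOf G b = B.1)
    (ht : D.saddle (rep A.1) b ≠ ⊤) :
    (D.augmented χ rep).OpenAt (D.saddle (rep A.1) b).toReal (some A) (some B) :=
  ⟨fun h => hAB (Option.some_injective _ h), _, _, rfl,
    ne_top_of_le_ne_top ht (augmented_saddle_le hrep hb),
    ENNReal.toReal_mono ht (augmented_saddle_le hrep hb)⟩

theorem openAt_none {A : ActiveOrbit X χ} {b : X} (hb : b ≠ rep A.1) (hφ : phase χ rep b ≠ 1)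
    (ht : D.saddle (rep A.1) b ≠ ⊤) :
    (D.augmented χ rep).OpenAt (D.saddle (rep A.1) b).toReal (some A) none :=
  ⟨by simp, _, _, rfl, ne_top_of_le_ne_top ht (augmented_saddle_none_le hb hφ),
    ENNReal.toReal_mono ht (augmented_saddle_none_le hb hφ)⟩

include hD hinv hrep in
-- The reversed transition, moved to start at the representative of `B`, ends in a point of `A`
-- whose phase is the inverse of the original one. It therefore contributes to the killing of `B` at
-- the same saddle height.
theorem openAt_none_of_orbit {A B : ActiveOrbit X χ} (hAB : A ≠ B) {b : X}
    (hb : orbitOf G b = B.1) (hφ : phase χ rep b ≠ 1) (ht : D.saddle (rep A.1) b ≠ ⊤) :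
    (D.augmented χ rep).OpenAt (D.saddle (rep A.1) b).toReal (some B) none := by
  obtain ⟨g, hg⟩ := exists_smul_rep hrep b
  rw [hb] at hg
  have hAB' : B.1 ≠ A.1 := fun h => hAB (Subtype.ext h.symm)
  have horb : orbitOf G (g⁻¹ • rep A.1) = A.1 := by rw [orbitOf_smul, hrep]
  have hne := ne_of_orbit_ne hAB' (hrep B.1) horb
  have hs : D.saddle (rep B.1) (g⁻¹ • rep A.1) = D.saddle (rep A.1) b := by
    rw [← saddle_smul hD hinv g hne, hg, smul_inv_smul,
      saddle_comm hD (ne_of_orbit_ne hAB' hb (hrep A.1))]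
  rw [← hs] at ht ⊢
  refine openAt_none hne.symm (fun h => hφ ?_) ht
  rw [phase_smul hrep, phase_rep hrep A.2, mul_one, map_inv, Units.val_eq_one, inv_eq_one] at h
  rw [← hg, phase_smul hrep, phase_rep hrep B.2, h]
  simp

variable (χ) in
/-- The state of the augmented process reached by the transition from the orbit `A` to `b`. -/
def partner (A : ActiveOrbit X χ) (b : X) : Option (ActiveOrbit X χ) :=
  if h : IsActive χ (orbitOf G b) ∧ orbitOf G b ≠ A.1 then some ⟨_, h.1⟩ else none

omit hrep in
theorem partner_eq_some {A B : ActiveOrbit X χ} {b : X} :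
    partner χ A b = some B ↔ orbitOf G b = B.1 ∧ A ≠ B := by
  unfold partner
  split_ifs with h
  · simp only [Option.some.injEq]
    constructor
    · rintro rfl
      exact ⟨rfl, fun h' => h.2 (by rw [h'])⟩
    · rintro ⟨h', -⟩
      exact Subtype.ext h'
  · simp only [false_iff, not_and, not_not]
    intro hb
    by_contra hAB
    exact h ⟨hb ▸ B.2, fun h' => hAB (Subtype.ext (h'.symm.trans hb))⟩

theorem pairEnergy_of_some {F : ActiveOrbit X χ → ℂ} {A B : ActiveOrbit X χ} {b : X}
    (h : partner χ A b = some B) :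
    pairEnergy χ rep F A b = ‖F A - phase χ rep b * F B‖ ^ 2 / 2 := by
  obtain ⟨hb, hAB⟩ := partner_eq_some.1 h
  rw [pairEnergy, if_pos ⟨hb ▸ B.2, fun h' => hAB (Subtype.ext (h'.symm.trans hb))⟩,
    lift_of_active F hb]

theorem pairEnergy_of_none {F : ActiveOrbit X χ → ℂ} {A : ActiveOrbit X χ} {b : X}
    (h : partner χ A b = none) :
    pairEnergy χ rep F A b = (1 - phase χ rep b).re * ‖F A‖ ^ 2 := by
  rw [pairEnergy, if_neg]
  intro h'
  rw [partner, dif_pos h'] at h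
  simp at h

omit [Fintype X] [Fintype G] in
theorem orbitWeight_of_top {ε : ℝ} {A : orbitRel.Quotient G X} {b : X}
    (ht : D.saddle (rep A) b = ⊤) : D.orbitWeight rep ε A b = 0 := by
  rw [orbitWeight, conductance, ht, arrhenius_top, mul_zero, mul_zero]

omit [Fintype X] [Fintype G] in
theorem orbitWeight_of_ne_top {ε : ℝ} {A : orbitRel.Quotient G X} {b : X}
    (ht : D.saddle (rep A) b ≠ ⊤) : D.orbitWeight rep ε A b =
      (Nat.card (stabilizer G (rep A)) : ℝ)⁻¹ * D.c (rep A) b *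
        Real.exp (-(D.saddle (rep A) b).toReal / ε) := by
  rw [orbitWeight, conductance, arrhenius_of_ne_top ht, mul_assoc]

include hD hinv hrep in
-- Leading transitions are selected by their saddle height, which, unlike the exponent, is
-- symmetric; the sum can then be counted from either orbit by `orbit_sum_swap`.
theorem orbitCoeff_comm {A B : ActiveOrbit X χ} (hAB : A ≠ B)
    (ht : (D.augmented χ rep).saddle (some A) (some B) ≠ ⊤) :
    D.orbitCoeff rep A.1 B.1 = D.orbitCoeff rep B.1 A.1 := by
  have hAB' : A.1 ≠ B.1 := fun h => hAB (Subtype.ext h)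
  have hsymm := augmented_saddle_comm (χ := χ) hD hinv hrep (some A) (some B) (by simp) (by simp)
    (fun h => hAB (Option.some_injective _ h))
  set s₀ := (D.augmented χ rep).saddle (some A) (some B) with hs₀
  have h := orbit_sum_swap (R := ℝ) hrep A.1 B.1
    (w := fun a b => if a ≠ b ∧ D.saddle a b = s₀ then D.c a b else 0) (by
      intro g a b
      by_cases hab : a = b
      · simp [hab]
      · simp only [ne_eq, smul_left_cancel_iff, hab, not_false_eq_true, true_and,
          saddle_smul hD hinv g hab]
        split_ifs with hs
        · exact c_smul hD hinv g hab (saddle_ne_top_iff.1 (by rwa [hs]))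
        · rfl)
  simp only [← Finset.sum_filter, Finset.filter_filter] at h
  have hset : ∀ {A B : ActiveOrbit X χ} (hAB : A.1 ≠ B.1) (b : X),
      (orbitOf G b = B.1 ∧ D.h (rep A.1) b = D.orbitExponent A.1 B.1) ↔
        (orbitOf G b = B.1 ∧ rep A.1 ≠ b ∧
          D.saddle (rep A.1) b = (D.augmented χ rep).saddle (some A) (some B)) := by
    intro A B hAB b
    refine and_congr_right fun hb => ?_
    rw [and_iff_right (ne_of_orbit_ne hAB (hrep A.1) hb)]
    exact (ENNReal.add_right_inj ENNReal.coe_ne_top).symm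
  unfold orbitCoeff
  simp only [hset hAB', hset hAB'.symm]
  rw [← hs₀, ← hsymm, h]
  congr 1
  refine Finset.sum_congr ?_ fun a _ => hD.c_symm _ _
  ext a
  simp only [Finset.mem_filter, Finset.mem_univ, true_and]
  refine and_congr_right fun ha => ?_
  have hne := ne_of_orbit_ne hAB' ha (hrep B.1)
  rw [saddle_comm hD hne, and_iff_right hne, and_iff_right hne.symm]

variable {n : ℕ} {σ : Fin (n + 1) ≃ Option (ActiveOrbit X χ)}
  {e : Fin n → Option (ActiveOrbit X χ) × Option (ActiveOrbit X χ)}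
  (hier : (D.augmented χ rep).IsMetastableHierarchy θ σ e) (hθ : 0 < θ)

include hD hinv hrep hier in
theorem saddle_c_of_edge {A : ActiveOrbit X χ} {y : Option (ActiveOrbit X χ)} {k : Fin n}
    (hk : s(some A, y) = s((e k).1, (e k).2)) :
    (D.augmented χ rep).saddle (e k).1 (e k).2 = (D.augmented χ rep).saddle (some A) y ∧
      (D.augmented χ rep).c (e k).1 (e k).2 = (D.augmented χ rep).c (some A) y := by
  have ht := hier.saddle_ne_top k
  have hne := (hier.edge k).1
  rcases Sym2.eq_iff.1 hk with ⟨h1, h2⟩ | ⟨h1, h2⟩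
  · rw [h1, h2]
    exact ⟨rfl, rfl⟩
  · rw [← h1, ← h2] at ht hne ⊢
    rcases y with _ | B
    · exact absurd (saddle_absorbing (D := D.augmented χ rep) (fun _ => rfl) _) ht
    · exact ⟨augmented_saddle_comm hD hinv hrep _ _ (by simp) (by simp) hne,
        orbitCoeff_comm hD hinv hrep (fun h => hne (by rw [h])) ht⟩

include hier in
omit hrep in
theorem exists_edge_eq (k : Fin n) : ∃ (A : ActiveOrbit X χ) (y : Option (ActiveOrbit X χ)),
    e k = (some A, y) ∧ some A ≠ y := by
  have ht := hier.saddle_ne_top k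
  have hne := (hier.edge k).1
  rcases hk : e k with ⟨_ | A, y⟩
  · rw [hk] at ht
    exact absurd (saddle_absorbing (D := D.augmented χ rep) (fun _ => rfl) _) ht
  · rw [hk] at hne
    exact ⟨A, y, rfl, hne⟩

include hD hinv hrep hier in
theorem edge_c_pos (k : Fin n) : 0 < (D.augmented χ rep).c (e k).1 (e k).2 := by
  obtain ⟨A, y, hk, hne⟩ := exists_edge_eq hier k
  have ht := saddle_ne_top_iff.1 (hier.saddle_ne_top k)
  rw [hk] at ht ⊢
  rcases y with _ | B
  · exact killCoeff_pos hrep hD ht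
  · exact orbitCoeff_pos hD hinv hrep fun h => hne (congrArg some (Subtype.ext h))

variable (D χ rep e) in
/-- The transition from the orbit `A` to `b` is a leading part of the edge `e k`. -/
def IsLeading (k : Fin n) (A : ActiveOrbit X χ) (b : X) : Prop :=
  s(some A, partner χ A b) = s((e k).1, (e k).2) ∧
    D.saddle (rep A.1) b = (D.augmented χ rep).saddle (e k).1 (e k).2

/-- The extension of a function by zero to the cemetery. -/
def extendNone {ι : Type*} (F : ι → ℂ) (x : Option ι) : ℂ := x.elim 0 F

@[simp] theorem extendNone_none {ι : Type*} (F : ι → ℂ) : extendNone F none = 0 := rfl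

@[simp] theorem extendNone_some {ι : Type*} (F : ι → ℂ) (i : ι) : extendNone F (some i) = F i := rfl

include hD hinv hrep hgap hier hθ in
/-- The transitions that are not leading parts of edges carry little energy. -/
theorem energy_le_of_not_leading {A : ActiveOrbit X χ} {b : X} (hb : b ≠ rep A.1)
    (hn : ∀ k, ¬ IsLeading D χ rep e k A b) :
    ∃ K, 0 ≤ K ∧ ∀ ε : ℝ, 0 < ε → ∀ F : ActiveOrbit X χ → ℂ,
      D.orbitWeight rep ε A.1 b * pairEnergy χ rep F A b ≤
        K * Real.exp (-θ / ε) * (D.augmented χ rep).edgeForm e ε (extendNone F) := by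
  have hsymm := augmented_saddle_comm (χ := χ) hD hinv hrep
  have ho : ∀ y, (D.augmented χ rep).h none y = ⊤ := fun _ => rfl
  have hc := edge_c_pos hD hinv hrep hier
  by_cases ht : D.saddle (rep A.1) b = ⊤
  · exact ⟨0, le_rfl, fun ε _ F => by simp [orbitWeight_of_top ht]⟩
  set h := (D.saddle (rep A.1) b).toReal with hh
  have hcb := hD.c_pos _ _ hb.symm
  -- reduction to a bound without the prefactors
  suffices hs : ∃ K, 0 ≤ K ∧ ∀ ε : ℝ, 0 < ε → ∀ F : ActiveOrbit X χ → ℂ,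
      Real.exp (-h / ε) * pairEnergy χ rep F A b ≤
        K * Real.exp (-θ / ε) * (D.augmented χ rep).edgeForm e ε (extendNone F) by
    obtain ⟨K, hK, hb⟩ := hs
    refine ⟨(Nat.card (stabilizer G (rep A.1)) : ℝ)⁻¹ * D.c (rep A.1) b * K, by positivity,
      fun ε hε F => ?_⟩
    rw [orbitWeight_of_ne_top ht]
    calc _ = (Nat.card (stabilizer G (rep A.1)) : ℝ)⁻¹ * D.c (rep A.1) b *
          (Real.exp (-h / ε) * pairEnergy χ rep F A b) := by ring
      _ ≤ (Nat.card (stabilizer G (rep A.1)) : ℝ)⁻¹ * D.c (rep A.1) b *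
          (K * Real.exp (-θ / ε) * (D.augmented χ rep).edgeForm e ε (extendNone F)) :=
        mul_le_mul_of_nonneg_left (hb ε hε F) (by positivity)
      _ = _ := by ring
  -- On a pair of states joined by a highest edge, a transition that is not leading must lie above
  -- the leading exponent, hence above it by `θ`.
  have hgapk : ∀ k, s(some A, partner χ A b) = s((e k).1, (e k).2) →
      ((D.saddle (rep A.1) b ≠ (D.augmented χ rep).saddle (some A) (partner χ A b)) →
        (D.augmented χ rep).saddle (some A) (partner χ A b) + θ ≤ D.saddle (rep A.1) b) →
      ((D.augmented χ rep).saddle (e k).1 (e k).2).toReal + θ ≤ h := by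
    intro k hk hg
    have h1 := hn k
    have h2 := (saddle_c_of_edge hD hinv hrep hier hk).1
    rw [IsLeading, and_iff_right hk, h2] at h1
    have h3 := ENNReal.toReal_mono ht (hg h1)
    rw [ENNReal.toReal_add (ne_top_of_le_ne_top ht (le_self_add.trans (hg h1)))
      ENNReal.coe_ne_top] at h3
    rw [h2]
    exact h3
  rcases hp : partner χ A b with _ | B
  · by_cases hφ : phase χ rep b = 1
    · exact ⟨0, le_rfl, fun ε _ F => by simp [pairEnergy_of_none hp, hφ]⟩
    rw [hp] at hgapk
    obtain ⟨K, hK, hb'⟩ := hier.energy_le ho hsymm hθ hc (openAt_none hb hφ ht)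
      fun k hk => hgapk k hk (augmented_saddle_none_gap hgap hb hφ)
    refine ⟨(1 - phase χ rep b).re * K, mul_nonneg (one_sub_phase_re_nonneg hrep b) hK,
      fun ε hε F => ?_⟩
    have h1 := hb' ε hε (extendNone F)
    simp only [extendNone_some, extendNone_none, sub_zero] at h1
    have h2 := one_sub_phase_re_nonneg (χ := χ) hrep b
    rw [pairEnergy_of_none hp]
    calc _ = (1 - phase χ rep b).re * (Real.exp (-h / ε) * ‖F A‖ ^ 2) := by ring
      _ ≤ (1 - phase χ rep b).re * _ := mul_le_mul_of_nonneg_left h1 h2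
      _ = _ := by ring
  · obtain ⟨hbB, hAB⟩ := partner_eq_some.1 hp
    by_cases hφ : phase χ rep b = 1
    · rw [hp] at hgapk
      obtain ⟨K, hK, hb'⟩ := hier.energy_le ho hsymm hθ hc (openAt_some hrep hAB hbB ht)
        fun k hk => hgapk k hk (augmented_saddle_gap hrep hgap hAB hbB)
      refine ⟨K / 2, by positivity, fun ε hε F => ?_⟩
      have h1 := hb' ε hε (extendNone F)
      simp only [extendNone_some] at h1
      rw [pairEnergy_of_some hp, hφ, one_mul]
      linarith
    -- A nontrivial phase prevents a bound by `F A - F B`. Both orbits are open to the cemetery at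
    -- this height, so `F A` and `F B` are bounded separately through the triangle.
    · have hA := openAt_none hb hφ ht
      have hB := openAt_none_of_orbit hD hinv hrep hAB hbB hφ ht
      have hOAB := openAt_some hrep hAB hbB ht
      obtain ⟨K₁, hK₁, hb₁⟩ := hier.energy_le_of_triangle ho hsymm hθ hc (by simp) (by simp) hOAB
        hA hB
      obtain ⟨K₂, hK₂, hb₂⟩ := hier.energy_le_of_triangle ho hsymm hθ hc (by simp) (by simp)
        hOAB.symm hB hA
      refine ⟨K₁ + K₂, by positivity, fun ε hε F => ?_⟩
      have h1 := hb₁ ε hε (extendNone F)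
      have h2 := hb₂ ε hε (extendNone F)
      simp only [extendNone_some, extendNone_none, sub_zero] at h1 h2
      have h3 := norm_add_sq_le (F A) (-(phase χ rep b * F B))
      rw [← sub_eq_add_neg, norm_neg, norm_mul, norm_phase hrep (hbB ▸ B.2), one_mul] at h3
      rw [pairEnergy_of_some hp]
      calc _ ≤ Real.exp (-h / ε) * (‖F A‖ ^ 2 + ‖F B‖ ^ 2) := by gcongr; linarith
        _ = Real.exp (-h / ε) * ‖F A‖ ^ 2 + Real.exp (-h / ε) * ‖F B‖ ^ 2 := by ring
        _ ≤ _ := add_le_add h1 h2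
        _ = _ := by ring

end JumpData

/-! ### Leading transitions reproduce the energy of the highest edges. -/

namespace JumpData

open MulAction Relation
open scoped Classical

variable {X G : Type*} [Fintype X] [Group G] [Fintype G] [MulAction G X] {D : JumpData X}
  (hD : D.IsReversible) (hinv : D.IsInvariant G)
  {χ : G →* ℂˣ} {rep : orbitRel.Quotient G X → X} (hrep : ∀ A, orbitOf G (rep A) = A)
  {θ : ℝ≥0} {n : ℕ} {σ : Fin (n + 1) ≃ Option (ActiveOrbit X χ)}
  {e : Fin n → Option (ActiveOrbit X χ) × Option (ActiveOrbit X χ)}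
  (hier : (D.augmented χ rep).IsMetastableHierarchy θ σ e) (hθ : 0 < θ)

include hD hinv hrep hier hθ

/-- The leading transitions between two active orbits joined by one of the highest edges have
phase `1`. -/
theorem phase_eq_one_of_isLeading {k : Fin n} {A B : ActiveOrbit X χ} {b : X} (hb : b ≠ rep A.1)
    (hl : IsLeading D χ rep e k A b) (hp : partner χ A b = some B) : phase χ rep b = 1 := by
  -- Otherwise both orbits could be killed at the height of the edge, which `not_triangle` forbids.
  by_contra hφ
  obtain ⟨hbB, hAB⟩ := partner_eq_some.1 hp
  have ht : D.saddle (rep A.1) b ≠ ⊤ := by rw [hl.2]; exact hier.saddle_ne_top k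
  have h1 := openAt_none hb hφ ht
  have h2 := openAt_none_of_orbit hD hinv hrep hAB hbB hφ ht
  have hs := hl.1
  rw [hp] at hs
  rw [hl.2] at h1 h2
  exact hier.not_triangle (fun _ => rfl) (augmented_saddle_comm hD hinv hrep) hθ hs (by simp)
    (by simp) h1 h2

/-- The energy of the edge is counted once from each of its two orbits, which explains the factor `1
/ 2`. -/
theorem sum_isLeading_some {k : Fin n} {A B : ActiveOrbit X χ}
    (hk : s(some A, some B) = s((e k).1, (e k).2)) (ε : ℝ) (F : ActiveOrbit X χ → ℂ) :
    ∑ b ∈ (Finset.univ.erase (rep A.1)).filter (fun b => IsLeading D χ rep e k A b),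
      D.orbitWeight rep ε A.1 b * pairEnergy χ rep F A b =
    (D.augmented χ rep).edgeTerm e ε (extendNone F) k / 2 := by
  have hne : some A ≠ some B := by
    have := (hier.edge k).1
    rcases Sym2.eq_iff.1 hk with ⟨h1, h2⟩ | ⟨h1, h2⟩ <;> rw [h1, h2]
    · exact this
    · exact this.symm
  have hAB : A ≠ B := fun h => hne (by rw [h])
  have hAB' : A.1 ≠ B.1 := fun h => hAB (Subtype.ext h)
  obtain ⟨hs, hc⟩ := saddle_c_of_edge hD hinv hrep hier hk
  have ht := hier.saddle_ne_top k
  have hnorm : ‖extendNone F (e k).1 - extendNone F (e k).2‖ ^ 2 = ‖F A - F B‖ ^ 2 := by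
    rcases Sym2.eq_iff.1 hk with ⟨h1, h2⟩ | ⟨h1, h2⟩ <;> rw [← h1, ← h2]
    · rfl
    · rw [norm_sub_rev]; rfl
  have hpart : ∀ b, IsLeading D χ rep e k A b → partner χ A b = some B := by
    intro b hl
    have := hl.1
    rw [← hk] at this
    rcases Sym2.eq_iff.1 this with ⟨_, h⟩ | ⟨h, _⟩
    · exact h
    · exact absurd h hne
  have hset : (Finset.univ.erase (rep A.1)).filter (fun b => IsLeading D χ rep e k A b) =
      Finset.univ.filter (fun b : X => orbitOf G b = B.1 ∧
        D.h (rep A.1) b = D.orbitExponent A.1 B.1) := by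
    ext b
    simp only [Finset.mem_filter, Finset.mem_erase, Finset.mem_univ, and_true, true_and]
    constructor
    · rintro ⟨_, hl⟩
      refine ⟨(partner_eq_some.1 (hpart b hl)).1, ?_⟩
      have h2 := hl.2
      rw [hs] at h2
      exact (ENNReal.add_right_inj ENNReal.coe_ne_top).1 h2
    · rintro ⟨hb, hh⟩
      refine ⟨(ne_of_orbit_ne hAB' (hrep A.1) hb).symm, ?_, ?_⟩
      · rw [partner_eq_some.2 ⟨hb, hAB⟩, hk]
      · rw [hs]
        exact (ENNReal.add_right_inj ENNReal.coe_ne_top).2 hh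
  have hterm : ∀ b ∈ (Finset.univ.erase (rep A.1)).filter (fun b => IsLeading D χ rep e k A b),
      D.orbitWeight rep ε A.1 b * pairEnergy χ rep F A b =
      D.c (rep A.1) b * ((Nat.card (stabilizer G (rep A.1)) : ℝ)⁻¹ *
        (Real.exp (-((D.augmented χ rep).saddle (e k).1 (e k).2).toReal / ε) *
          (‖F A - F B‖ ^ 2 / 2))) := by
    intro b hb
    simp only [Finset.mem_filter, Finset.mem_erase, Finset.mem_univ, and_true] at hb
    obtain ⟨hb, hl⟩ := hb
    rw [orbitWeight_of_ne_top (by rwa [hl.2]), pairEnergy_of_some (hpart b hl),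
      phase_eq_one_of_isLeading hD hinv hrep hier hθ hb hl (hpart b hl), hl.2, one_mul]
    ring
  rw [Finset.sum_congr rfl hterm, ← Finset.sum_mul, hset, edgeTerm, hnorm, hc]
  change _ = D.orbitCoeff rep A.1 B.1 * _ * _ / 2
  rw [orbitCoeff]
  ring

omit hier hθ in
/-- The sum of the leading phases within an orbit is real. -/
theorem conj_sum_phase (A : ActiveOrbit X χ) {s₀ : ℝ≥0∞} (hs₀ : s₀ ≠ ⊤) :
    starRingEnd ℂ (∑ b ∈ Finset.univ.filter (fun b : X => orbitOf G b = A.1 ∧ b ≠ rep A.1 ∧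
      D.saddle (rep A.1) b = s₀), D.c (rep A.1) b * phase χ rep b) =
    ∑ b ∈ Finset.univ.filter (fun b : X => orbitOf G b = A.1 ∧ b ≠ rep A.1 ∧
      D.saddle (rep A.1) b = s₀), D.c (rep A.1) b * phase χ rep b := by
  -- With both orbits equal, the exchange of roles is the reversal of transitions inside the orbit,
  -- which conjugates phases.
  have h := orbit_sum_swap (R := ℂ) hrep A.1 A.1
    (w := fun a b => if b ≠ a ∧ D.saddle a b = s₀ then
      (D.c a b : ℂ) * (starRingEnd ℂ (phase χ rep a) * phase χ rep b) else 0) (by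
      intro g a b
      by_cases hab : b = a
      · simp [hab]
      · simp only [ne_eq, smul_left_cancel_iff, hab, not_false_eq_true, true_and,
          saddle_smul hD hinv g (Ne.symm hab)]
        split_ifs with hs
        · rw [c_smul hD hinv g (Ne.symm hab) (saddle_ne_top_iff.1 (by rwa [hs]))]
          simp only [phase_smul hrep, map_mul, conj_character]
          congr 1
          rw [mul_mul_mul_comm, map_inv, Units.inv_mul, one_mul]
        · rfl)
  have hcard : (Nat.card (stabilizer G (rep A.1)) : ℂ)⁻¹ ≠ 0 :=
    inv_ne_zero (by exact_mod_cast Nat.card_pos.ne')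
  have h := mul_left_cancel₀ hcard h
  simp only [← Finset.sum_filter, Finset.filter_filter, phase_rep hrep A.2, map_one, one_mul,
    mul_one] at h
  conv_rhs => rw [h]
  rw [map_sum]
  refine Finset.sum_congr ?_ fun b hb => ?_
  · ext b
    simp only [Finset.mem_filter, Finset.mem_univ, true_and]
    refine and_congr_right fun _ => ?_
    rw [ne_comm]
    refine and_congr_right fun hne => ?_
    rw [saddle_comm hD hne]
  · rw [map_mul, Complex.conj_ofReal, hD.c_symm]

/-- The killing coefficient is the modulus of a complex sum, while the energy contains the real
parts of its terms. They agree because the sum is real with nonnegative terms in its real part: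
other active orbits drop out by `gap_of_triangle`, inactive points have phase zero, and inside the
orbit reversal conjugates the phases. -/
theorem sum_isLeading_none {k : Fin n} {A : ActiveOrbit X χ}
    (hk : s(some A, none) = s((e k).1, (e k).2)) (ε : ℝ) (F : ActiveOrbit X χ → ℂ) :
    ∑ b ∈ (Finset.univ.erase (rep A.1)).filter (fun b => IsLeading D χ rep e k A b),
      D.orbitWeight rep ε A.1 b * pairEnergy χ rep F A b =
    (D.augmented χ rep).edgeTerm e ε (extendNone F) k := by
  obtain ⟨hs, hc⟩ := saddle_c_of_edge hD hinv hrep hier hk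
  have ht := hier.saddle_ne_top k
  have hnorm : ‖extendNone F (e k).1 - extendNone F (e k).2‖ ^ 2 = ‖F A‖ ^ 2 := by
    rcases Sym2.eq_iff.1 hk with ⟨h1, h2⟩ | ⟨h1, h2⟩ <;> rw [← h1, ← h2]
    · simp
    · simp
  have hlead : ∀ b, IsLeading D χ rep e k A b ↔ partner χ A b = none ∧
      D.saddle (rep A.1) b = (D.augmented χ rep).saddle (e k).1 (e k).2 := by
    intro b
    refine and_congr_left fun _ => ?_
    rw [← hk]
    simp
  set s₀ := (D.augmented χ rep).saddle (e k).1 (e k).2 with hs₀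
  set L := (Finset.univ.erase (rep A.1)).filter (fun b => IsLeading D χ rep e k A b) with hL
  have hmem : ∀ b, b ∈ L ↔ b ≠ rep A.1 ∧ partner χ A b = none ∧ D.saddle (rep A.1) b = s₀ := by
    intro b
    rw [hL, Finset.mem_filter, Finset.mem_erase, hlead]
    simp
  -- the sum defining the killing coefficient runs over the same transitions
  have hkill : ∑ b ∈ Finset.univ.filter (fun b : X => b ≠ rep A.1 ∧ phase χ rep b ≠ 1 ∧
        D.h (rep A.1) b = D.killExponent χ rep A.1), (1 - phase χ rep b) * (D.c (rep A.1) b : ℂ) =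
      ∑ b ∈ L, (1 - phase χ rep b) * (D.c (rep A.1) b : ℂ) := by
    refine Finset.sum_subset_zero_on_sdiff ?_ ?_ fun _ _ => rfl
    · intro b hb
      simp only [Finset.mem_filter, Finset.mem_univ, true_and] at hb
      obtain ⟨hb, hφ, hh⟩ := hb
      have hsb : D.saddle (rep A.1) b = s₀ := by
        rw [hs]
        exact (ENNReal.add_right_inj ENNReal.coe_ne_top).2 hh
      rw [hmem]
      refine ⟨hb, ?_, hsb⟩
      rcases hp : partner χ A b with _ | B
      · rfl
      -- A point of another active orbit `B` with phase different from `1` would open the triangle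
      -- `A`, `B`, cemetery at the height of the edge.
      · exfalso
        obtain ⟨hbB, hAB⟩ := partner_eq_some.1 hp
        have htb : D.saddle (rep A.1) b ≠ ⊤ := by rwa [hsb]
        have h1 := hier.gap_of_triangle (fun _ => rfl) (augmented_saddle_comm hD hinv hrep) hθ hk
          (by simp) (by simp) (openAt_some hrep hAB hbB htb)
          (openAt_none_of_orbit hD hinv hrep hAB hbB hφ htb)
        rw [hsb, ← hs₀] at h1
        have : (0 : ℝ) < θ := by exact_mod_cast hθ
        linarith
    · intro b hb
      rw [Finset.mem_sdiff, hmem, Finset.mem_filter] at hb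
      obtain ⟨⟨hb, _, hsb⟩, h2⟩ := hb
      have hφ : phase χ rep b = 1 := by
        by_contra hφ
        refine h2 ⟨Finset.mem_univ _, hb, hφ, ?_⟩
        rw [hs] at hsb
        exact (ENNReal.add_right_inj ENNReal.coe_ne_top).1 hsb
      rw [hφ, sub_self, zero_mul]
  -- this sum is real
  have him : (∑ b ∈ L, (1 - phase χ rep b) * (D.c (rep A.1) b : ℂ)).im = 0 := by
    have h1 := Complex.conj_eq_iff_im.1 (conj_sum_phase hD hinv hrep A ht)
    have h2 : ∑ b ∈ L, (D.c (rep A.1) b : ℂ) * phase χ rep b =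
        ∑ b ∈ Finset.univ.filter (fun b : X => orbitOf G b = A.1 ∧ b ≠ rep A.1 ∧
          D.saddle (rep A.1) b = s₀), D.c (rep A.1) b * phase χ rep b := by
      symm
      refine Finset.sum_subset_zero_on_sdiff ?_ ?_ fun _ _ => rfl
      · intro b hb
        simp only [Finset.mem_filter, Finset.mem_univ, true_and] at hb
        rw [hmem]
        refine ⟨hb.2.1, ?_, hb.2.2⟩
        rw [partner, dif_neg]
        exact fun h => h.2 hb.1
      · intro b hb
        rw [Finset.mem_sdiff, hmem, Finset.mem_filter] at hb
        obtain ⟨⟨hb, hp, hsb⟩, h2⟩ := hb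
        rw [phase_of_not_active, mul_zero]
        intro hact
        have hA : orbitOf G b ≠ A.1 := fun h => h2 ⟨Finset.mem_univ _, h, hb, hsb⟩
        rw [partner, dif_pos ⟨hact, hA⟩] at hp
        simp at hp
    have h3 : ∑ b ∈ L, (1 - phase χ rep b) * (D.c (rep A.1) b : ℂ) =
        ((∑ b ∈ L, D.c (rep A.1) b : ℝ) : ℂ) -
          ∑ b ∈ L, (D.c (rep A.1) b : ℂ) * phase χ rep b := by
      rw [Complex.ofReal_sum, ← Finset.sum_sub_distrib]
      exact Finset.sum_congr rfl fun b _ => by ring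
    rw [h3, h2, Complex.sub_im, h1, Complex.ofReal_im, sub_zero]
  have hre : (∑ b ∈ L, (1 - phase χ rep b) * (D.c (rep A.1) b : ℂ)).re =
      ∑ b ∈ L, (1 - phase χ rep b).re * D.c (rep A.1) b := by
    rw [Complex.re_sum]
    exact Finset.sum_congr rfl fun b _ => Complex.re_mul_ofReal _ _
  have hnn : 0 ≤ ∑ b ∈ L, (1 - phase χ rep b).re * D.c (rep A.1) b :=
    Finset.sum_nonneg fun b hb => mul_nonneg (one_sub_phase_re_nonneg hrep b)
      (hD.c_pos _ _ ((hmem b).1 hb).1.symm).le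
  have hcoeff : D.killCoeff χ rep A.1 = (Nat.card (stabilizer G (rep A.1)) : ℝ)⁻¹ *
      ∑ b ∈ L, (1 - phase χ rep b).re * D.c (rep A.1) b := by
    rw [killCoeff, hkill, ← Complex.re_add_im (∑ b ∈ L, _), him, hre, Complex.ofReal_zero, zero_mul,
      add_zero, Complex.norm_real, Real.norm_eq_abs, abs_of_nonneg hnn]
  have hterm : ∀ b ∈ L, D.orbitWeight rep ε A.1 b * pairEnergy χ rep F A b =
      (1 - phase χ rep b).re * D.c (rep A.1) b *
        ((Nat.card (stabilizer G (rep A.1)) : ℝ)⁻¹ * (Real.exp (-s₀.toReal / ε) * ‖F A‖ ^ 2)) := by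
    intro b hb
    obtain ⟨_, hp, hsb⟩ := (hmem b).1 hb
    rw [orbitWeight_of_ne_top (by rwa [hsb]), pairEnergy_of_none hp, hsb]
    ring
  rw [Finset.sum_congr rfl hterm, ← Finset.sum_mul, edgeTerm, hnorm, hc]
  change _ = D.killCoeff χ rep A.1 * _ * _
  rw [hcoeff]
  ring

variable [Fintype (ActiveOrbit X χ)]

theorem sum_isLeading (k : Fin n) (ε : ℝ) (F : ActiveOrbit X χ → ℂ) :
    ∑ A : ActiveOrbit X χ,
      ∑ b ∈ (Finset.univ.erase (rep A.1)).filter (fun b => IsLeading D χ rep e k A b),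
        D.orbitWeight rep ε A.1 b * pairEnergy χ rep F A b =
    (D.augmented χ rep).edgeTerm e ε (extendNone F) k := by
  obtain ⟨A, y, hk, hne⟩ := exists_edge_eq hier k
  have hk' : s(some A, y) = s((e k).1, (e k).2) := by rw [hk]
  have hzero : ∀ A' : ActiveOrbit X χ, some A' ≠ some A → some A' ≠ y →
      ∑ b ∈ (Finset.univ.erase (rep A'.1)).filter (fun b => IsLeading D χ rep e k A' b),
        D.orbitWeight rep ε A'.1 b * pairEnergy χ rep F A' b = 0 := by
    intro A' h1 h2
    rw [Finset.filter_false_of_mem, Finset.sum_empty]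
    intro b _ hl
    have := hl.1
    rw [← hk'] at this
    rcases Sym2.eq_iff.1 this with ⟨h, _⟩ | ⟨h, _⟩
    · exact h1 h
    · exact h2 h
  rcases y with _ | B
  · rw [Fintype.sum_eq_single A fun A' h => hzero A' (by simpa using h) (by simp)]
    exact sum_isLeading_none hD hinv hrep hier hθ hk' ε F
  · have hAB : A ≠ B := fun h => hne (by rw [h])
    rw [Fintype.sum_eq_add A B hAB fun A' h => hzero A' (by simpa using h.1) (by simpa using h.2),
      sum_isLeading_some hD hinv hrep hier hθ hk',
      sum_isLeading_some hD hinv hrep hier hθ (Sym2.eq_swap.trans hk')]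
    ring

/-- The Dirichlet form is the energy of the highest edges plus that of the other transitions. -/
theorem sum_energy_eq (ε : ℝ) (F : ActiveOrbit X χ → ℂ) :
    ∑ A : ActiveOrbit X χ, ∑ b ∈ Finset.univ.erase (rep A.1),
      D.orbitWeight rep ε A.1 b * pairEnergy χ rep F A b =
    (D.augmented χ rep).edgeForm e ε (extendNone F) + ∑ A : ActiveOrbit X χ,
      ∑ b ∈ (Finset.univ.erase (rep A.1)).filter (fun b => ∀ k, ¬ IsLeading D χ rep e k A b),
        D.orbitWeight rep ε A.1 b * pairEnergy χ rep F A b := by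
  have h1 : (D.augmented χ rep).edgeForm e ε (extendNone F) = ∑ A : ActiveOrbit X χ, ∑ k,
      ∑ b ∈ (Finset.univ.erase (rep A.1)).filter (fun b => IsLeading D χ rep e k A b),
        D.orbitWeight rep ε A.1 b * pairEnergy χ rep F A b := by
    rw [Finset.sum_comm, edgeForm]
    exact Finset.sum_congr rfl fun k _ => (sum_isLeading hD hinv hrep hier hθ k ε F).symm
  rw [h1, ← Finset.sum_add_distrib]
  refine Finset.sum_congr rfl fun A _ => ?_
  simp only [Finset.sum_filter]
  rw [Finset.sum_comm, ← Finset.sum_add_distrib]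
  refine Finset.sum_congr rfl fun b _ => ?_
  by_cases h : ∃ k, IsLeading D χ rep e k A b
  · obtain ⟨k, hk⟩ := h
    -- A transition is leading for at most one edge, because the highest edges are distinct.
    rw [if_neg (fun h => h k hk), add_zero, Fintype.sum_eq_single k, if_pos hk]
    intro k' hne
    rw [if_neg]
    intro hk'
    exact hne (hier.edge_injective (fun _ => rfl) (augmented_saddle_comm hD hinv hrep) hθ
      (hk'.1.symm.trans hk.1))
  · push Not at h
    rw [if_pos h, Finset.sum_eq_zero fun k _ => if_neg (h k), zero_add]

/-- The Dirichlet form of the restricted generator is equivalent to the energy of the highest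
edges. -/
theorem dirichlet_form_bounds (hgap : D.IsGap χ rep θ) :
    ∃ C, 0 ≤ C ∧ ∀ ε : ℝ, 0 < ε → ∀ F : ActiveOrbit X χ → ℂ,
      (D.augmented χ rep).edgeForm e ε (extendNone F) ≤
        ∑ A : ActiveOrbit X χ, ∑ b ∈ Finset.univ.erase (rep A.1),
          D.orbitWeight rep ε A.1 b * pairEnergy χ rep F A b ∧
      ∑ A : ActiveOrbit X χ, ∑ b ∈ Finset.univ.erase (rep A.1),
          D.orbitWeight rep ε A.1 b * pairEnergy χ rep F A b ≤
        (1 + C * Real.exp (-θ / ε)) * (D.augmented χ rep).edgeForm e ε (extendNone F) := by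
  have hbad : ∀ (A : ActiveOrbit X χ) (b : X), ∃ K, 0 ≤ K ∧
      (b ≠ rep A.1 → (∀ k, ¬ IsLeading D χ rep e k A b) →
      ∀ ε : ℝ, 0 < ε → ∀ F : ActiveOrbit X χ → ℂ,
      D.orbitWeight rep ε A.1 b * pairEnergy χ rep F A b ≤
        K * Real.exp (-θ / ε) * (D.augmented χ rep).edgeForm e ε (extendNone F)) := by
    intro A b
    by_cases h : b ≠ rep A.1 ∧ ∀ k, ¬ IsLeading D χ rep e k A b
    · obtain ⟨K, hK, hb⟩ := energy_le_of_not_leading hD hinv hrep hgap hier hθ h.1 h.2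
      exact ⟨K, hK, fun _ _ => hb⟩
    · exact ⟨0, le_rfl, fun h1 h2 => absurd ⟨h1, h2⟩ h⟩
  choose K hK hb using hbad
  refine ⟨∑ A : ActiveOrbit X χ, ∑ b ∈ (Finset.univ.erase (rep A.1)).filter
    (fun b => ∀ k, ¬ IsLeading D χ rep e k A b), K A b,
    Finset.sum_nonneg fun A _ => Finset.sum_nonneg fun b _ => hK A b, fun ε hε F => ?_⟩
  rw [sum_energy_eq hD hinv hrep hier hθ]
  constructor
  · refine le_add_of_nonneg_right (Finset.sum_nonneg fun A _ => Finset.sum_nonneg fun b hb => ?_)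
    simp only [Finset.mem_filter, Finset.mem_erase] at hb
    exact mul_nonneg (orbitWeight_nonneg hD ε hb.1.1) (pairEnergy_nonneg hrep F A b)
  · rw [add_mul, one_mul]
    simp only [Finset.sum_mul]
    refine add_le_add le_rfl (Finset.sum_le_sum fun A _ => Finset.sum_le_sum fun b hb' => ?_)
    simp only [Finset.mem_filter, Finset.mem_erase] at hb'
    exact hb A b hb'.1.1 hb'.2 ε hε F

end JumpData

/-! ### Eigenvalues of the restricted generator. -/

namespace JumpData

open MulAction

variable {X G : Type*} [Fintype X] [Group G] [Fintype G] [MulAction G X] {D : JumpData X}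
  (hD : D.IsReversible) (hinv : D.IsInvariant G)
  {χ : G →* ℂˣ} {rep : orbitRel.Quotient G X → X} (hrep : ∀ A, orbitOf G (rep A) = A)
  {θ : ℝ≥0} {n : ℕ} {σ : Fin (n + 1) ≃ Option (ActiveOrbit X χ)}
  {e : Fin n → Option (ActiveOrbit X χ) × Option (ActiveOrbit X χ)}
  (hier : (D.augmented χ rep).IsMetastableHierarchy θ σ e) (hθ : 0 < θ)

theorem exists_equiv_of_zero {ι : Type*} (σ : Fin (n + 1) ≃ Option ι) (h0 : σ 0 = none) :
    ∃ τ : Fin n ≃ ι, ∀ i, σ i.succ = some (τ i) := by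
  refine ⟨Equiv.removeNone ((finSuccEquiv n).symm.trans σ), fun i => ?_⟩
  have h := Equiv.removeNone_some ((finSuccEquiv n).symm.trans σ) (x := i) (by
    rcases hx : ((finSuccEquiv n).symm.trans σ) (some i) with _ | y
    · simp only [Equiv.trans_apply, finSuccEquiv_symm_some] at hx
      exact absurd (σ.injective (hx.trans h0.symm)) (Fin.succ_ne_zero i)
    · exact ⟨y, rfl⟩)
  rw [h]
  simp

theorem kramersValue_eq {S : Type*} {D : JumpData S} {σ : Fin (n + 1) ≃ S} {e : Fin n → S × S}
    (hier : D.IsMetastableHierarchy θ σ e) (ε : ℝ) (k : Fin n) :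
    D.kramersValue σ e ε k = -kramersRate (fun k => D.c (e k).1 (e k).2)
      (fun k => (D.saddle (e k).1 (e k).2).toReal) (fun k => D.m (σ k.succ))
      (fun i => D.V (σ i)) ε k := by
  rw [kramersValue, arrhenius_of_ne_top (hier.commHeight_ne_top k), hier.commHeight_toReal,
    kramersRate]

include hD hinv hrep hier hθ in
/-- The eigenvalues of the restricted generator. -/
theorem exists_eigenvalues_restriction (hgap : D.IsGap χ rep θ) :
    ∃ C ε₀, 0 < C ∧ 0 < ε₀ ∧ ∀ (ε : ℝ) (hε : 0 < ε), ε < ε₀ → ∃ lam : Fin n → ℝ,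
      Function.Injective lam ∧
      (∀ k, ∃ x : isotypic X χ, x ≠ 0 ∧ restriction hinv χ hε x = (lam k : ℂ) • x) ∧
      ∀ k, |lam k - (D.augmented χ rep).kramersValue σ e ε k| ≤
        C * Real.exp (-θ / ε) * |(D.augmented χ rep).kramersValue σ e ε k| := by
  classical
  have : Fintype (ActiveOrbit X χ) := Fintype.ofFinite _
  have hsymm := augmented_saddle_comm (χ := χ) hD hinv hrep
  have ho : ∀ y, (D.augmented χ rep).h none y = ⊤ := fun _ => rfl
  have hc := edge_c_pos hD hinv hrep hier
  have h0 : σ 0 = none := hier.first_eq_absorbing ho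
  obtain ⟨τ, hτ⟩ := exists_equiv_of_zero σ h0
  obtain ⟨C₁, hC₁, hbounds⟩ := dirichlet_form_bounds hD hinv hrep hier hθ hgap
  have hm : ∀ i : Fin n, 0 < (D.augmented χ rep).m (σ i.succ) := fun i => augmented_m_pos hD _
  obtain ⟨C, ε₀, hC, hε₀, hmain⟩ := (hier.gapHierarchy ho hsymm hθ).exists_eigenvalues hc hm hC₁
  refine ⟨C, ε₀, hC, hε₀, fun ε hε hlt => ?_⟩
  -- Since `σ 0` is the cemetery, `σ` restricts to an enumeration `τ` of the active orbits, and
  -- extension by zero to the cemetery matches extension by zero at `0`.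
  set M := (restrictedMatrix D χ rep ε).submatrix τ τ with hM
  have hmul : ∀ (f : Fin n → ℂ) (i : Fin n), M.mulVec f i =
      (restrictedMatrix D χ rep ε).mulVec (f ∘ τ.symm) (τ i) := by
    intro f i
    rw [hM, Matrix.submatrix_mulVec_equiv]
    rfl
  have hform : ∀ f : Fin n → ℂ,
      -(∑ i, (((D.augmented χ rep).m (σ i.succ) *
        Real.exp (-((D.augmented χ rep).V (σ i.succ)) / ε) : ℝ) : ℂ) *
          (star (f i) * M.mulVec f i)).re =
      ∑ A : ActiveOrbit X χ, ∑ b ∈ Finset.univ.erase (rep A.1),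
        D.orbitWeight rep ε A.1 b * pairEnergy χ rep (f ∘ τ.symm) A b := by
    intro f
    rw [← dirichlet_form_eq hD hinv hrep hε, ← Equiv.sum_comp τ]
    congr 2
    refine Finset.sum_congr rfl fun i _ => ?_
    rw [hτ, hmul]
    simp
  have hext : ∀ f : Fin n → ℂ, treeForm (fun k => (D.augmented χ rep).c (e k).1 (e k).2)
      (fun k => ((D.augmented χ rep).saddle (e k).1 (e k).2).toReal)
      (fun k => σ.symm (e k).1) (fun k => σ.symm (e k).2) ε (extendZero f) =
      (D.augmented χ rep).edgeForm e ε (extendNone (f ∘ τ.symm)) := by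
    intro f
    rw [← treeForm_comp σ]
    congr 1
    ext i
    refine Fin.cases ?_ (fun j => ?_) i
    · simp [h0]
    · simp [hτ]
  obtain ⟨lam, hinj, hvec, hlam⟩ := hmain ε hε hlt M
    (fun i j => by rw [hτ, hτ]; exact restrictedMatrix_symm hrep hD hinv hε _ _)
    (fun f => by rw [hform, hext]; exact (hbounds ε hε _).1)
    (fun f => by rw [hform, hext]; exact (hbounds ε hε _).2)
  refine ⟨lam, hinj, fun k => ?_, fun k => ?_⟩
  · obtain ⟨f, hf, hfk⟩ := hvec k
    refine exists_eigenvector_restriction hrep hinv hε (F := f ∘ τ.symm) (fun h => hf ?_) ?_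
    · ext i
      have := congrFun h (τ i)
      simpa using this
    · ext A
      have := congrFun hfk (τ.symm A)
      rw [hmul, Equiv.apply_symm_apply] at this
      rw [this]
      simp
  · rw [kramersValue_eq hier, sub_neg_eq_add, abs_neg,
      abs_of_pos (kramersRate_pos hc hm k)]
    exact hlam k

end JumpData

end

theorem mainTheorem2 {X G : Type*} [Fintype X] [Group G] [Fintype G] [MulAction G X]
    (D : JumpData X) (hD : D.IsReversible) (hinv : D.IsInvariant G) (hnd : D.IsNondegenerate G)
    (χ : G →* ℂˣ) (hχ : χ ≠ 1)
    (rep : MulAction.orbitRel.Quotient G X → X) (hrep : ∀ A, orbitOf G (rep A) = A)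
    (θ : ℝ≥0) (hθ : 0 < θ) (hgap : D.IsGap χ rep θ)
    (σ : Fin (numActive X χ + 1) ≃ Option (ActiveOrbit X χ))
    (e : Fin (numActive X χ) → Option (ActiveOrbit X χ) × Option (ActiveOrbit X χ))
    (hhier : (D.augmented χ rep).IsMetastableHierarchy θ σ e) :
    σ 0 = none ∧
    ∃ C ε₀ : ℝ, 0 < C ∧ 0 < ε₀ ∧ ∀ (ε : ℝ) (hε : 0 < ε), ε < ε₀ →
      (∀ x y, x ≠ y →
        |‖D.augmentedMatrix χ rep ε x y‖ - (D.augmented χ rep).rate ε x y| ≤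
          C * Real.exp (-θ / ε) * (D.augmented χ rep).rate ε x y) ∧
      ∃ lam : Fin (numActive X χ) → ℝ,
        Function.Injective lam ∧
        spectrum ℂ (JumpData.restriction hinv χ hε) = Set.range (fun k => (lam k : ℂ)) ∧
        (∀ k, Module.finrank ℂ
          (Module.End.eigenspace (JumpData.restriction hinv χ hε) (lam k : ℂ)) = 1) ∧
        ∀ k, |lam k - (D.augmented χ rep).kramersValue σ e ε k| ≤
          C * Real.exp (-θ / ε) * |(D.augmented χ rep).kramersValue σ e ε k| := by
  refine ⟨hhier.first_eq_absorbing (fun _ => rfl), ?_⟩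
  obtain ⟨C₁, hC₁, h1⟩ := JumpData.augmentedMatrix_asymptotics hrep hD hinv hnd hgap
  obtain ⟨C₂, ε₀, hC₂, hε₀, h2⟩ :=
    JumpData.exists_eigenvalues_restriction hD hinv hrep hhier hθ hgap
  refine ⟨C₁ + C₂, ε₀, by positivity, hε₀, fun ε hε hlt => ⟨fun x y hxy => ?_, ?_⟩⟩
  · have h := h1 ε hε x y hxy
    have hr := JumpData.augmented_rate_nonneg (χ := χ) hD hinv hrep ε hxy
    refine h.trans ?_
    gcongr
    linarith
  · obtain ⟨lam, hinj, hvec, hlam⟩ := h2 ε hε hlt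
    -- The invariant subspace has dimension `numActive X χ`, so the distinct eigenvalues found so
    -- far leave no room for others.
    have hspec := Module.End.spectrum_eq_range_of_injective (JumpData.finrank_isotypic hrep)
      (L := JumpData.restriction hinv χ hε) (lam := fun k => (lam k : ℂ))
      (Complex.ofReal_injective.comp hinj) hvec
    refine ⟨lam, hinj, hspec.1, hspec.2, fun k => (hlam k).trans ?_⟩
    gcongr
    linarith
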